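/- Let $(X,\mu)$ be a $\sigma$-finite measure space, $L^r=L^r(X,\mu)$ the spaces of real-valued functions, and let $\alpha>0$, $p>1$ and $q\in[1,2]$. Write $\langle t\rangle=(1+t^2)^{1/2}$. Let $A$ be a non-negative self-adjoint operator on $L^2$, with spectral resolution $E_A$; for a Borel function $\varphi$ put $\varphi(A)=\int\varphi(\lambda)\,dE_A(\lambda)$. For $s\ge 0$ let $H^s(A)$ be the domain of $(I+A)^{s/2}$, with norm $\|f\|_{H^s(A)}=\|(I+A)^{s/2}f\|_{L^2}$. A bound on $\|e^{-tA}\|_{L^r\to L^{r'}}$ refers to $e^{-tA}$ on $L^2\cap L^r$. Assume: (A) there is a constant $C$ such that $\|e^{-tA}\|_{L^2\to L^\infty}\le C t^{-\alpha}$ for all $t>0$; (B) if $\alpha>1/2$, then for every $r$ with $\frac{4\alpha}{4\alpha-1}<r<4\alpha$ there is a constant $C_r$ such that $\|e^{-tA}\|_{L^r\to L^r}\le C_r$ and $\|e^{-tA}\|_{L^r\to L^\infty}\le C_r t^{-2\alpha/r}$ for all $t>0$. Let $F\in C^1(\mathbb R;\mathbb R)$ satisfy $F(0)=0$ and, for some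 constant $C$, $|F(z_1)-F(z_2)|\le C(|z_1|+|z_2|)^{p-1}|z_1-z_2|$ for all $z_1,z_2\in\mathbb R$. Assume moreover $$p>1+\frac1{2\alpha},\qquad \frac2p<2\alpha(p-1),\qquad q\in\Big[\max\{1,\tfrac2p\},\ \min\{2,2\alpha(p-1)\}\Big],$$ and $p\le\frac{2\alpha}{2\alpha-1}$ if $\alpha>1/2$. Let $\mathcal D(t,\lambda)=e^{-t/2}\,\dfrac{\sinh\big(t\sqrt{1/4-\lambda}\big)}{\sqrt{1/4-\lambda}}$ for $0\le\lambda<\frac14$, $\mathcal D(t,\frac14)=te^{-t/2}$, and $\mathcal D(t,\lambda)=e^{-t/2}\,\dfrac{\sin\big(t\sqrt{\lambda-1/4}\big)}{\sqrt{\lambda-1/4}}$ for $\lambda>\frac14$. A global mild solution of $$\partial_t^2u+Au+\partial_tu=F(u),\qquad (u(0),\partial_tu(0))=(u_0,u_1)\in H^1(A)\times L^2$$ is a function $u\in C([0,\infty);H^1(A))\cap C^1([0,\infty);L^2)$ such that $F(u(t))\in L^2$ and $$u(t)=\mathcal D(t,A)(u_0+u_1)+\partial_t\mathcal D(t,A)u_0+\int_0^t\mathcal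 D(t-\tau,A)F(u(\tau))\,d\tau\qquad\text{for all }t\ge0,$$ the integral being a Bochner integral in $L^2$. Then there are constants $\epsilon_0>0$ and $C>0$, independent of the initial data, such that for all $(u_0,u_1)\in(H^1(A)\cap L^q)\times(L^2\cap L^q)$ with $$I_0:=\|u_0\|_{L^q}+\|u_0\|_{H^1(A)}+\|u_1\|_{L^q}+\|u_1\|_{L^2}\le\epsilon_0$$ there is a unique global mild solution $u$; it satisfies $u(0)=u_0$, $\partial_tu(0)=u_1$, and for all $t>0$ $$\langle t\rangle^{2\alpha(\frac1q-\frac12)+1}(\log(2+t))^{-\delta}\|\partial_tu(t)\|_{L^2}+\langle t\rangle^{2\alpha(\frac1q-\frac12)+\frac12}\|A^{1/2}u(t)\|_{L^2}+\langle t\rangle^{2\alpha(\frac1q-\frac12)}\|u(t)\|_{L^2}\le C I_0,$$ where $\delta=0$ if $q<2\alpha(p-1)$ and $\delta=1$ if $q=2\alpha(p-1)$. -/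

import Mathlib

open MeasureTheory Set Filter Topology
open scoped ENNReal

noncomputable section

namespace DampedWave

section SpectralCalculus

variable {H : Type*} [NormedAddCommGroup H] [InnerProductSpace ℝ H] [CompleteSpace H]

variable (H) in
/-- A spectral resolution of the identity: a countably additive (in the strong operator topology)
multiplicative family of orthogonal projections, indexed by the Borel sets of the line. -/
structure ResolutionOfIdentity where
  proj : Set ℝ → (H →L[ℝ] H)
  isStarProjection : ∀ S, MeasurableSet S → IsStarProjection (proj S)
  proj_univ : proj univ = 1
  proj_inter : ∀ S T, MeasurableSet S → MeasurableSet T → proj (S ∩ T) = proj S * proj T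
  hasSum_proj : ∀ S : ℕ → Set ℝ, (∀ n, MeasurableSet (S n)) → Pairwise (Function.onFun Disjoint S) →
    ∀ f : H, HasSum (fun n => proj (S n) f) (proj (⋃ n, S n) f)

namespace ResolutionOfIdentity

variable (E : ResolutionOfIdentity H)

theorem proj_empty (f : H) : E.proj ∅ f = 0 := by
  have h := E.hasSum_proj (fun _ => ∅) (fun _ => MeasurableSet.empty)
    (fun _ _ _ => by simp [Function.onFun]) f
  have h' := h.summable.tendsto_atTop_zero
  exact tendsto_nhds_unique tendsto_const_nhds h'

theorem norm_sq_proj {S : Set ℝ} (hS : MeasurableSet S) (f : H) :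
    ‖E.proj S f‖ ^ 2 = inner ℝ (E.proj S f) f := by
  have h := E.isStarProjection S hS
  have h1 : E.proj S (E.proj S f) = E.proj S f := by
    rw [← mul_apply_eq_comp, h.isIdempotentElem.eq]
  have h2 := (h.isSelfAdjoint.isSymmetric) (E.proj S f) f
  simp only [ContinuousLinearMap.coe_coe] at h2
  rw [← real_inner_self_eq_norm_sq, ← h2, h1]

/-- The positive measure `d‖E(λ) f‖²`. -/
def measure (f : H) : Measure ℝ :=
  Measure.ofMeasurable (fun S _ => ENNReal.ofReal (‖E.proj S f‖ ^ 2))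
    (by simp [E.proj_empty])
    (by
      intro S hS hd
      have h := E.hasSum_proj S hS hd f
      have h2 := h.mapL (innerSL ℝ f)
      have h3 : HasSum (fun n => ‖E.proj (S n) f‖ ^ 2) (‖E.proj (⋃ n, S n) f‖ ^ 2) := by
        simp only [E.norm_sq_proj (hS _), E.norm_sq_proj (MeasurableSet.iUnion hS)]
        simpa [real_inner_comm] using h2
      rw [← h3.tsum_eq, ENNReal.ofReal_tsum_of_nonneg (fun n => by positivity) h3.summable])

/-- `f ∈ Dom (∫ φ dE)`, i.e. `∫ |φ(λ)|² d‖E(λ) f‖² < ∞`. -/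
def MemDom (φ : ℝ → ℝ) (f : H) : Prop :=
  ∫⁻ l, ENNReal.ofReal (φ l ^ 2) ∂(E.measure f) < ∞

/-- `f` lies in the domain of `∫ φ dE` and `v = (∫ φ dE) f`, i.e.
`⟪v, g⟫ = ∫ φ(λ) d⟪E(λ) f, g⟫` for all `g` in the (dense) domain; the measure
`d⟪E(λ) f, g⟫` is written out by polarization. -/
def IsApply (φ : ℝ → ℝ) (f v : H) : Prop :=
  E.MemDom φ f ∧ ∀ g, E.MemDom φ g →
    inner ℝ v g = (1 / 4) * (∫ l, φ l ∂(E.measure (f + g)) - ∫ l, φ l ∂(E.measure (f - g)))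

/-- `E` is the spectral resolution of the operator `A`, i.e. `A = ∫ λ dE(λ)`, domains included. -/
def IsResolutionOf (A : H →ₗ.[ℝ] H) : Prop :=
  ∀ f v : H, (f, v) ∈ A.graph ↔ E.IsApply (fun l => l) f v

open Classical in
/-- The resolution concentrated at `0` (the one of the zero operator). -/
instance : Nonempty (ResolutionOfIdentity H) :=
  ⟨{ proj := fun S => if (0 : ℝ) ∈ S then 1 else 0
     isStarProjection := fun S _ => by
       split_ifs
       · exact IsStarProjection.one _
       · exact IsStarProjection.zero _
     proj_univ := by simp
     proj_inter := fun S T _ _ => by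
       by_cases h1 : (0 : ℝ) ∈ S <;> by_cases h2 : (0 : ℝ) ∈ T <;> simp [h1, h2]
     hasSum_proj := fun S _ hd f => by
       by_cases h : (0 : ℝ) ∈ ⋃ n, S n
       · obtain ⟨k, hk⟩ := mem_iUnion.1 h
         have h0 : ∀ n, n ≠ k → (0 : ℝ) ∉ S n := fun n hn hm =>
           (Set.disjoint_left.1 (hd hn)) hm hk
         have := hasSum_single (f := fun n => (if (0 : ℝ) ∈ S n then (1 : H →L[ℝ] H) else 0) f) k
           (fun n hn => by simp [h0 n hn])
         simpa [h, hk] using this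
       · have h0 : ∀ n, (0 : ℝ) ∉ S n := fun n hn => h (mem_iUnion.2 ⟨n, hn⟩)
         simp only [h, h0, if_false]
         simp }⟩

end ResolutionOfIdentity

/-- The spectral resolution `E_A` of a self-adjoint operator `A` (it exists and is unique by the
spectral theorem; the value is irrelevant if `A` is not self-adjoint). -/
def resolution (A : H →ₗ.[ℝ] H) : ResolutionOfIdentity H :=
  Classical.epsilon fun E => E.IsResolutionOf A

/-- `f ∈ Dom (φ(A))`. -/
def MemDom (A : H →ₗ.[ℝ] H) (φ : ℝ → ℝ) (f : H) : Prop :=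
  (resolution A).MemDom φ f

/-- `φ(A) f = ∫ φ(λ) dE_A(λ) f` for `f ∈ Dom (φ(A))`; the value outside the domain is not used. -/
def funcCalc (A : H →ₗ.[ℝ] H) (φ : ℝ → ℝ) (f : H) : H :=
  Classical.epsilon fun v => (resolution A).IsApply φ f v

/-- The heat semigroup `e^{-tA}`. -/
def heat (A : H →ₗ.[ℝ] H) (t : ℝ) : H → H :=
  funcCalc A fun l => Real.exp (-t * l)

/-- `f ∈ H^s(A)`. -/
def MemSobolev (A : H →ₗ.[ℝ] H) (s : ℝ) (f : H) : Prop :=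
  MemDom A (fun l => (1 + l) ^ (s / 2)) f

/-- `‖f‖_{H^s(A)} = ‖(I + A)^{s/2} f‖`. -/
def sobolevNorm (A : H →ₗ.[ℝ] H) (s : ℝ) (f : H) : ℝ :=
  ‖funcCalc A (fun l => (1 + l) ^ (s / 2)) f‖

/-- `A^{1/2} f`. -/
def sqrtOp (A : H →ₗ.[ℝ] H) : H → H :=
  funcCalc A fun l => l ^ (1 / 2 : ℝ)

/-- The symbol `𝒟(t, λ)` of the linear damped wave propagator. -/
def dSymbol (t l : ℝ) : ℝ :=
  if l < 1 / 4 then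
    Real.exp (-t / 2) * Real.sinh (t * √(1 / 4 - l)) / √(1 / 4 - l)
  else if l = 1 / 4 then t * Real.exp (-t / 2)
  else Real.exp (-t / 2) * Real.sin (t * √(l - 1 / 4)) / √(l - 1 / 4)

/-- `𝒟(t, A)`. -/
def propD (A : H →ₗ.[ℝ] H) (t : ℝ) : H → H :=
  funcCalc A fun l => dSymbol t l

/-- `∂ₜ𝒟(t, A)`. -/
def propDt (A : H →ₗ.[ℝ] H) (t : ℝ) : H → H :=
  funcCalc A fun l => deriv (fun s => dSymbol s l) t

/-- The solution `u_L(t) = 𝒟(t, A)(u₀ + u₁) + ∂ₜ𝒟(t, A) u₀` of the linear problem. -/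
def linearSol (A : H →ₗ.[ℝ] H) (u₀ u₁ : H) (t : ℝ) : H :=
  propD A t (u₀ + u₁) + propDt A t u₀

/-- `u ∈ C(J; H^s(A))`. -/
def ContinuousInSobolev (A : H →ₗ.[ℝ] H) (s : ℝ) (u : ℝ → H) (J : Set ℝ) : Prop :=
  (∀ t ∈ J, MemSobolev A s (u t)) ∧
    ∀ t ∈ J, Tendsto (fun τ => sobolevNorm A s (u τ - u t)) (𝓝[J] t) (𝓝 0)

end SpectralCalculus

section Equation

variable {X : Type*} [MeasurableSpace X] {μ : Measure X}

/-- `‖T‖_{L^q → L^r} ≤ K` for an operator `T` given on `L²`: the bound on `L² ∩ L^q`. -/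
def OpNormLE (T : Lp ℝ 2 μ → Lp ℝ 2 μ) (q r : ℝ≥0∞) (K : ℝ) : Prop :=
  ∀ f : Lp ℝ 2 μ, MemLp f q μ → eLpNorm (T f) r μ ≤ ENNReal.ofReal K * eLpNorm f q μ

/-- `A` is a non-negative self-adjoint operator on `L²(X)` and
`‖e^{-tA}‖_{L² → L^∞} ≲ t^{-α}` for `t > 0`, where `α > 0`. -/
structure AssumptionA (A : Lp ℝ 2 μ →ₗ.[ℝ] Lp ℝ 2 μ) (α : ℝ) : Prop where
  selfAdjoint : IsSelfAdjoint A
  nonneg : ∀ f : A.domain, 0 ≤ inner ℝ (A f) (f : Lp ℝ 2 μ)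
  alpha_pos : 0 < α
  ultracontractive : ∃ C : ℝ, ∀ t : ℝ, 0 < t → OpNormLE (heat A t) 2 ∞ (C * t ^ (-α))

/-- If `α > 1/2`, then `‖e^{-tA}‖_{L^q → L^q} ≲ 1` and `‖e^{-tA}‖_{L^q → L^∞} ≲ t^{-2α/q}` for
`t > 0`, for every `4α/(4α-1) < q < 4α`. -/
def AssumptionB (A : Lp ℝ 2 μ →ₗ.[ℝ] Lp ℝ 2 μ) (α : ℝ) : Prop :=
  1 / 2 < α → ∀ q : ℝ, 4 * α / (4 * α - 1) < q → q < 4 * α →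
    (∃ C : ℝ, ∀ t : ℝ, 0 < t → OpNormLE (heat A t) (ENNReal.ofReal q) (ENNReal.ofReal q) C) ∧
    (∃ C : ℝ, ∀ t : ℝ, 0 < t →
      OpNormLE (heat A t) (ENNReal.ofReal q) ∞ (C * t ^ (-(2 * α / q))))

/-- The nonlinearity: `F(0) = 0`, `F ∈ C¹(ℝ)` and
`|F(z₁) - F(z₂)| ≤ C (|z₁| + |z₂|)^{p-1} |z₁ - z₂|`. -/
structure IsNonlinearity (F : ℝ → ℝ) (p : ℝ) : Prop where
  map_zero : F 0 = 0
  contDiff : ContDiff ℝ 1 F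
  lipschitz : ∃ C : ℝ, ∀ z₁ z₂ : ℝ, |F z₁ - F z₂| ≤ C * (|z₁| + |z₂|) ^ (p - 1) * |z₁ - z₂|

open Classical in
/-- `F(f)` as an element of `L²(X)` (only used where `F ∘ f` is square integrable). -/
def superpose (F : ℝ → ℝ) (f : Lp ℝ 2 μ) : Lp ℝ 2 μ :=
  if h : MemLp (fun x => F (f x)) 2 μ then h.toLp _ else 0

/-- Mild solutions of `∂ₜ² u + A u + ∂ₜ u = F(u)` on a time interval `J = [0, T]` or `J = [0, ∞)`
with data `(u₀, u₁)`: `u ∈ C(J; H¹(A)) ∩ C¹(J; L²(X))` and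
`u(t) = u_L(t) + ∫₀ᵗ 𝒟(t-τ, A) F(u(τ)) dτ` for `t ∈ J`, the integral being a convergent Bochner
integral in `L²(X)`. -/
structure IsMildSolution (A : Lp ℝ 2 μ →ₗ.[ℝ] Lp ℝ 2 μ) (F : ℝ → ℝ) (u₀ u₁ : Lp ℝ 2 μ)
    (J : Set ℝ) (u : ℝ → Lp ℝ 2 μ) : Prop where
  continuous_sobolev : ContinuousInSobolev A 1 u J
  contDiffOn : ContDiffOn ℝ 1 u J
  memLp : ∀ t ∈ J, MemLp (fun x => F (u t x)) 2 μ
  integrable : ∀ t ∈ J,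
    IntervalIntegrable (fun τ => propD A (t - τ) (superpose F (u τ))) volume 0 t
  duhamel : ∀ t ∈ J,
    u t = linearSol A u₀ u₁ t + ∫ τ in (0 : ℝ)..t, propD A (t - τ) (superpose F (u τ))

/-- `I₀ = ‖u₀‖_{L^q} + ‖u₀‖_{H¹(A)} + ‖u₁‖_{L^q} + ‖u₁‖_{L²}`. -/
def dataSize (A : Lp ℝ 2 μ →ₗ.[ℝ] Lp ℝ 2 μ) (q : ℝ) (u₀ u₁ : Lp ℝ 2 μ) : ℝ :=
  (eLpNorm u₀ (ENNReal.ofReal q) μ).toReal + sobolevNorm A 1 u₀ +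
    (eLpNorm u₁ (ENNReal.ofReal q) μ).toReal + ‖u₁‖

/-- `⟨t⟩ = (1 + t²)^{1/2}`. -/
def japanese (t : ℝ) : ℝ := √(1 + t ^ 2)

end Equation

end DampedWave

end

open DampedWave

/-! ### Functional calculus of a resolution of the identity -/

noncomputable section

namespace DampedWave

namespace ResolutionOfIdentity

variable {H : Type*} [NormedAddCommGroup H] [InnerProductSpace ℝ H] [CompleteSpace H]
variable (E : ResolutionOfIdentity H)

/-! The equation is solved as a Volterra equation in `L²` for `w = (1 + A)^{1/2} u`, so that `u = (1
+ A)^{-1/2} w` and the `H¹(A)` norm of `u` is the `L²` norm of `w`. The argument rests on four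
ingredients.

Spectrum. The `L² → L^∞` bound forces `E_A((-∞, 0]) = 0` (`proj_Iic_zero`): on nonpositive
frequencies `e^{-tA}` does not shrink vectors, while its sup norm bound tends to zero. All symbols
therefore need control on `λ > 0` only. The same bound gives Bernstein's inequality on frequency
bands and, by duality and interpolation, the `L^r → L²` rate `t^{-2α(1/r - 1/2)}` for `1 ≤ r ≤ 2`
(`norm_heat_le`).

Linear decay. On low frequencies `𝒟(t, λ)` is dominated by `e^{-tλ}`, because `√(1/4 - λ) - 1/2 ≤
-λ`; on the others it decays exponentially. Up to constants it is bounded by `gSymbol`. Applying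
`A^{1/2}` gains `(1 + t)^{-1/2}` and a time derivative gains `(1 + t)^{-1}`. Comparison of symbols
on the spectral side turns these pointwise bounds into operator bounds (`exists_norm_op_le`,
`exists_norm_op_sobolev_le`).

Nonlinear decay. A Gagliardo–Nirenberg inequality bounds the `L^{2p}` norm by the `L²` norms of `u`
and `A^{1/2} u` (`lintegral_rpow_le`). It is proved by cutting each level set `|f| > t` at a
frequency depending on `t`: the low part is below `t/2` in sup norm, the high part is treated by
Chebyshev, and integration in `t` gives back `∫ λ d‖E f‖²`. This covers the Sobolev endpoint `s =
1`. Interpolation with `L²` yields the decay of `F(u)` in `L^r` for `2/p ≤ r ≤ 2`.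

Duhamel. Put `κ = 2α(p - 1)/q ≥ 1`. The time integral is cut at `t/2`: the early half uses `L^r →
L²` smoothing, the late half only `L²` bounds. If `κ > 1` one takes `r = q`; if `κ = 1`, a smaller
`r` trades integrability of the source for extra smoothing and avoids a logarithm. The late half
produces a logarithm only for `κ = 1` and a propagator of rate `1`, that is, for `∂ₜu`.

For small data the decay bounds on `u` and `A^{1/2} u` thus define an invariant family of closed
sets. Picard iteration stays in it and converges in an exponentially weighted norm, since the
nonlinearity is Lipschitz on bounded sets; no contraction in the decay norm is needed. The same
weighted estimate gives uniqueness among all mild solutions. The decay of `∂ₜu` is read off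
afterwards from the differentiated Duhamel formula. -/

theorem measure_apply {S : Set ℝ} (hS : MeasurableSet S) (f : H) :
    E.measure f S = ENNReal.ofReal (‖E.proj S f‖ ^ 2) :=
  Measure.ofMeasurable_apply S hS

instance isFiniteMeasure_measure (f : H) : IsFiniteMeasure (E.measure f) :=
  ⟨by rw [E.measure_apply MeasurableSet.univ]; exact ENNReal.ofReal_lt_top⟩

theorem measureReal_apply {S : Set ℝ} (hS : MeasurableSet S) (f : H) :
    (E.measure f).real S = ‖E.proj S f‖ ^ 2 := by
  rw [Measure.real, E.measure_apply hS, ENNReal.toReal_ofReal (by positivity)]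

theorem proj_union {S T : Set ℝ} (hS : MeasurableSet S) (hT : MeasurableSet T)
    (hd : Disjoint S T) : E.proj (S ∪ T) = E.proj S + E.proj T := by
  ext f
  let U : ℕ → Set ℝ := fun n => if n = 0 then S else if n = 1 then T else ∅
  have hU : (⋃ n, U n) = S ∪ T := by
    ext x
    simp only [mem_iUnion, mem_union, U]
    constructor
    · rintro ⟨n, hn⟩
      split_ifs at hn <;> simp_all
    · rintro (h | h)
      · exact ⟨0, by simpa using h⟩
      · exact ⟨1, by simpa using h⟩
  have h := E.hasSum_proj U (fun n => by simp only [U]; split_ifs <;> simp [hS, hT])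
    (fun i j hij => by
      simp only [Function.onFun, U]
      split_ifs <;> simp_all [disjoint_comm]) f
  rw [hU] at h
  have h' := hasSum_sum_of_ne_finset_zero (L := SummationFilter.unconditional ℕ)
    (f := fun n => E.proj (U n) f) (s := Finset.range 2) (fun n hn => by
      have h0 : n ≠ 0 := by rintro rfl; simp at hn
      have h1 : n ≠ 1 := by rintro rfl; simp at hn
      simp [U, h0, h1, E.proj_empty])
  rw [h.unique h']
  simp [Finset.sum_range_succ, U]

theorem inner_proj_left {S : Set ℝ} (hS : MeasurableSet S) (f g : H) :
    inner ℝ (E.proj S f) g = inner ℝ f (E.proj S g) :=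
  (E.isStarProjection S hS).isSelfAdjoint.isSymmetric f g

theorem norm_proj_apply_le {S : Set ℝ} (hS : MeasurableSet S) (f : H) : ‖E.proj S f‖ ≤ ‖f‖ := by
  have h := E.norm_sq_proj hS f
  have h2 := real_inner_le_norm (E.proj S f) f
  rcases (norm_nonneg (E.proj S f)).eq_or_lt with h0 | h0
  · rw [← h0]; positivity
  · nlinarith

theorem measureReal_univ (f : H) : (E.measure f).real univ = ‖f‖ ^ 2 := by
  rw [E.measureReal_apply MeasurableSet.univ, E.proj_univ]; simp

/-- `∫ s dE` for a simple function `s`. -/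
def simpleOp (s : SimpleFunc ℝ ℝ) : H →L[ℝ] H :=
  s.setToSimpleFunc fun S => ContinuousLinearMap.toSpanSingleton ℝ (E.proj S)

theorem finMeasAdditive_proj :
    FinMeasAdditive (0 : Measure ℝ)
      (fun S => ContinuousLinearMap.toSpanSingleton ℝ (E.proj S)) := by
  intro S T hS hT _ _ hd
  ext x
  simp [E.proj_union hS hT hd]

theorem simpleOp_add (s t : SimpleFunc ℝ ℝ) :
    E.simpleOp (s + t) = E.simpleOp s + E.simpleOp t :=
  SimpleFunc.setToSimpleFunc_add _ E.finMeasAdditive_proj (by simp) (by simp)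

theorem simpleOp_sub (s t : SimpleFunc ℝ ℝ) :
    E.simpleOp (s - t) = E.simpleOp s - E.simpleOp t := by
  rw [eq_sub_iff_add_eq, ← simpleOp_add]; congr 1; ext; simp

theorem simpleOp_indicator (c : ℝ) {S : Set ℝ} (hS : MeasurableSet S) :
    E.simpleOp (SimpleFunc.piecewise S hS (SimpleFunc.const _ c) (SimpleFunc.const _ 0)) =
      c • E.proj S := by
  rw [simpleOp, SimpleFunc.setToSimpleFunc_indicator _ (by ext; simp [E.proj_empty])]
  simp

/-- By bilinearity this reduces to indicators, where it is `proj_inter`. Together with symmetry it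
gives the isometry `norm_sq_simpleOp`, on which every limit below depends. -/
theorem simpleOp_mul (s t : SimpleFunc ℝ ℝ) :
    E.simpleOp (s * t) = E.simpleOp s * E.simpleOp t := by
  induction s using SimpleFunc.induction with
  | const c hS =>
    rename_i S
    induction t using SimpleFunc.induction with
    | const d hT =>
      rename_i T
      rw [E.simpleOp_indicator, E.simpleOp_indicator, smul_mul_smul_comm, ← E.proj_inter _ _ hS hT,
        ← E.simpleOp_indicator _ (hS.inter hT)]
      congr 1
      ext x
      by_cases h1 : x ∈ S <;> by_cases h2 : x ∈ T <;> simp [h1, h2]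
    | add h ht ht' => rw [mul_add, E.simpleOp_add, ht, ht', E.simpleOp_add, mul_add]
  | add h hs hs' => rw [add_mul, E.simpleOp_add, hs, hs', E.simpleOp_add, add_mul]

theorem inner_simpleOp_left (s : SimpleFunc ℝ ℝ) (f g : H) :
    inner ℝ (E.simpleOp s f) g = inner ℝ f (E.simpleOp s g) := by
  induction s using SimpleFunc.induction with
  | const c hS =>
    rw [E.simpleOp_indicator]
    simp [inner_smul_left, inner_smul_right, E.inner_proj_left hS]
  | add h hs hs' => simp [E.simpleOp_add, inner_add_left, inner_add_right, hs, hs']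

theorem integrable_simpleFunc (s : SimpleFunc ℝ ℝ) (f : H) : Integrable s (E.measure f) :=
  SimpleFunc.integrable_of_isFiniteMeasure s

theorem inner_simpleOp_self (s : SimpleFunc ℝ ℝ) (f : H) :
    inner ℝ (E.simpleOp s f) f = ∫ l, s l ∂(E.measure f) := by
  induction s using SimpleFunc.induction with
  | const c hS =>
    rename_i S
    rw [E.simpleOp_indicator]
    simp only [SimpleFunc.coe_piecewise, SimpleFunc.coe_const, Function.const_zero,
      piecewise_eq_indicator]
    rw [integral_indicator hS]
    simp [inner_smul_left, E.measureReal_apply hS, E.norm_sq_proj hS, mul_comm]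
  | add h hs hs' =>
    simp only [E.simpleOp_add, add_apply, inner_add_left, hs, hs', SimpleFunc.coe_add,
      Pi.add_apply]
    rw [integral_add (E.integrable_simpleFunc _ f) (E.integrable_simpleFunc _ f)]

theorem norm_sq_simpleOp (s : SimpleFunc ℝ ℝ) (f : H) :
    ‖E.simpleOp s f‖ ^ 2 = ∫ l, s l ^ 2 ∂(E.measure f) := by
  rw [← real_inner_self_eq_norm_sq, E.inner_simpleOp_left, real_inner_comm,
    ← mul_apply_eq_comp, ← E.simpleOp_mul, E.inner_simpleOp_self]
  simp [sq]

theorem inner_simpleOp (s : SimpleFunc ℝ ℝ) (f g : H) :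
    inner ℝ (E.simpleOp s f) g =
      (1 / 4) * (∫ l, s l ∂(E.measure (f + g)) - ∫ l, s l ∂(E.measure (f - g))) := by
  rw [← E.inner_simpleOp_self, ← E.inner_simpleOp_self]
  simp only [map_add, map_sub, inner_add_left, inner_add_right, inner_sub_left, inner_sub_right]
  rw [E.inner_simpleOp_left s g f, real_inner_comm]
  ring

theorem memDom_iff {φ : ℝ → ℝ} (hφ : Measurable φ) (f : H) :
    E.MemDom φ f ↔ MemLp φ 2 (E.measure f) := by
  rw [memLp_two_iff_integrable_sq hφ.aestronglyMeasurable, MemDom, Integrable,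
    and_iff_right (hφ.pow_const 2).aestronglyMeasurable,
    hasFiniteIntegral_iff_ofReal (ae_of_all _ fun x => by positivity)]

/-- The spectral measure is quadratic in the vector, so only `‖a + b‖² ≤ 2‖a‖² + 2‖b‖²` is
available; it suffices to make the domains linear. -/
theorem measure_add_le (f g : H) :
    E.measure (f + g) ≤ (2 : ℝ≥0∞) • E.measure f + (2 : ℝ≥0∞) • E.measure g := by
  refine Measure.le_iff.2 fun S hS => ?_
  simp only [Measure.add_apply, Measure.smul_apply, smul_eq_mul, E.measure_apply hS]
  have h2 : (2 : ℝ≥0∞) = ENNReal.ofReal 2 := by simp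
  rw [h2, ← ENNReal.ofReal_mul (by norm_num), ← ENNReal.ofReal_mul (by norm_num),
    ← ENNReal.ofReal_add (by positivity) (by positivity)]
  refine ENNReal.ofReal_le_ofReal ?_
  rw [map_add]
  have := norm_add_le (E.proj S f) (E.proj S g)
  have h3 := norm_nonneg (E.proj S f + E.proj S g)
  nlinarith [sq_nonneg (‖E.proj S f‖ - ‖E.proj S g‖)]

theorem measure_smul (c : ℝ) (f : H) :
    E.measure (c • f) = ENNReal.ofReal (c ^ 2) • E.measure f := by
  refine Measure.ext fun S hS => ?_
  simp only [Measure.smul_apply, smul_eq_mul, E.measure_apply hS]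
  rw [← ENNReal.ofReal_mul (by positivity), map_smul, norm_smul, mul_pow, Real.norm_eq_abs, sq_abs]

variable {E} in
theorem MemDom.add {φ : ℝ → ℝ} {f g : H} (hf : E.MemDom φ f) (hg : E.MemDom φ g) :
    E.MemDom φ (f + g) := by
  refine (lintegral_mono' (E.measure_add_le f g) le_rfl).trans_lt ?_
  rw [lintegral_add_measure, lintegral_smul_measure, lintegral_smul_measure]
  exact ENNReal.add_lt_top.2 ⟨ENNReal.mul_lt_top (by simp) hf, ENNReal.mul_lt_top (by simp) hg⟩

variable {E} in
theorem MemDom.smul {φ : ℝ → ℝ} {f : H} (c : ℝ) (hf : E.MemDom φ f) : E.MemDom φ (c • f) := by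
  unfold MemDom
  rw [E.measure_smul, lintegral_smul_measure]
  exact ENNReal.mul_lt_top (by simp) hf

variable {E} in
theorem MemDom.sub {φ : ℝ → ℝ} {f g : H} (hf : E.MemDom φ f) (hg : E.MemDom φ g) :
    E.MemDom φ (f - g) := by
  rw [sub_eq_add_neg, ← neg_one_smul ℝ g]
  exact hf.add (hg.smul _)

/-- Simple functions approximating `φ`. -/
def approx {φ : ℝ → ℝ} (hφ : Measurable φ) (n : ℕ) : SimpleFunc ℝ ℝ :=
  SimpleFunc.approxOn φ hφ univ 0 (mem_univ 0) n

theorem abs_approx_le {φ : ℝ → ℝ} (hφ : Measurable φ) (n : ℕ) (l : ℝ) :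
    |approx hφ n l| ≤ 2 * |φ l| := by
  have := SimpleFunc.norm_approxOn_zero_le hφ (mem_univ 0) l n
  rw [Real.norm_eq_abs, Real.norm_eq_abs] at this
  simp only [approx]
  linarith

theorem tendsto_approx {φ : ℝ → ℝ} (hφ : Measurable φ) (l : ℝ) :
    Tendsto (fun n => approx hφ n l) atTop (𝓝 (φ l)) :=
  SimpleFunc.tendsto_approxOn hφ (mem_univ 0) (by simp)

open Classical in
/-- `(∫ φ dE) f` as a limit of integrals of simple functions. -/
def app (φ : ℝ → ℝ) (f : H) : H :=
  if hφ : Measurable φ then limUnder atTop fun n => E.simpleOp (approx hφ n) f else 0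

theorem tendsto_integral_sq_sub {φ ψ : ℝ → ℝ} {s : ℕ → ℝ → ℝ} {ν : Measure ℝ}
    (hψ : MemLp ψ 2 ν) (hs : ∀ n, Measurable (s n))
    (hb : ∀ n, ∀ᵐ l ∂ν, |s n l - φ l| ≤ |ψ l|) (hφ : Measurable φ)
    (ht : ∀ᵐ l ∂ν, Tendsto (fun n => s n l) atTop (𝓝 (φ l))) :
    Tendsto (fun n => ∫ l, (s n l - φ l) ^ 2 ∂ν) atTop (𝓝 0) := by
  have h0 : (0 : ℝ) = ∫ _, (0 : ℝ) ∂ν := by simp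
  rw [h0]
  refine tendsto_integral_of_dominated_convergence (fun l => ψ l ^ 2)
    (fun n => (((hs n).sub hφ).pow_const 2).aestronglyMeasurable) hψ.integrable_sq ?_ ?_
  · intro n
    filter_upwards [hb n] with l hl
    rw [Real.norm_eq_abs, abs_pow, ← sq_abs (ψ l)]
    gcongr
  · filter_upwards [ht] with l hl
    have := (hl.sub_const (φ l)).pow 2
    simpa using this

/-- By the isometry, the distance between two approximants is an `L²` distance for the spectral
measure of `f`, and there the simple functions converge by domination. -/
theorem tendsto_simpleOp_approx {φ : ℝ → ℝ} (hφ : Measurable φ) {f : H} (hf : E.MemDom φ f) :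
    Tendsto (fun n => E.simpleOp (approx hφ n) f) atTop (𝓝 (E.app φ f)) := by
  have hL := (E.memDom_iff hφ f).1 hf
  have hcau : CauchySeq fun n => E.simpleOp (approx hφ n) f := by
    have key := tendsto_integral_sq_sub (φ := φ) (ψ := fun l => 3 * φ l)
      (s := fun n => approx hφ n) (ν := E.measure f) (hL.const_mul 3)
      (fun n => (approx hφ n).measurable) (fun n => ae_of_all _ fun l => by
        have h1 := abs_approx_le hφ n l
        have h2 := abs_sub (approx hφ n l) (φ l)
        rw [abs_mul, abs_of_pos (by norm_num : (0 : ℝ) < 3)]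
        linarith) hφ (ae_of_all _ fun l => tendsto_approx hφ l)
    have hint : ∀ n, Integrable (fun l => (approx hφ n l - φ l) ^ 2) (E.measure f) := fun n =>
      (MemLp.sub (SimpleFunc.memLp_of_isFiniteMeasure (approx hφ n) 2 (E.measure f))
        hL).integrable_sq
    rw [Metric.cauchySeq_iff]
    intro ε hε
    obtain ⟨N, hN⟩ := Metric.tendsto_atTop.1 key (ε ^ 2 / 4) (by positivity)
    refine ⟨N, fun m hm n hn => ?_⟩
    have h1 := hN m hm
    have h2 := hN n hn
    rw [Real.dist_eq, sub_zero] at h1 h2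
    have h3 : ‖E.simpleOp (approx hφ m) f - E.simpleOp (approx hφ n) f‖ ^ 2 < ε ^ 2 := by
      rw [← sub_apply, ← E.simpleOp_sub, E.norm_sq_simpleOp]
      calc ∫ l, (approx hφ m - approx hφ n) l ^ 2 ∂(E.measure f)
          ≤ ∫ l, (2 * (approx hφ m l - φ l) ^ 2 + 2 * (approx hφ n l - φ l) ^ 2)
              ∂(E.measure f) := by
            refine integral_mono ?_ (((hint m).const_mul 2).add ((hint n).const_mul 2)) fun l => ?_
            · exact (SimpleFunc.memLp_of_isFiniteMeasure (approx hφ m - approx hφ n) 2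
                (E.measure f)).integrable_sq
            · simp only [SimpleFunc.coe_sub, Pi.sub_apply]
              nlinarith [sq_nonneg ((approx hφ m l - φ l) + (approx hφ n l - φ l))]
        _ < ε ^ 2 := by
            rw [integral_add ((hint m).const_mul 2) ((hint n).const_mul 2),
              integral_const_mul, integral_const_mul]
            linarith [(abs_lt.1 h1).2, (abs_lt.1 h2).2]
    rw [dist_eq_norm]
    exact lt_of_pow_lt_pow_left₀ 2 hε.le h3
  rw [app, dif_pos hφ]
  exact hcau.tendsto_limUnder

theorem norm_sq_app_sub_simpleOp {φ : ℝ → ℝ} (hφ : Measurable φ) {f : H} (hf : E.MemDom φ f)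
    (s : SimpleFunc ℝ ℝ) :
    ‖E.app φ f - E.simpleOp s f‖ ^ 2 = ∫ l, (φ l - s l) ^ 2 ∂(E.measure f) := by
  have hL := (E.memDom_iff hφ f).1 hf
  have h1 := (((E.tendsto_simpleOp_approx hφ hf).sub_const (E.simpleOp s f)).norm.pow 2)
  refine tendsto_nhds_unique h1 ?_
  simp_rw [← sub_apply, ← E.simpleOp_sub, E.norm_sq_simpleOp]
  refine tendsto_integral_of_dominated_convergence (fun l => (2 * |φ l| + |s l|) ^ 2)
    (fun n => ((approx hφ n - s).measurable.pow_const 2).aestronglyMeasurable)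
    ((hL.abs.const_mul 2).add
      (SimpleFunc.memLp_of_isFiniteMeasure s 2 (E.measure f)).abs).integrable_sq ?_ ?_
  · refine fun n => ae_of_all _ fun l => ?_
    rw [Real.norm_eq_abs, abs_pow]
    gcongr
    exact (abs_sub _ _).trans (by gcongr; exact abs_approx_le hφ n l)
  · exact ae_of_all _ fun l => (((tendsto_approx hφ l).sub_const (s l)).pow 2)

theorem memDom_simpleFunc (s : SimpleFunc ℝ ℝ) (f : H) : E.MemDom s f :=
  (E.memDom_iff s.measurable f).2 (SimpleFunc.memLp_of_isFiniteMeasure s 2 _)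

theorem app_simpleFunc (s : SimpleFunc ℝ ℝ) (f : H) : E.app s f = E.simpleOp s f := by
  have h := E.norm_sq_app_sub_simpleOp s.measurable (E.memDom_simpleFunc s f) s
  simpa [sub_eq_zero] using h

/-- A sequence of simple functions converging in `L²(d‖E f‖²)` computes `app`. -/
theorem tendsto_simpleOp {φ : ℝ → ℝ} (hφ : Measurable φ) {f : H} (hf : E.MemDom φ f)
    {s : ℕ → SimpleFunc ℝ ℝ}
    (hs : Tendsto (fun n => ∫ l, (s n l - φ l) ^ 2 ∂(E.measure f)) atTop (𝓝 0)) :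
    Tendsto (fun n => E.simpleOp (s n) f) atTop (𝓝 (E.app φ f)) := by
  rw [tendsto_iff_norm_sub_tendsto_zero]
  have h : ∀ n, ‖E.simpleOp (s n) f - E.app φ f‖ = √(∫ l, (s n l - φ l) ^ 2 ∂(E.measure f)) := by
    intro n
    rw [norm_sub_rev, ← Real.sqrt_sq (norm_nonneg (E.app φ f - _)),
      E.norm_sq_app_sub_simpleOp hφ hf]
    congr 2
    ext l; ring
  simp_rw [h]
  simpa using hs.sqrt

theorem norm_sq_app {φ : ℝ → ℝ} (hφ : Measurable φ) {f : H} (hf : E.MemDom φ f) :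
    ‖E.app φ f‖ ^ 2 = ∫ l, φ l ^ 2 ∂(E.measure f) := by
  have h := E.norm_sq_app_sub_simpleOp hφ hf 0
  have h0 : E.simpleOp 0 f = 0 := by
    have := E.norm_sq_simpleOp 0 f
    simpa using this
  simpa [h0] using h

theorem app_add_vec {φ : ℝ → ℝ} (hφ : Measurable φ) {f g : H} (hf : E.MemDom φ f)
    (hg : E.MemDom φ g) : E.app φ (f + g) = E.app φ f + E.app φ g := by
  refine tendsto_nhds_unique (E.tendsto_simpleOp_approx hφ (hf.add hg)) ?_
  simp_rw [map_add]
  exact (E.tendsto_simpleOp_approx hφ hf).add (E.tendsto_simpleOp_approx hφ hg)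

theorem app_smul_vec {φ : ℝ → ℝ} (hφ : Measurable φ) {f : H} (c : ℝ) (hf : E.MemDom φ f) :
    E.app φ (c • f) = c • E.app φ f := by
  refine tendsto_nhds_unique (E.tendsto_simpleOp_approx hφ (hf.smul c)) ?_
  simp_rw [map_smul]
  exact (E.tendsto_simpleOp_approx hφ hf).const_smul c

theorem inner_app_left {φ : ℝ → ℝ} (hφ : Measurable φ) {f g : H} (hf : E.MemDom φ f)
    (hg : E.MemDom φ g) : inner ℝ (E.app φ f) g = inner ℝ f (E.app φ g) := by
  refine tendsto_nhds_unique ((E.tendsto_simpleOp_approx hφ hf).inner tendsto_const_nhds)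
    ((tendsto_const_nhds.inner (E.tendsto_simpleOp_approx hφ hg)).congr fun n => ?_)
  rw [E.inner_simpleOp_left]

theorem tendsto_integral_approx {φ : ℝ → ℝ} (hφ : Measurable φ) {f : H} (hf : E.MemDom φ f) :
    Tendsto (fun n => ∫ l, approx hφ n l ∂(E.measure f)) atTop (𝓝 (∫ l, φ l ∂(E.measure f))) := by
  have hL := ((E.memDom_iff hφ f).1 hf).integrable one_le_two
  refine tendsto_integral_of_dominated_convergence (fun l => 2 * |φ l|)
    (fun n => (approx hφ n).measurable.aestronglyMeasurable) (hL.abs.const_mul 2)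
    (fun n => ae_of_all _ fun l => abs_approx_le hφ n l)
    (ae_of_all _ fun l => tendsto_approx hφ l)

theorem isApply_app {φ : ℝ → ℝ} (hφ : Measurable φ) {f : H} (hf : E.MemDom φ f) :
    E.IsApply φ f (E.app φ f) := by
  refine ⟨hf, fun g hg => ?_⟩
  refine tendsto_nhds_unique ((E.tendsto_simpleOp_approx hφ hf).inner tendsto_const_nhds) ?_
  simp_rw [E.inner_simpleOp]
  exact ((E.tendsto_integral_approx hφ (hf.add hg)).sub
    (E.tendsto_integral_approx hφ (hf.sub hg))).const_mul _

theorem measure_proj {S : Set ℝ} (hS : MeasurableSet S) (f : H) :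
    E.measure (E.proj S f) = (E.measure f).restrict S := by
  refine Measure.ext fun T hT => ?_
  rw [Measure.restrict_apply hT, E.measure_apply hT, E.measure_apply (hT.inter hS),
    E.proj_inter _ _ hT hS, mul_apply_eq_comp]

theorem tendsto_proj_iUnion {S : ℕ → Set ℝ} (hS : ∀ n, MeasurableSet (S n)) (hm : Monotone S)
    (f : H) : Tendsto (fun n => E.proj (S n) f) atTop (𝓝 (E.proj (⋃ n, S n) f)) := by
  have hU := MeasurableSet.iUnion hS
  have h1 : Tendsto (fun n => (E.measure f).real (S n)) atTop
      (𝓝 ((E.measure f).real (⋃ n, S n))) :=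
    (ENNReal.tendsto_toReal (measure_ne_top _ _)).comp (tendsto_measure_iUnion_atTop hm)
  rw [tendsto_iff_norm_sub_tendsto_zero]
  have h2 : ∀ n, ‖E.proj (S n) f - E.proj (⋃ n, S n) f‖ =
      √((E.measure f).real (⋃ n, S n) - (E.measure f).real (S n)) := by
    intro n
    have hsub : S n ∪ ((⋃ n, S n) \ S n) = ⋃ n, S n :=
      union_sdiff_cancel (subset_iUnion S n)
    have h3 := E.proj_union (hS n) (hU.diff (hS n)) disjoint_sdiff_right
    rw [hsub] at h3
    have h4 := measureReal_sdiff (μ := E.measure f) (subset_iUnion S n) (hS n)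
    rw [← h4, E.measureReal_apply (hU.diff (hS n)), Real.sqrt_sq (norm_nonneg _), h3,
      norm_sub_rev]
    simp
  simp_rw [h2]
  simpa using (h1.const_sub ((E.measure f).real (⋃ n, S n))).sqrt

/-- Cutting frequencies to `{|φ| ≤ n}` puts any vector in the domain. Since `IsApply` tests only
against domain vectors, this density is what determines its value uniquely. -/
theorem exists_tendsto_memDom {φ : ℝ → ℝ} (hφ : Measurable φ) (g : H) :
    ∃ G : ℕ → H, (∀ n, E.MemDom φ (G n)) ∧ Tendsto G atTop (𝓝 g) := by
  let S : ℕ → Set ℝ := fun n => {l | |φ l| ≤ n}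
  have hS : ∀ n, MeasurableSet (S n) := fun n => measurableSet_le hφ.abs measurable_const
  have hm : Monotone S := fun m n hmn l (hl : |φ l| ≤ m) =>
    hl.trans (by exact_mod_cast hmn : (m : ℝ) ≤ n)
  have hU : (⋃ n, S n) = univ := by
    refine eq_univ_of_forall fun l => mem_iUnion.2 ?_
    exact exists_nat_ge |φ l|
  refine ⟨fun n => E.proj (S n) g, fun n => ?_, ?_⟩
  · unfold MemDom
    rw [E.measure_proj (hS n)]
    calc ∫⁻ l in S n, ENNReal.ofReal (φ l ^ 2) ∂(E.measure g)
        ≤ ∫⁻ l in S n, ENNReal.ofReal ((n : ℝ) ^ 2) ∂(E.measure g) := by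
          refine setLIntegral_mono measurable_const fun l (hl : |φ l| ≤ n) => ?_
          refine ENNReal.ofReal_le_ofReal ?_
          rw [← sq_abs]
          gcongr
      _ < ∞ := by
          rw [setLIntegral_const]
          exact ENNReal.mul_lt_top (by simp) (measure_lt_top _ _)
  · have := E.tendsto_proj_iUnion hS hm g
    rwa [hU, E.proj_univ] at this

theorem IsApply.unique {φ : ℝ → ℝ} (hφ : Measurable φ) {f v w : H} (hv : E.IsApply φ f v)
    (hw : E.IsApply φ f w) : v = w := by
  refine ext_inner_right ℝ fun g => ?_
  obtain ⟨G, hG, hGt⟩ := E.exists_tendsto_memDom hφ g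
  refine tendsto_nhds_unique (tendsto_const_nhds.inner hGt)
    ((tendsto_const_nhds.inner hGt).congr fun n => ?_)
  rw [hw.2 _ (hG n), hv.2 _ (hG n)]

theorem norm_sq_app_sub {φ ψ : ℝ → ℝ} (hφ : Measurable φ) (hψ : Measurable ψ) {f : H}
    (hf : E.MemDom φ f) (hf' : E.MemDom ψ f) :
    ‖E.app φ f - E.app ψ f‖ ^ 2 = ∫ l, (φ l - ψ l) ^ 2 ∂(E.measure f) := by
  have hL := (E.memDom_iff hφ f).1 hf
  have hL' := (E.memDom_iff hψ f).1 hf'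
  refine tendsto_nhds_unique
    ((tendsto_const_nhds.sub (E.tendsto_simpleOp_approx hψ hf')).norm.pow 2) ?_
  simp_rw [E.norm_sq_app_sub_simpleOp hφ hf]
  refine tendsto_integral_of_dominated_convergence (fun l => (|φ l| + 2 * |ψ l|) ^ 2)
    (fun n => ((hφ.sub (approx hψ n).measurable).pow_const 2).aestronglyMeasurable)
    (hL.abs.add (hL'.abs.const_mul 2)).integrable_sq ?_ ?_
  · refine fun n => ae_of_all _ fun l => ?_
    rw [Real.norm_eq_abs, abs_pow]
    gcongr
    exact (abs_sub _ _).trans (by gcongr; exact abs_approx_le hψ n l)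
  · exact ae_of_all _ fun l => (((tendsto_approx hψ l).const_sub (φ l)).pow 2)

theorem app_congr_ae {φ ψ : ℝ → ℝ} (hφ : Measurable φ) (hψ : Measurable ψ) {f : H}
    (hf : E.MemDom φ f) (h : φ =ᵐ[E.measure f] ψ) : E.MemDom ψ f ∧ E.app φ f = E.app ψ f := by
  have hf' : E.MemDom ψ f := by
    rw [E.memDom_iff hψ]; exact ((E.memDom_iff hφ f).1 hf).ae_eq h
  refine ⟨hf', ?_⟩
  have h1 := E.norm_sq_app_sub hφ hψ hf hf'
  rw [integral_eq_zero_of_ae] at h1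
  · simpa [sub_eq_zero] using h1
  · filter_upwards [h] with l hl
    simp [hl]

theorem memDom_mono {φ ψ : ℝ → ℝ} {f : H} (hf : E.MemDom ψ f)
    (h : ∀ᵐ l ∂(E.measure f), |φ l| ≤ |ψ l|) : E.MemDom φ f := by
  refine (lintegral_mono_ae ?_).trans_lt hf
  filter_upwards [h] with l hl
  exact ENNReal.ofReal_le_ofReal (sq_le_sq.2 hl)

theorem memDom_add {φ ψ : ℝ → ℝ} (hφ : Measurable φ) (hψ : Measurable ψ) {f : H}
    (hf : E.MemDom φ f) (hf' : E.MemDom ψ f) : E.MemDom (fun l => φ l + ψ l) f := by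
  rw [E.memDom_iff (φ := fun l => φ l + ψ l) (hφ.add hψ)]
  exact ((E.memDom_iff hφ f).1 hf).add ((E.memDom_iff hψ f).1 hf')

theorem app_add {φ ψ : ℝ → ℝ} (hφ : Measurable φ) (hψ : Measurable ψ) {f : H}
    (hf : E.MemDom φ f) (hf' : E.MemDom ψ f) :
    E.app (fun l => φ l + ψ l) f = E.app φ f + E.app ψ f := by
  have hL := (E.memDom_iff hφ f).1 hf
  have hL' := (E.memDom_iff hψ f).1 hf'
  refine tendsto_nhds_unique (E.tendsto_simpleOp (s := fun n => approx hφ n + approx hψ n)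
    (hφ.add hψ) (E.memDom_add hφ hψ hf hf') ?_) ?_
  · refine tendsto_integral_sq_sub (ψ := fun l => 3 * |φ l| + 3 * |ψ l|)
      (s := fun n => (approx hφ n + approx hψ n : SimpleFunc ℝ ℝ))
      ((hL.abs.const_mul 3).add (hL'.abs.const_mul 3))
      (fun n => (approx hφ n + approx hψ n).measurable)
      (fun n => ae_of_all _ fun l => ?_) (hφ.add hψ) (ae_of_all _ fun l => ?_)
    · refine le_trans ?_ (le_abs_self _)
      simp only [SimpleFunc.coe_add, Pi.add_apply]
      have h1 := abs_approx_le hφ n l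
      have h2 := abs_approx_le hψ n l
      have h3 := abs_sub (approx hφ n l + approx hψ n l) (φ l + ψ l)
      have h4 := abs_add_le (approx hφ n l) (approx hψ n l)
      have h5 := abs_add_le (φ l) (ψ l)
      linarith
    · exact (tendsto_approx hφ l).add (tendsto_approx hψ l)
  · simp_rw [E.simpleOp_add, add_apply]
    exact (E.tendsto_simpleOp_approx hφ hf).add (E.tendsto_simpleOp_approx hψ hf')

/-- The simple function `1_S`. -/
def ind {S : Set ℝ} (hS : MeasurableSet S) : SimpleFunc ℝ ℝ :=
  SimpleFunc.piecewise S hS (SimpleFunc.const _ 1) (SimpleFunc.const _ 0)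

theorem ind_apply {S : Set ℝ} (hS : MeasurableSet S) (l : ℝ) :
    ind hS l = S.indicator (fun _ => 1) l := by
  simp [ind, indicator, Set.piecewise]

theorem simpleOp_app {ψ : ℝ → ℝ} (hψ : Measurable ψ) {f : H} (hf : E.MemDom ψ f)
    (s : SimpleFunc ℝ ℝ) :
    E.MemDom (fun l => s l * ψ l) f ∧ E.simpleOp s (E.app ψ f) = E.app (fun l => s l * ψ l) f := by
  have hL := (E.memDom_iff hψ f).1 hf
  obtain ⟨M, hM⟩ := s.exists_forall_norm_le
  simp only [Real.norm_eq_abs] at hM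
  have hM0 : 0 ≤ M := (abs_nonneg _).trans (hM 0)
  have hdom : E.MemDom (fun l => s l * ψ l) f := by
    refine E.memDom_mono (ψ := fun l => M * ψ l) ?_ (ae_of_all _ fun l => ?_)
    · rw [E.memDom_iff (hψ.const_mul M)]; exact hL.const_mul M
    · rw [abs_mul, abs_mul, abs_of_nonneg hM0]; gcongr; exact hM l
  refine ⟨hdom, ?_⟩
  refine tendsto_nhds_unique (((E.simpleOp s).continuous.tendsto _).comp
    (E.tendsto_simpleOp_approx hψ hf)) ?_
  simp only [Function.comp_def, ← mul_apply_eq_comp, ← E.simpleOp_mul]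
  refine E.tendsto_simpleOp (s.measurable.mul hψ) hdom ?_
  refine tendsto_integral_sq_sub (ψ := fun l => M * (3 * |ψ l|))
      (s := fun n => (s * approx hψ n : SimpleFunc ℝ ℝ))
      ((hL.abs.const_mul 3).const_mul M) (fun n => (s * approx hψ n).measurable)
      (fun n => ae_of_all _ fun l => ?_) (s.measurable.mul hψ) (ae_of_all _ fun l => ?_)
  · refine le_trans ?_ (le_abs_self _)
    simp only [SimpleFunc.coe_mul, Pi.mul_apply]
    rw [← mul_sub, abs_mul]
    have h1 := abs_approx_le hψ n l
    have h3 := abs_sub (approx hψ n l) (ψ l)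
    exact mul_le_mul (hM l) (by linarith) (abs_nonneg _) hM0
  · exact (tendsto_approx hψ l).const_mul _

/-- A spectral projection commutes through: `E(S) ψ(A) f = (1_S ψ)(A) f`. This computes domains of
compositions by a change of density. -/
theorem measure_app {ψ : ℝ → ℝ} (hψ : Measurable ψ) {f : H} (hf : E.MemDom ψ f) :
    E.measure (E.app ψ f) = (E.measure f).withDensity (fun l => ENNReal.ofReal (ψ l ^ 2)) := by
  refine Measure.ext fun S hS => ?_
  rw [withDensity_apply _ hS, E.measure_apply hS]
  have h1 : E.proj S = E.simpleOp (ind hS) := by rw [ind, E.simpleOp_indicator, one_smul]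
  obtain ⟨h2, h3⟩ := E.simpleOp_app hψ hf (ind hS)
  rw [h1, h3, E.norm_sq_app (φ := fun l => ind hS l * ψ l)
    ((ind hS).measurable.mul hψ) h2, ofReal_integral_eq_lintegral_ofReal,
    ← lintegral_indicator hS]
  · refine lintegral_congr fun l => ?_
    rw [ind_apply]
    by_cases hl : l ∈ S <;> simp [hl]
  · exact ((E.memDom_iff ((ind hS).measurable.mul hψ) f).1 h2).integrable_sq
  · exact ae_of_all _ fun l => by positivity

theorem app_app {φ ψ : ℝ → ℝ} (hφ : Measurable φ) (hψ : Measurable ψ) {f : H}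
    (hf : E.MemDom ψ f) (hf' : E.MemDom (fun l => φ l * ψ l) f) :
    E.MemDom φ (E.app ψ f) ∧ E.app φ (E.app ψ f) = E.app (fun l => φ l * ψ l) f := by
  have hL := (E.memDom_iff (hφ.mul hψ) f).1 hf'
  have hdom : E.MemDom φ (E.app ψ f) := by
    unfold MemDom
    rw [E.measure_app hψ hf, lintegral_withDensity_eq_lintegral_mul _ (by fun_prop) (by fun_prop)]
    refine lt_of_eq_of_lt (lintegral_congr fun l => ?_) hf'
    rw [Pi.mul_apply, ← ENNReal.ofReal_mul (by positivity), mul_pow, mul_comm]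
  refine ⟨hdom, tendsto_nhds_unique (E.tendsto_simpleOp_approx hφ hdom) ?_⟩
  rw [tendsto_iff_norm_sub_tendsto_zero]
  have h : ∀ n, ‖E.simpleOp (approx hφ n) (E.app ψ f) - E.app (fun l => φ l * ψ l) f‖ =
      √(∫ l, (approx hφ n l * ψ l - φ l * ψ l) ^ 2 ∂(E.measure f)) := by
    intro n
    obtain ⟨h1, h2⟩ := E.simpleOp_app hψ hf (approx hφ n)
    rw [h2, ← E.norm_sq_app_sub (φ := fun l => approx hφ n l * ψ l)
      (ψ := fun l => φ l * ψ l) ((approx hφ n).measurable.mul hψ) (hφ.mul hψ) h1 hf',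
      Real.sqrt_sq (norm_nonneg _)]
  simp_rw [h]
  have := tendsto_integral_sq_sub (φ := fun l => φ l * ψ l) (ψ := fun l => 3 * (φ l * ψ l))
    (s := fun n l => approx hφ n l * ψ l) (hL.const_mul 3)
    (fun n => (approx hφ n).measurable.mul hψ) (fun n => ae_of_all _ fun l => by
      have h1 := abs_approx_le hφ n l
      have h3 := abs_sub (approx hφ n l) (φ l)
      rw [← sub_mul, abs_mul, abs_mul, abs_mul, abs_of_pos (by norm_num : (0 : ℝ) < 3), ← mul_assoc]
      gcongr
      linarith) (hφ.mul hψ) (ae_of_all _ fun l => (tendsto_approx hφ l).mul_const _)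
  simpa using this.sqrt

end ResolutionOfIdentity

/-- The weak characterization has exactly one solution, so the choice operator must return the `L²`
limit; from here on all estimates can be made for `app`. -/
theorem funcCalc_eq_app {H : Type*} [NormedAddCommGroup H] [InnerProductSpace ℝ H]
    [CompleteSpace H] (A : H →ₗ.[ℝ] H) {φ : ℝ → ℝ} (hφ : Measurable φ) {f : H}
    (hf : (resolution A).MemDom φ f) : funcCalc A φ f = (resolution A).app φ f := by
  have h := (resolution A).isApply_app hφ hf
  exact ResolutionOfIdentity.IsApply.unique _ hφ (Classical.epsilon_spec ⟨_, h⟩) h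

end DampedWave

end

/-! ### Bounded symbols on a spectrum in the positive half line -/

noncomputable section

namespace DampedWave

/-- Borel functions that are bounded on the positive half line. -/
def IsBddSymbol (φ : ℝ → ℝ) : Prop := Measurable φ ∧ ∃ M, ∀ l, 0 < l → |φ l| ≤ M

theorem IsBddSymbol.mul {φ ψ : ℝ → ℝ} (hφ : IsBddSymbol φ) (hψ : IsBddSymbol ψ) :
    IsBddSymbol fun l => φ l * ψ l := by
  obtain ⟨h1, M, hM⟩ := hφ
  obtain ⟨h2, N, hN⟩ := hψ
  refine ⟨h1.mul h2, M * N, fun l hl => ?_⟩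
  rw [abs_mul]
  exact mul_le_mul (hM l hl) (hN l hl) (abs_nonneg _) ((abs_nonneg _).trans (hM l hl))

theorem IsBddSymbol.add {φ ψ : ℝ → ℝ} (hφ : IsBddSymbol φ) (hψ : IsBddSymbol ψ) :
    IsBddSymbol fun l => φ l + ψ l := by
  obtain ⟨h1, M, hM⟩ := hφ
  obtain ⟨h2, N, hN⟩ := hψ
  exact ⟨h1.add h2, M + N, fun l hl => (abs_add_le _ _).trans (add_le_add (hM l hl) (hN l hl))⟩

theorem IsBddSymbol.sub {φ ψ : ℝ → ℝ} (hφ : IsBddSymbol φ) (hψ : IsBddSymbol ψ) :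
    IsBddSymbol fun l => φ l - ψ l := by
  obtain ⟨h1, M, hM⟩ := hφ
  obtain ⟨h2, N, hN⟩ := hψ
  exact ⟨h1.sub h2, M + N, fun l hl => (abs_sub _ _).trans (add_le_add (hM l hl) (hN l hl))⟩

theorem isBddSymbol_const (c : ℝ) : IsBddSymbol fun _ => c := ⟨measurable_const, |c|, by simp⟩

/-- Families of symbols, continuous in time and bounded on `(0, ∞)` locally uniformly in time. -/
structure IsSymbolFamily (m : ℝ → ℝ → ℝ) : Prop where
  measurable : ∀ t, Measurable (m t)
  bounded : ∀ T, ∃ M, ∀ t, |t| ≤ T → ∀ l, 0 < l → |m t l| ≤ M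
  continuous : ∀ l, 0 < l → Continuous fun t => m t l

theorem IsSymbolFamily.isBddSymbol {m : ℝ → ℝ → ℝ} (hm : IsSymbolFamily m) (t : ℝ) :
    IsBddSymbol (m t) := by
  obtain ⟨M, hM⟩ := hm.bounded |t|
  exact ⟨hm.measurable t, M, hM t le_rfl⟩

namespace ResolutionOfIdentity

variable {H : Type*} [NormedAddCommGroup H] [InnerProductSpace ℝ H] [CompleteSpace H]
variable (E : ResolutionOfIdentity H)

open Classical in
/-- `∫ φ dE` as a bounded operator. -/
def op (φ : ℝ → ℝ) : H →L[ℝ] H :=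
  if h : Measurable φ ∧ ∃ M, ∀ f, E.MemDom φ f ∧ ‖E.app φ f‖ ≤ M * ‖f‖ then
    LinearMap.mkContinuousOfExistsBound
      { toFun := E.app φ
        map_add' := fun f g => E.app_add_vec h.1 (h.2.choose_spec f).1 (h.2.choose_spec g).1
        map_smul' := fun c f => E.app_smul_vec h.1 c (h.2.choose_spec f).1 }
      ⟨h.2.choose, fun f => (h.2.choose_spec f).2⟩
  else 0

theorem app_const (c : ℝ) (f : H) : E.app (fun _ => c) f = c • f := by
  have h := E.app_simpleFunc (SimpleFunc.const ℝ c) f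
  have h2 : E.simpleOp (SimpleFunc.const ℝ c) = c • 1 := by
    rw [simpleOp, SimpleFunc.setToSimpleFunc_const _ (by ext; simp [E.proj_empty]), E.proj_univ]
    simp
  rw [h2] at h
  exact h

variable {E} (hE : E.proj (Iic 0) = 0)
include hE

/-- This is why symbols are only bounded on `λ > 0`: the propagator symbols grow without bound as `λ
→ -∞`. -/
theorem ae_pos (f : H) : ∀ᵐ l ∂(E.measure f), 0 < l := by
  have h : E.measure f (Iic 0) = 0 := by
    rw [E.measure_apply measurableSet_Iic, hE]; simp
  rw [ae_iff]
  simpa [Iic_def] using h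

theorem memDom_of_bdd {φ : ℝ → ℝ} (hφ : IsBddSymbol φ) (f : H) : E.MemDom φ f := by
  obtain ⟨h, M, hM⟩ := hφ
  refine E.memDom_mono (ψ := fun _ => M) ?_ ?_
  · exact (E.memDom_iff measurable_const f).2 (memLp_const M)
  · filter_upwards [ae_pos hE f] with l hl
    exact (hM l hl).trans (le_abs_self M)

theorem norm_app_le {φ ψ : ℝ → ℝ} (hφ : Measurable φ) (hψ : Measurable ψ) {f : H}
    (hf : E.MemDom ψ f) (h : ∀ l, 0 < l → |φ l| ≤ |ψ l|) :
    E.MemDom φ f ∧ ‖E.app φ f‖ ≤ ‖E.app ψ f‖ := by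
  have h' : ∀ᵐ l ∂(E.measure f), |φ l| ≤ |ψ l| := by
    filter_upwards [ae_pos hE f] with l hl using h l hl
  have h1 := E.memDom_mono hf h'
  refine ⟨h1, ?_⟩
  refine (sq_le_sq₀ (norm_nonneg _) (norm_nonneg _)).1 ?_
  rw [E.norm_sq_app hφ h1, E.norm_sq_app hψ hf]
  refine integral_mono_ae ((E.memDom_iff hφ f).1 h1).integrable_sq
    ((E.memDom_iff hψ f).1 hf).integrable_sq ?_
  filter_upwards [h'] with l hl using sq_le_sq.2 hl

theorem op_apply {φ : ℝ → ℝ} (hφ : IsBddSymbol φ) (f : H) : E.op φ f = E.app φ f := by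
  have hdom := memDom_of_bdd hE hφ
  obtain ⟨h, M, hM⟩ := hφ
  have h1 : Measurable φ ∧ ∃ M, ∀ f, E.MemDom φ f ∧ ‖E.app φ f‖ ≤ M * ‖f‖ := by
    refine ⟨h, |M|, fun f => ⟨hdom f, ?_⟩⟩
    have := (norm_app_le hE h (measurable_const (a := |M|))
      (memDom_of_bdd hE (isBddSymbol_const _) f)
      (fun l hl => by rw [abs_abs]; exact (hM l hl).trans (le_abs_self M))).2
    rwa [E.app_const, norm_smul, Real.norm_eq_abs, abs_abs] at this
  rw [op, dif_pos h1]
  rfl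

theorem norm_op_mono {φ ψ : ℝ → ℝ} (hφ : IsBddSymbol φ) (hψ : IsBddSymbol ψ)
    (h : ∀ l, 0 < l → |φ l| ≤ |ψ l|) (f : H) : ‖E.op φ f‖ ≤ ‖E.op ψ f‖ := by
  rw [op_apply hE hφ, op_apply hE hψ]
  exact (norm_app_le hE hφ.1 hψ.1 (memDom_of_bdd hE hψ f) h).2

theorem op_const (c : ℝ) (f : H) : E.op (fun _ => c) f = c • f := by
  rw [op_apply hE (isBddSymbol_const c), E.app_const]

theorem norm_op_le {φ : ℝ → ℝ} (hφ : Measurable φ) {M : ℝ} (hM : ∀ l, 0 < l → |φ l| ≤ M) (f : H) :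
    ‖E.op φ f‖ ≤ M * ‖f‖ := by
  have hM0 : 0 ≤ M := (abs_nonneg _).trans (hM 1 one_pos)
  have := norm_op_mono hE ⟨hφ, M, hM⟩ (isBddSymbol_const M)
    (fun l hl => (hM l hl).trans (le_abs_self M)) f
  rwa [op_const hE, norm_smul, Real.norm_eq_abs, abs_of_nonneg hM0] at this

theorem op_congr {φ ψ : ℝ → ℝ} (hφ : IsBddSymbol φ) (hψ : Measurable ψ)
    (h : ∀ l, 0 < l → φ l = ψ l) : E.op φ = E.op ψ := by
  ext1 f
  have hψ' : IsBddSymbol ψ := ⟨hψ, by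
    obtain ⟨-, M, hM⟩ := hφ
    exact ⟨M, fun l hl => by rw [← h l hl]; exact hM l hl⟩⟩
  rw [op_apply hE hφ, op_apply hE hψ']
  refine (E.app_congr_ae hφ.1 hψ (memDom_of_bdd hE hφ f) ?_).2
  filter_upwards [ae_pos hE f] with l hl using h l hl

theorem op_add {φ ψ : ℝ → ℝ} (hφ : IsBddSymbol φ) (hψ : IsBddSymbol ψ) (f : H) :
    E.op (fun l => φ l + ψ l) f = E.op φ f + E.op ψ f := by
  rw [op_apply hE hφ, op_apply hE hψ, op_apply hE (hφ.add hψ)]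
  exact E.app_add hφ.1 hψ.1 (memDom_of_bdd hE hφ f) (memDom_of_bdd hE hψ f)

theorem op_mul {φ ψ : ℝ → ℝ} (hφ : IsBddSymbol φ) (hψ : IsBddSymbol ψ) (f : H) :
    E.op (fun l => φ l * ψ l) f = E.op φ (E.op ψ f) := by
  rw [op_apply hE hφ, op_apply hE hψ, op_apply hE (hφ.mul hψ)]
  exact (E.app_app hφ.1 hψ.1 (memDom_of_bdd hE hψ f) (memDom_of_bdd hE (hφ.mul hψ) f)).2.symm

theorem op_const_mul (c : ℝ) {φ : ℝ → ℝ} (hφ : IsBddSymbol φ) (f : H) :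
    E.op (fun l => c * φ l) f = c • E.op φ f := by
  rw [op_mul hE (isBddSymbol_const c) hφ, op_const hE]

theorem op_sub {φ ψ : ℝ → ℝ} (hφ : IsBddSymbol φ) (hψ : IsBddSymbol ψ) (f : H) :
    E.op (fun l => φ l - ψ l) f = E.op φ f - E.op ψ f := by
  have h := op_add hE hφ ((isBddSymbol_const (-1)).mul hψ) f
  rw [op_const_mul hE _ hψ] at h
  rw [sub_eq_add_neg, ← neg_one_smul ℝ (E.op ψ f), ← h]
  congr 2
  ext l; ring

theorem inner_op_left {φ : ℝ → ℝ} (hφ : IsBddSymbol φ) (f g : H) :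
    inner ℝ (E.op φ f) g = inner ℝ f (E.op φ g) := by
  rw [op_apply hE hφ, op_apply hE hφ]
  exact E.inner_app_left hφ.1 (memDom_of_bdd hE hφ f) (memDom_of_bdd hE hφ g)

theorem norm_sq_op {φ : ℝ → ℝ} (hφ : IsBddSymbol φ) (f : H) :
    ‖E.op φ f‖ ^ 2 = ∫ l, φ l ^ 2 ∂(E.measure f) := by
  rw [op_apply hE hφ, E.norm_sq_app hφ.1 (memDom_of_bdd hE hφ f)]

theorem op_indicator {S : Set ℝ} (hS : MeasurableSet S) (f : H) :
    E.op (S.indicator fun _ => 1) f = E.proj S f := by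
  have h1 : (S.indicator fun _ => (1 : ℝ)) = ind hS := by ext l; rw [ind_apply]
  rw [op_apply hE, h1, E.app_simpleFunc, ind, E.simpleOp_indicator, one_smul]
  refine ⟨measurable_const.indicator hS, 1, fun l _ => ?_⟩
  by_cases h : l ∈ S <;> simp [h]

theorem app_op {φ ψ : ℝ → ℝ} (hφ : Measurable φ) (hψ : IsBddSymbol ψ)
    (h : IsBddSymbol fun l => φ l * ψ l) (f : H) :
    E.MemDom φ (E.op ψ f) ∧ E.app φ (E.op ψ f) = E.op (fun l => φ l * ψ l) f := by
  rw [op_apply hE hψ, op_apply hE h]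
  exact E.app_app hφ hψ.1 (memDom_of_bdd hE hψ f) (memDom_of_bdd hE h f)

theorem op_app {φ ψ : ℝ → ℝ} (hφ : IsBddSymbol φ) (hψ : Measurable ψ)
    (h : IsBddSymbol fun l => φ l * ψ l) {f : H} (hf : E.MemDom ψ f) :
    E.op φ (E.app ψ f) = E.op (fun l => φ l * ψ l) f := by
  rw [op_apply hE hφ, op_apply hE h]
  exact (E.app_app hφ.1 hψ hf (memDom_of_bdd hE h f)).2

/-- Dominated convergence. -/
theorem tendsto_op {ι : Type*} {F : Filter ι} [F.IsCountablyGenerated] {m : ι → ℝ → ℝ}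
    {φ : ℝ → ℝ} {M : ℝ} (hm : ∀ i, IsBddSymbol (m i)) (hφ : IsBddSymbol φ)
    (hb : ∀ᶠ i in F, ∀ l, 0 < l → |m i l| ≤ M)
    (ht : ∀ l, 0 < l → Tendsto (fun i => m i l) F (𝓝 (φ l))) (f : H) :
    Tendsto (fun i => E.op (m i) f) F (𝓝 (E.op φ f)) := by
  rw [tendsto_iff_norm_sub_tendsto_zero]
  have h : ∀ i, ‖E.op (m i) f - E.op φ f‖ = √(∫ l, (m i l - φ l) ^ 2 ∂(E.measure f)) := by
    intro i
    rw [op_apply hE (hm i), op_apply hE hφ, ← E.norm_sq_app_sub (hm i).1 hφ.1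
      (memDom_of_bdd hE (hm i) f) (memDom_of_bdd hE hφ f), Real.sqrt_sq (norm_nonneg _)]
  simp_rw [h]
  obtain ⟨N, hN⟩ := hφ.2
  have key : Tendsto (fun i => ∫ l, (m i l - φ l) ^ 2 ∂(E.measure f)) F
      (𝓝 (∫ _, (0 : ℝ) ∂(E.measure f))) := by
    refine tendsto_integral_filter_of_dominated_convergence (fun _ => (M + N) ^ 2) ?_ ?_
      (integrable_const _) ?_
    · exact Eventually.of_forall fun i =>
        (((hm i).1.sub hφ.1).pow_const 2).aestronglyMeasurable
    · filter_upwards [hb] with i hi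
      filter_upwards [ae_pos hE f] with l hl
      rw [Real.norm_eq_abs, abs_pow]
      gcongr
      exact (abs_sub _ _).trans (add_le_add (hi l hl) (hN l hl))
    · filter_upwards [ae_pos hE f] with l hl
      simpa using ((ht l hl).sub_const (φ l)).pow 2
  simpa using key.sqrt

theorem continuous_op {m : ℝ → ℝ → ℝ} (hm : IsSymbolFamily m) (f : H) :
    Continuous fun t => E.op (m t) f := by
  refine continuous_iff_continuousAt.2 fun t => ?_
  obtain ⟨M, hM⟩ := hm.bounded (|t| + 1)
  refine tendsto_op hE (M := M) hm.isBddSymbol (hm.isBddSymbol t) ?_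
    (fun l hl => (hm.continuous l hl).tendsto t) f
  filter_upwards [Metric.ball_mem_nhds t one_pos] with s hs
  refine hM s ?_
  rw [Metric.mem_ball, Real.dist_eq] at hs
  have := abs_sub_abs_le_abs_sub s t
  linarith

/-- Strong continuity in time at a fixed vector, plus an operator bound that is locally uniform in
time for the change of vector. -/
theorem continuous_op_uncurry {m : ℝ → ℝ → ℝ} (hm : IsSymbolFamily m) :
    Continuous fun x : ℝ × H => E.op (m x.1) x.2 := by
  refine continuous_iff_continuousAt.2 fun ⟨t, f⟩ => ?_
  obtain ⟨M, hM⟩ := hm.bounded (|t| + 1)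
  have h1 : Tendsto (fun x : ℝ × H => E.op (m x.1) f) (𝓝 (t, f)) (𝓝 (E.op (m t) f)) :=
    ((continuous_op hE hm f).tendsto t).comp (continuous_fst.tendsto (t, f))
  have h2 : Tendsto (fun x : ℝ × H => E.op (m x.1) (x.2 - f)) (𝓝 (t, f)) (𝓝 0) := by
    have h3 : Tendsto (fun x : ℝ × H => M * ‖x.2 - f‖) (𝓝 (t, f)) (𝓝 0) := by
      have : Continuous fun x : ℝ × H => M * ‖x.2 - f‖ := by fun_prop
      simpa using this.tendsto (t, f)
    refine squeeze_zero_norm' ?_ h3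
    have h4 : ∀ᶠ x : ℝ × H in 𝓝 (t, f), x.1 ∈ Metric.ball t 1 :=
      (continuous_fst.tendsto (t, f)).eventually (Metric.ball_mem_nhds t one_pos)
    filter_upwards [h4] with x hx
    refine norm_op_le hE (hm.measurable _) (hM x.1 ?_) _
    rw [Metric.mem_ball, Real.dist_eq] at hx
    have := abs_sub_abs_le_abs_sub x.1 t
    linarith
  have h3 := h1.add h2
  simp only [map_sub, add_zero, add_sub_cancel] at h3
  exact h3

/-- The mean value inequality bounds the difference quotients of `m` by a local bound of its
derivative `n`, uniformly in `λ`, so dominated convergence applies on the spectral side. -/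
theorem hasDerivAt_op {m n : ℝ → ℝ → ℝ} (hm : IsSymbolFamily m) (hn : IsSymbolFamily n)
    (h : ∀ l, 0 < l → ∀ t, HasDerivAt (fun s => m s l) (n t l) t) (f : H) (t : ℝ) :
    HasDerivAt (fun s => E.op (m s) f) (E.op (n t) f) t := by
  rw [hasDerivAt_iff_tendsto_slope]
  obtain ⟨M, hM⟩ := hn.bounded (|t| + 1)
  have hsl : ∀ s, slope (fun s => E.op (m s) f) t s =
      E.op (fun l => (s - t)⁻¹ * (m s l - m t l)) f := by
    intro s
    rw [op_mul hE (φ := fun _ => (s - t)⁻¹) (isBddSymbol_const _) (ψ := fun l => m s l - m t l),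
      op_const hE, op_sub hE (hm.isBddSymbol s) (hm.isBddSymbol t), slope_def_module]
    exact (hm.isBddSymbol s).sub (hm.isBddSymbol t)
  refine Tendsto.congr (fun s => (hsl s).symm) ?_
  refine tendsto_op hE (M := M)
    (fun s => (isBddSymbol_const _).mul ((hm.isBddSymbol s).sub (hm.isBddSymbol t)))
    (hn.isBddSymbol t) ?_ ?_ f
  · have hball : Metric.ball t 1 ∈ 𝓝[≠] t := mem_nhdsWithin_of_mem_nhds (Metric.ball_mem_nhds t one_pos)
    filter_upwards [hball, self_mem_nhdsWithin] with s hs hne l hl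
    have hmv := Convex.norm_image_sub_le_of_norm_hasDerivWithin_le (f := fun s => m s l)
      (f' := fun s => n s l) (s := Metric.ball t 1) (C := M) (x := t) (y := s)
      (fun x _ => (h l hl x).hasDerivWithinAt)
      (fun x hx => by
        refine hM x ?_ l hl
        rw [Metric.mem_ball, Real.dist_eq] at hx
        have := abs_sub_abs_le_abs_sub x t
        linarith) (convex_ball t 1) (Metric.mem_ball_self one_pos) hs
    rw [Real.norm_eq_abs, Real.norm_eq_abs] at hmv
    have hst : 0 < |s - t| := abs_pos.2 (sub_ne_zero.2 hne)
    rw [abs_mul, abs_inv, inv_mul_le_iff₀ hst, mul_comm]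
    exact hmv
  · intro l hl
    have := (h l hl t).tendsto_slope
    exact this.congr fun s => by rw [slope_def_module, smul_eq_mul]

end ResolutionOfIdentity

end DampedWave

end

/-! ### Pointwise bounds for the symbols of the damped wave propagators -/

noncomputable section

namespace DampedWave

/-- The solution of `y'' = (1/4 - λ) y`, `y(0) = 0`, `y'(0) = 1`. -/
def sinSymbol (t l : ℝ) : ℝ :=
  if l < 1 / 4 then Real.sinh (t * √(1 / 4 - l)) / √(1 / 4 - l)
  else if l = 1 / 4 then t
  else Real.sin (t * √(l - 1 / 4)) / √(l - 1 / 4)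

/-- The solution of `y'' = (1/4 - λ) y`, `y(0) = 1`, `y'(0) = 0`. -/
def cosSymbol (t l : ℝ) : ℝ :=
  if l < 1 / 4 then Real.cosh (t * √(1 / 4 - l))
  else if l = 1 / 4 then 1
  else Real.cos (t * √(l - 1 / 4))

theorem dSymbol_eq (t l : ℝ) : dSymbol t l = Real.exp (-t / 2) * sinSymbol t l := by
  unfold dSymbol sinSymbol
  split_ifs <;> ring

theorem hasDerivAt_sinSymbol (l t : ℝ) :
    HasDerivAt (fun t => sinSymbol t l) (cosSymbol t l) t := by
  unfold sinSymbol cosSymbol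
  rcases lt_trichotomy l (1 / 4) with h | h | h
  · simp only [h, if_true]
    have hs : √(1 / 4 - l) ≠ 0 := (Real.sqrt_pos.2 (by linarith)).ne'
    exact ((((hasDerivAt_id' t).mul_const √(1 / 4 - l)).sinh).div_const √(1 / 4 - l)).congr_deriv
      (by rw [one_mul, mul_div_cancel_right₀ _ hs])
  · simp only [h, lt_irrefl, if_true, if_false]
    exact hasDerivAt_id t
  · simp only [h.not_gt, h.ne', if_false]
    have hs : √(l - 1 / 4) ≠ 0 := (Real.sqrt_pos.2 (by linarith)).ne'
    exact ((((hasDerivAt_id' t).mul_const √(l - 1 / 4)).sin).div_const √(l - 1 / 4)).congr_deriv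
      (by rw [one_mul, mul_div_cancel_right₀ _ hs])

theorem hasDerivAt_cosSymbol (l t : ℝ) :
    HasDerivAt (fun t => cosSymbol t l) ((1 / 4 - l) * sinSymbol t l) t := by
  unfold sinSymbol cosSymbol
  rcases lt_trichotomy l (1 / 4) with h | h | h
  · simp only [h, if_true]
    have hs : √(1 / 4 - l) ≠ 0 := (Real.sqrt_pos.2 (by linarith)).ne'
    have hsq : √(1 / 4 - l) ^ 2 = 1 / 4 - l := Real.sq_sqrt (by linarith)
    refine (((hasDerivAt_id' t).mul_const √(1 / 4 - l)).cosh).congr_deriv ?_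
    generalize √(1 / 4 - l) = s at *
    rw [← hsq]
    field_simp
  · simp only [h, lt_irrefl, if_true, if_false, sub_self, zero_mul]
    exact hasDerivAt_const t 1
  · simp only [h.not_gt, h.ne', if_false]
    have hs : √(l - 1 / 4) ≠ 0 := (Real.sqrt_pos.2 (by linarith)).ne'
    have hsq : √(l - 1 / 4) ^ 2 = l - 1 / 4 := Real.sq_sqrt (by linarith)
    refine (((hasDerivAt_id' t).mul_const √(l - 1 / 4)).cos).congr_deriv ?_
    rw [← neg_sub l]
    generalize √(l - 1 / 4) = s at *
    rw [← hsq]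
    field_simp

theorem measurable_sinSymbol (t : ℝ) : Measurable (sinSymbol t) := by
  unfold sinSymbol
  refine Measurable.ite measurableSet_Iio ?_ (Measurable.ite (measurableSet_singleton _) ?_ ?_)
  all_goals fun_prop

theorem measurable_cosSymbol (t : ℝ) : Measurable (cosSymbol t) := by
  unfold cosSymbol
  refine Measurable.ite measurableSet_Iio ?_ (Measurable.ite (measurableSet_singleton _) ?_ ?_)
  all_goals fun_prop

theorem abs_sinh_le (x : ℝ) : |Real.sinh x| ≤ |x| * Real.exp |x| := by
  rw [Real.abs_sinh, Real.sinh_eq]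
  have h1 := Real.add_one_le_exp (-(2 * |x|))
  have h2 : Real.exp (-|x|) = Real.exp |x| * Real.exp (-(2 * |x|)) := by
    rw [← Real.exp_add]; congr 1; ring
  rw [h2]
  nlinarith [Real.exp_pos |x|]

/-- `∂ₜ𝒟(t, λ)`. -/
def dtSymbol (t l : ℝ) : ℝ := Real.exp (-t / 2) * (cosSymbol t l - sinSymbol t l / 2)

/-- `∂ₜ²𝒟(t, λ)`. -/
def dttSymbol (t l : ℝ) : ℝ := -dtSymbol t l - l * dSymbol t l

theorem hasDerivAt_exp_neg_half (t : ℝ) :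
    HasDerivAt (fun t : ℝ => Real.exp (-t / 2)) (-(1 / 2) * Real.exp (-t / 2)) t := by
  exact ((hasDerivAt_id' t).neg.div_const 2).exp.congr_deriv (by simp only [Pi.neg_apply]; ring)

theorem hasDerivAt_dSymbol (l t : ℝ) : HasDerivAt (fun t => dSymbol t l) (dtSymbol t l) t := by
  simp_rw [dSymbol_eq]
  refine ((hasDerivAt_exp_neg_half t).mul (hasDerivAt_sinSymbol l t)).congr_deriv ?_
  unfold dtSymbol; ring

theorem hasDerivAt_dtSymbol (l t : ℝ) : HasDerivAt (fun t => dtSymbol t l) (dttSymbol t l) t := by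
  unfold dtSymbol
  refine ((hasDerivAt_exp_neg_half t).mul
    ((hasDerivAt_cosSymbol l t).sub ((hasDerivAt_sinSymbol l t).div_const 2))).congr_deriv ?_
  unfold dttSymbol dtSymbol; rw [dSymbol_eq]; simp only [Pi.sub_apply]; ring

theorem deriv_dSymbol (l t : ℝ) : deriv (fun s => dSymbol s l) t = dtSymbol t l :=
  (hasDerivAt_dSymbol l t).deriv

theorem dSymbol_zero (l : ℝ) : dSymbol 0 l = 0 := by
  simp [dSymbol]

theorem dtSymbol_zero (l : ℝ) : dtSymbol 0 l = 1 := by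
  simp [dtSymbol, sinSymbol, cosSymbol]

theorem measurable_dSymbol (t : ℝ) : Measurable (dSymbol t) := by
  have : dSymbol t = fun l => Real.exp (-t / 2) * sinSymbol t l := by ext l; exact dSymbol_eq t l
  rw [this]
  exact (measurable_sinSymbol t).const_mul _

theorem measurable_dtSymbol (t : ℝ) : Measurable (dtSymbol t) := by
  exact ((measurable_cosSymbol t).sub ((measurable_sinSymbol t).div_const 2)).const_mul _

theorem abs_sin_div_le (t s : ℝ) (hs : 0 < s) : |Real.sin (t * s) / s| ≤ |t| := by
  rw [abs_div, abs_of_pos hs, div_le_iff₀ hs]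
  calc |Real.sin (t * s)| ≤ |t * s| := Real.abs_sin_le_abs
    _ = |t| * s := by rw [abs_mul, abs_of_pos hs]

theorem abs_sinh_div_le (t s : ℝ) (hs : 0 < s) :
    |Real.sinh (t * s) / s| ≤ |t| * Real.exp (|t| * s) := by
  rw [abs_div, abs_of_pos hs, div_le_iff₀ hs]
  calc |Real.sinh (t * s)| ≤ |t * s| * Real.exp |t * s| := abs_sinh_le _
    _ = _ := by rw [abs_mul, abs_of_pos hs]; ring

theorem cosh_le_exp_abs (x : ℝ) : Real.cosh x ≤ Real.exp |x| := by
  rw [← Real.cosh_abs, Real.cosh_eq]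
  have : Real.exp (-|x|) ≤ Real.exp |x| := Real.exp_le_exp.2 (by linarith [abs_nonneg x])
  linarith

/-- Bounds for the frequencies `λ ≥ 1/4 - r²`. -/
theorem abs_symbols_le {r t l : ℝ} (hr : 0 ≤ r) (hr' : r ≤ 1 / 2) (hl : 1 / 4 - r ^ 2 ≤ l) :
    |sinSymbol t l| ≤ |t| * Real.exp (|t| * r) ∧ |cosSymbol t l| ≤ Real.exp (|t| * r) ∧
      √l * |sinSymbol t l| ≤ (1 + |t|) * Real.exp (|t| * r) := by
  have he : 1 ≤ Real.exp (|t| * r) := Real.one_le_exp (by positivity)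
  have ht := abs_nonneg t
  unfold sinSymbol cosSymbol
  rcases lt_trichotomy l (1 / 4) with h | h | h
  · simp only [h, if_true]
    have hs : 0 < √(1 / 4 - l) := Real.sqrt_pos.2 (by linarith)
    have hsr : √(1 / 4 - l) ≤ r := Real.sqrt_le_iff.2 ⟨hr, by linarith⟩
    have he' : Real.exp (|t| * √(1 / 4 - l)) ≤ Real.exp (|t| * r) := by gcongr
    have h1 : |Real.sinh (t * √(1 / 4 - l)) / √(1 / 4 - l)| ≤ |t| * Real.exp (|t| * r) :=
      (abs_sinh_div_le t _ hs).trans (by gcongr)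
    have hl1 : √l ≤ 1 := Real.sqrt_le_one.2 (by linarith)
    refine ⟨h1, ?_, ?_⟩
    · rw [abs_of_pos (Real.cosh_pos _)]
      refine (cosh_le_exp_abs _).trans ?_
      rwa [abs_mul, abs_of_pos hs]
    · calc √l * |Real.sinh (t * √(1 / 4 - l)) / √(1 / 4 - l)| ≤ 1 * (|t| * Real.exp (|t| * r)) := by
            gcongr
        _ ≤ _ := by nlinarith
  · simp only [h, lt_irrefl, if_true, if_false]
    have hl1 : √(1 / 4 : ℝ) ≤ 1 := Real.sqrt_le_one.2 (by norm_num)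
    refine ⟨by nlinarith, by simpa using he, ?_⟩
    calc √(1 / 4 : ℝ) * |t| ≤ 1 * |t| := by gcongr
      _ ≤ _ := by nlinarith
  · simp only [h.not_gt, h.ne', if_false]
    have hs : 0 < √(l - 1 / 4) := Real.sqrt_pos.2 (by linarith)
    have h1 := abs_sin_div_le t _ hs
    refine ⟨by nlinarith, (Real.abs_cos_le_one _).trans he, ?_⟩
    have hsl : √l ≤ √(l - 1 / 4) + 1 := by
      refine Real.sqrt_le_iff.2 ⟨by positivity, ?_⟩
      have := Real.sq_sqrt (show 0 ≤ l - 1 / 4 by linarith)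
      nlinarith
    have h2 : √(l - 1 / 4) * |Real.sin (t * √(l - 1 / 4)) / √(l - 1 / 4)| ≤ 1 := by
      rw [abs_div, abs_of_pos hs, mul_div_cancel₀ _ hs.ne']
      exact Real.abs_sin_le_one _
    calc √l * |Real.sin (t * √(l - 1 / 4)) / √(l - 1 / 4)|
        ≤ (√(l - 1 / 4) + 1) * |Real.sin (t * √(l - 1 / 4)) / √(l - 1 / 4)| := by gcongr
      _ ≤ 1 + |t| := by rw [add_mul, one_mul]; exact add_le_add h2 h1
      _ ≤ _ := by nlinarith

/-- From `1 + x ≤ e^x` at `x = t/16`, squared; the constant is `16²`. -/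
theorem one_add_sq_mul_exp_le {t : ℝ} (ht : 0 ≤ t) :
    (1 + t) ^ 2 * Real.exp (-(t / 4)) ≤ 256 * Real.exp (-(t / 8)) := by
  have h1 : (1 + t / 16) ^ 2 ≤ Real.exp (t / 8) := by
    have : Real.exp (t / 8) = Real.exp (t / 16) ^ 2 := by
      rw [← Real.exp_nat_mul]; congr 1; push_cast; ring
    rw [this]
    gcongr
    linarith [Real.add_one_le_exp (t / 16)]
  have h2 : Real.exp (-(t / 8)) = Real.exp (-(t / 4)) * Real.exp (t / 8) := by
    rw [← Real.exp_add]; congr 1; ring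
  rw [h2]
  have := Real.exp_pos (-(t / 4))
  nlinarith

/-- The size of the symbols: the heat symbol for the low frequencies, exponential decay for the
others. -/
def gSymbol (t l : ℝ) : ℝ := Real.exp (-(t / 2) * l) + Real.exp (-(t / 8))

theorem gSymbol_pos (t l : ℝ) : 0 < gSymbol t l := by unfold gSymbol; positivity

/-- The threshold `3/16 = 1/4 - (1/4)²` limits the growth of the undamped factors to `(1 + t)
e^{t/4}`, against the damping `e^{-t/2}`. The remaining `e^{-t/4}` pays for the polynomial factors.
-/
theorem high_freq_le {t l : ℝ} (ht : 0 ≤ t) (hl : 3 / 16 ≤ l) :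
    (1 + t) * |dSymbol t l| ≤ 256 * gSymbol t l ∧ (1 + t) * |dtSymbol t l| ≤ 256 * gSymbol t l ∧
      (1 + t) * (√l * |dSymbol t l|) ≤ 256 * gSymbol t l := by
  obtain ⟨h1, h2, h3⟩ := abs_symbols_le (r := 1 / 4) (t := t) (l := l) (by norm_num) (by norm_num)
    (by linarith)
  rw [abs_of_nonneg ht] at h1 h2 h3
  have hexp : Real.exp (-t / 2) * Real.exp (t * (1 / 4)) = Real.exp (-(t / 4)) := by
    rw [← Real.exp_add]; congr 1; ring
  have hpos := Real.exp_pos (-t / 2)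
  have hpos' := Real.exp_pos (-(t / 4))
  have key := one_add_sq_mul_exp_le ht
  have hg : Real.exp (-(t / 8)) ≤ gSymbol t l := by
    unfold gSymbol; linarith [Real.exp_pos (-(t / 2) * l)]
  have bound : ∀ x : ℝ, x ≤ Real.exp (-t / 2) * ((1 + t) * Real.exp (t * (1 / 4))) →
      (1 + t) * x ≤ 256 * gSymbol t l := by
    intro x hx
    calc (1 + t) * x ≤ (1 + t) * (Real.exp (-t / 2) * ((1 + t) * Real.exp (t * (1 / 4)))) := by
          gcongr
      _ = (1 + t) ^ 2 * Real.exp (-(t / 4)) := by rw [← hexp]; ring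
      _ ≤ 256 * gSymbol t l := by linarith
  have he := Real.exp_pos (t * (1 / 4))
  refine ⟨bound _ ?_, bound _ ?_, bound _ ?_⟩
  · rw [dSymbol_eq, abs_mul, abs_of_pos hpos]
    gcongr
    nlinarith
  · rw [dtSymbol, abs_mul, abs_of_pos hpos]
    gcongr
    refine (abs_sub _ _).trans ?_
    rw [abs_div, abs_of_pos (by norm_num : (0 : ℝ) < 2)]
    nlinarith
  · rw [dSymbol_eq, abs_mul, abs_of_pos hpos, mul_left_comm]
    gcongr

theorem one_add_mul_exp_le {t l : ℝ} (ht : 0 ≤ t) (hl : 0 < l) (hl' : l ≤ 1) :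
    (1 + t) * l * Real.exp (-(t / 2) * l) ≤ 3 := by
  have h := Real.add_one_le_exp (t / 2 * l)
  have h2 : Real.exp (-(t / 2) * l) = (Real.exp (t / 2 * l))⁻¹ := by
    rw [← Real.exp_neg]; congr 1; ring
  rw [h2, ← div_eq_mul_inv, div_le_iff₀ (Real.exp_pos _)]
  nlinarith [mul_nonneg ht hl.le]

/-- With `s = √(1/4 - λ)` one has `(1/2 - s)(1/2 + s) = λ`, hence `s - 1/2 ≤ -λ` and the growing
mode is at most `e^{-tλ}` after damping. In the time derivative that mode has coefficient `(1 -
2s)/(4s) = O(λ)`, which is the source of the extra decay; the other mode is bounded by `e^{-t/2}`.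
-/
theorem low_freq_le {t l : ℝ} (ht : 0 ≤ t) (hl : 0 < l) (hl' : l < 3 / 16) :
    |dSymbol t l| ≤ 2 * Real.exp (-t * l) ∧
      |dtSymbol t l| ≤ 4 * l * Real.exp (-t * l) + 2 * Real.exp (-t / 2) := by
  have h4 : l < 1 / 4 := by linarith
  set s := √(1 / 4 - l) with hs
  have hsq : s ^ 2 = 1 / 4 - l := Real.sq_sqrt (by linarith)
  have hs4 : 1 / 4 ≤ s := Real.le_sqrt_of_sq_le (by linarith)
  have hs2 : s ≤ 1 / 2 := Real.sqrt_le_iff.2 ⟨by norm_num, by linarith⟩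
  have hsl : s - 1 / 2 ≤ -l := by nlinarith
  have hexp : Real.exp (-t / 2) * Real.exp (t * s) ≤ Real.exp (-t * l) := by
    rw [← Real.exp_add]
    exact Real.exp_le_exp.2 (by nlinarith)
  have e0 := Real.exp_pos (-t / 2)
  have e1 := Real.exp_pos (t * s)
  have e2 := Real.exp_pos (-(t * s))
  have e3 : Real.exp (-(t * s)) ≤ 1 := Real.exp_le_one_iff.2 (by nlinarith)
  constructor
  · rw [dSymbol_eq, sinSymbol, if_pos h4, ← hs, abs_mul, abs_of_pos e0]
    have h1 : |Real.sinh (t * s) / s| ≤ 2 * Real.exp (t * s) := by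
      rw [abs_div, abs_of_pos (by linarith : 0 < s), div_le_iff₀ (by linarith),
        abs_of_nonneg (Real.sinh_nonneg_iff.2 (by nlinarith)), Real.sinh_eq]
      nlinarith
    calc Real.exp (-t / 2) * |Real.sinh (t * s) / s| ≤ Real.exp (-t / 2) * (2 * Real.exp (t * s)) := by
          gcongr
      _ ≤ _ := by linarith
  · rw [dtSymbol, sinSymbol, cosSymbol, if_pos h4, if_pos h4, ← hs, abs_mul, abs_of_pos e0]
    have h1 : |Real.cosh (t * s) - Real.sinh (t * s) / s / 2| ≤ 4 * l * Real.exp (t * s) + 2 := by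
      have hs0 : s ≠ 0 := by linarith
      have hid : Real.cosh (t * s) - Real.sinh (t * s) / s / 2 =
          Real.exp (-(t * s)) * ((2 * s + 1) / (4 * s)) -
            Real.exp (t * s) * ((1 - 2 * s) / (4 * s)) := by
        rw [Real.cosh_eq, Real.sinh_eq]; field_simp; ring
      have ha : (2 * s + 1) / (4 * s) ≤ 2 := by rw [div_le_iff₀ (by linarith)]; linarith
      have ha' : 0 ≤ (2 * s + 1) / (4 * s) := by positivity
      have hb : (1 - 2 * s) / (4 * s) ≤ 4 * l := by
        rw [div_le_iff₀ (by linarith)]; nlinarith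
      have hb' : 0 ≤ (1 - 2 * s) / (4 * s) := div_nonneg (by linarith) (by linarith)
      rw [hid]
      refine (abs_sub _ _).trans ?_
      rw [abs_mul, abs_mul, abs_of_pos e1, abs_of_pos e2, abs_of_nonneg ha', abs_of_nonneg hb']
      nlinarith
    calc Real.exp (-t / 2) * |Real.cosh (t * s) - Real.sinh (t * s) / s / 2|
        ≤ Real.exp (-t / 2) * (4 * l * Real.exp (t * s) + 2) := by gcongr
      _ = 4 * l * (Real.exp (-t / 2) * Real.exp (t * s)) + 2 * Real.exp (-t / 2) := by ring
      _ ≤ _ := by gcongr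

theorem abs_dSymbol_le {t l : ℝ} (ht : 0 ≤ t) (hl : 0 < l) : |dSymbol t l| ≤ 600 * gSymbol t l := by
  have hg := gSymbol_pos t l
  rcases lt_or_ge l (3 / 16) with h | h
  · have h1 := (low_freq_le ht hl h).1
    have h2 : Real.exp (-t * l) ≤ Real.exp (-(t / 2) * l) := Real.exp_le_exp.2 (by nlinarith)
    have h3 : Real.exp (-(t / 2) * l) ≤ gSymbol t l := by
      unfold gSymbol; linarith [Real.exp_pos (-(t / 8))]
    linarith
  · have h1 := (high_freq_le ht h).1
    nlinarith [abs_nonneg (dSymbol t l)]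

/-- Half of the heat exponent is spent on the factor `(1 + t) λ` and half is kept, which is why
`gSymbol` carries `t / 2`. -/
theorem low_freq_mul_le {t l : ℝ} (ht : 0 ≤ t) (hl : 0 < l) (hl' : l < 3 / 16) :
    (1 + t) * (l * Real.exp (-t * l)) ≤ 3 * gSymbol t l := by
  have h1 := one_add_mul_exp_le ht hl (by linarith)
  have h2 : Real.exp (-t * l) = Real.exp (-(t / 2) * l) * Real.exp (-(t / 2) * l) := by
    rw [← Real.exp_add]; congr 1; ring
  have h3 : Real.exp (-(t / 2) * l) ≤ gSymbol t l := by
    unfold gSymbol; linarith [Real.exp_pos (-(t / 8))]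
  have h4 := Real.exp_pos (-(t / 2) * l)
  calc (1 + t) * (l * Real.exp (-t * l))
      = ((1 + t) * l * Real.exp (-(t / 2) * l)) * Real.exp (-(t / 2) * l) := by rw [h2]; ring
    _ ≤ 3 * gSymbol t l := by gcongr

theorem abs_dtSymbol_le {t l : ℝ} (ht : 0 ≤ t) (hl : 0 < l) :
    (1 + t) * |dtSymbol t l| ≤ 600 * gSymbol t l := by
  have hg := gSymbol_pos t l
  rcases lt_or_ge l (3 / 16) with h | h
  · have h1 := (low_freq_le ht hl h).2
    have h2 := low_freq_mul_le ht hl h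
    have h3 : (1 + t) * Real.exp (-t / 2) ≤ 256 * gSymbol t l := by
      have := one_add_sq_mul_exp_le ht
      have h4 : Real.exp (-t / 2) ≤ Real.exp (-(t / 4)) := Real.exp_le_exp.2 (by linarith)
      have h5 : Real.exp (-(t / 8)) ≤ gSymbol t l := by
        unfold gSymbol; linarith [Real.exp_pos (-(t / 2) * l)]
      have := Real.exp_pos (-t / 2)
      nlinarith
    calc (1 + t) * |dtSymbol t l|
        ≤ (1 + t) * (4 * l * Real.exp (-t * l) + 2 * Real.exp (-t / 2)) := by gcongr
      _ ≤ 600 * gSymbol t l := by linarith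
  · have h1 := (high_freq_le ht h).2.1
    linarith

theorem abs_sqrt_mul_dSymbol_le {t l : ℝ} (ht : 0 ≤ t) (hl : 0 < l) :
    √(1 + t) * (√l * |dSymbol t l|) ≤ 600 * gSymbol t l := by
  have hg := gSymbol_pos t l
  rcases lt_or_ge l (3 / 16) with h | h
  · have h1 := (low_freq_le ht hl h).1
    have h2 := one_add_mul_exp_le ht hl (by linarith)
    have h3 : Real.exp (-(t / 2) * l) ≤ gSymbol t l := by
      unfold gSymbol; linarith [Real.exp_pos (-(t / 8))]
    have h4 := Real.exp_pos (-(t / 2) * l)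
    have h5 : Real.exp (-t * l) = Real.exp (-(t / 2) * l) * Real.exp (-(t / 2) * l) := by
      rw [← Real.exp_add]; congr 1; ring
    have h6 : Real.exp (-(t / 2) * l) ≤ 1 := Real.exp_le_one_iff.2 (by nlinarith)
    have h7 : √(1 + t) * √l * Real.exp (-(t / 2) * l) ≤ 2 := by
      refine abs_le_of_sq_le_sq' ?_ (by norm_num) |>.2
      rw [mul_pow, mul_pow, Real.sq_sqrt (by linarith), Real.sq_sqrt hl.le]
      nlinarith [mul_nonneg (by linarith : 0 ≤ 1 + t) hl.le]
    calc √(1 + t) * (√l * |dSymbol t l|) ≤ √(1 + t) * (√l * (2 * Real.exp (-t * l))) := by gcongr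
      _ = 2 * (√(1 + t) * √l * Real.exp (-(t / 2) * l)) * Real.exp (-(t / 2) * l) := by
        rw [h5]; ring
      _ ≤ 2 * 2 * gSymbol t l := by gcongr
      _ ≤ _ := by linarith
  · have h1 := (high_freq_le ht h).2.2
    have h2 : √(1 + t) ≤ 1 + t := by
      refine Real.sqrt_le_iff.2 ⟨by linarith, by nlinarith⟩
    calc √(1 + t) * (√l * |dSymbol t l|) ≤ (1 + t) * (√l * |dSymbol t l|) := by gcongr
      _ ≤ _ := by linarith

/-- The symbol of `(1 + A)^{-1/2}`. -/
def jSymbol (l : ℝ) : ℝ := (√(1 + l))⁻¹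

theorem jSymbol_nonneg (l : ℝ) : 0 ≤ jSymbol l := by unfold jSymbol; positivity

theorem jSymbol_le_one {l : ℝ} (hl : 0 < l) : jSymbol l ≤ 1 :=
  inv_le_one_of_one_le₀ (Real.one_le_sqrt.2 (by linarith))

theorem sqrt_mul_jSymbol_le (l : ℝ) : √l * jSymbol l ≤ 1 := by
  unfold jSymbol
  rw [← div_eq_mul_inv]
  exact div_le_one_of_le₀ (Real.sqrt_le_sqrt (by linarith)) (Real.sqrt_nonneg _)

theorem mul_jSymbol_le {l : ℝ} (hl : 0 < l) : l * jSymbol l ≤ √l := by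
  have h := sqrt_mul_jSymbol_le l
  calc l * jSymbol l = √l * (√l * jSymbol l) := by rw [← mul_assoc, Real.mul_self_sqrt hl.le]
    _ ≤ √l * 1 := by gcongr
    _ = √l := mul_one _

theorem measurable_jSymbol : Measurable jSymbol := by unfold jSymbol; fun_prop

theorem isBddSymbol_jSymbol : IsBddSymbol jSymbol :=
  ⟨measurable_jSymbol, 1, fun l hl => by
    rw [abs_of_nonneg (jSymbol_nonneg l)]; exact jSymbol_le_one hl⟩

/-- By the equation `∂ₜ²𝒟 = -∂ₜ𝒟 - λ𝒟`. At low frequencies the factor `λ` supplies `(1 + t)^{-1}`;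
at high frequencies `λ (1 + λ)^{-1/2} ≤ √λ` costs no more than `A^{1/2} 𝒟`. One power of decay is
all that the velocity estimate needs. -/
theorem abs_dttSymbol_le {t l : ℝ} (ht : 0 ≤ t) (hl : 0 < l) :
    (1 + t) * |dttSymbol t l * jSymbol l| ≤ 1200 * gSymbol t l := by
  have hg := gSymbol_pos t l
  have hj := jSymbol_nonneg l
  have hj1 := jSymbol_le_one hl
  have h1 := abs_dtSymbol_le ht hl
  have h2 : (1 + t) * (l * jSymbol l * |dSymbol t l|) ≤ 600 * gSymbol t l := by
    rcases lt_or_ge l (3 / 16) with h | h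
    · have h3 := (low_freq_le ht hl h).1
      have h4 := low_freq_mul_le ht hl h
      calc (1 + t) * (l * jSymbol l * |dSymbol t l|)
          ≤ (1 + t) * (l * 1 * (2 * Real.exp (-t * l))) := by gcongr
        _ ≤ _ := by linarith
    · have h3 := (high_freq_le ht h).2.2
      calc (1 + t) * (l * jSymbol l * |dSymbol t l|) ≤ (1 + t) * (√l * |dSymbol t l|) := by
            gcongr; exact mul_jSymbol_le hl
        _ ≤ _ := by linarith
  have h3 : |dttSymbol t l * jSymbol l| ≤ |dtSymbol t l| + l * jSymbol l * |dSymbol t l| := by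
    unfold dttSymbol
    rw [abs_mul, abs_of_nonneg hj]
    calc |-dtSymbol t l - l * dSymbol t l| * jSymbol l
        ≤ (|dtSymbol t l| + l * |dSymbol t l|) * jSymbol l := by
          gcongr
          refine (abs_sub _ _).trans ?_
          rw [abs_neg, abs_mul, abs_of_pos hl]
      _ ≤ _ := by nlinarith [abs_nonneg (dtSymbol t l)]
  calc (1 + t) * |dttSymbol t l * jSymbol l|
      ≤ (1 + t) * (|dtSymbol t l| + l * jSymbol l * |dSymbol t l|) := by gcongr
    _ ≤ _ := by linarith

/-- The choice `r = 1/2` covers all `λ > 0`. There is no decay here, but negative times are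
included, so the families can be differentiated on both sides of every time. -/
theorem local_bound {T t l : ℝ} (ht : |t| ≤ T) (hl : 0 < l) :
    |dSymbol t l| ≤ (1 + T) * Real.exp T ∧ |dtSymbol t l| ≤ 2 * ((1 + T) * Real.exp T) ∧
      √l * |dSymbol t l| ≤ (1 + T) * Real.exp T := by
  obtain ⟨h1, h2, h3⟩ := abs_symbols_le (r := 1 / 2) (t := t) (l := l) (by norm_num) (by norm_num)
    (by linarith)
  have hT : 0 ≤ T := (abs_nonneg t).trans ht
  have e1 : Real.exp (-t / 2) * Real.exp (|t| * (1 / 2)) ≤ Real.exp T := by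
    rw [← Real.exp_add]
    exact Real.exp_le_exp.2 (by linarith [neg_abs_le t])
  have e0 := Real.exp_pos (-t / 2)
  have e2 := Real.exp_pos (|t| * (1 / 2))
  have e3 := Real.exp_pos T
  have e4 : Real.exp (-t / 2) * ((1 + |t|) * Real.exp (|t| * (1 / 2))) ≤ (1 + T) * Real.exp T := by
    calc _ = (1 + |t|) * (Real.exp (-t / 2) * Real.exp (|t| * (1 / 2))) := by ring
      _ ≤ _ := by gcongr
  have ht0 := abs_nonneg t
  refine ⟨?_, ?_, ?_⟩
  · rw [dSymbol_eq, abs_mul, abs_of_pos e0]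
    refine le_trans ?_ e4
    gcongr
    nlinarith
  · rw [dtSymbol, abs_mul, abs_of_pos e0]
    refine le_trans ?_ (mul_le_mul_of_nonneg_left e4 (by norm_num : (0 : ℝ) ≤ 2))
    rw [mul_left_comm]
    gcongr
    refine (abs_sub _ _).trans ?_
    rw [abs_div, abs_of_pos (by norm_num : (0 : ℝ) < 2)]
    nlinarith
  · rw [dSymbol_eq, abs_mul, abs_of_pos e0, mul_left_comm]
    refine le_trans ?_ e4
    gcongr

theorem continuous_dSymbol (l : ℝ) : Continuous fun t => dSymbol t l :=
  continuous_iff_continuousAt.2 fun t => (hasDerivAt_dSymbol l t).continuousAt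

theorem continuous_dtSymbol (l : ℝ) : Continuous fun t => dtSymbol t l :=
  continuous_iff_continuousAt.2 fun t => (hasDerivAt_dtSymbol l t).continuousAt

theorem isSymbolFamily_d : IsSymbolFamily dSymbol where
  measurable := measurable_dSymbol
  bounded _ := ⟨_, fun _ ht _ hl => (local_bound ht hl).1⟩
  continuous l _ := continuous_dSymbol l

theorem isSymbolFamily_dt : IsSymbolFamily dtSymbol where
  measurable := measurable_dtSymbol
  bounded _ := ⟨_, fun _ ht _ hl => (local_bound ht hl).2.1⟩
  continuous l _ := continuous_dtSymbol l

theorem IsSymbolFamily.mul_symbol {m : ℝ → ℝ → ℝ} (hm : IsSymbolFamily m) {φ : ℝ → ℝ}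
    (hφ : IsBddSymbol φ) : IsSymbolFamily fun t l => m t l * φ l where
  measurable t := (hm.measurable t).mul hφ.1
  bounded T := by
    obtain ⟨M, hM⟩ := hm.bounded T
    obtain ⟨-, N, hN⟩ := hφ
    refine ⟨M * N, fun t ht l hl => ?_⟩
    rw [abs_mul]
    exact mul_le_mul (hM t ht l hl) (hN l hl) (abs_nonneg _) ((abs_nonneg _).trans (hM t ht l hl))
  continuous l hl := (hm.continuous l hl).mul_const _

/-- The symbol of `A^{1/2} 𝒟(t, A)`. -/
theorem isSymbolFamily_sqrt_d : IsSymbolFamily fun t l => √l * dSymbol t l where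
  measurable t := Real.continuous_sqrt.measurable.mul (measurable_dSymbol t)
  bounded _ := ⟨_, fun t ht l hl => by
    rw [abs_mul, abs_of_nonneg (Real.sqrt_nonneg l)]; exact (local_bound ht hl).2.2⟩
  continuous l _ := (continuous_dSymbol l).const_mul _

/-- The symbol of `(1 + A)^{1/2} 𝒟(t, A)`. -/
def sSymbol (t l : ℝ) : ℝ := √(1 + l) * dSymbol t l

theorem isSymbolFamily_s : IsSymbolFamily sSymbol where
  measurable t := (by fun_prop : Measurable fun l : ℝ => √(1 + l)).mul (measurable_dSymbol t)
  bounded T := ⟨2 * ((1 + T) * Real.exp T), fun t ht l hl => by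
    obtain ⟨h1, -, h3⟩ := local_bound ht hl
    have h4 : √(1 + l) ≤ 1 + √l := by
      refine Real.sqrt_le_iff.2 ⟨by positivity, ?_⟩
      nlinarith [Real.sq_sqrt hl.le, Real.sqrt_nonneg l]
    rw [sSymbol, abs_mul, abs_of_nonneg (Real.sqrt_nonneg _)]
    calc √(1 + l) * |dSymbol t l| ≤ (1 + √l) * |dSymbol t l| := by gcongr
      _ ≤ _ := by linarith⟩
  continuous l _ := (continuous_dSymbol l).const_mul _

theorem isSymbolFamily_dtt : IsSymbolFamily fun t l => dttSymbol t l * jSymbol l where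
  measurable t := (((measurable_dtSymbol t).neg).sub
    (measurable_id.mul (measurable_dSymbol t))).mul measurable_jSymbol
  bounded T := ⟨3 * ((1 + T) * Real.exp T), fun t ht l hl => by
    obtain ⟨h1, h2, h3⟩ := local_bound ht hl
    have hj := jSymbol_nonneg l
    have hj1 := jSymbol_le_one hl
    unfold dttSymbol
    rw [abs_mul, abs_of_nonneg hj]
    calc |-dtSymbol t l - l * dSymbol t l| * jSymbol l
        ≤ (|dtSymbol t l| + l * |dSymbol t l|) * jSymbol l := by
          gcongr
          refine (abs_sub _ _).trans ?_
          rw [abs_neg, abs_mul, abs_of_pos hl]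
      _ = |dtSymbol t l| * jSymbol l + (l * jSymbol l) * |dSymbol t l| := by ring
      _ ≤ |dtSymbol t l| * 1 + √l * |dSymbol t l| := by
          gcongr
          exact mul_jSymbol_le hl
      _ ≤ _ := by linarith⟩
  continuous l _ := ((continuous_dtSymbol l).neg.sub ((continuous_dSymbol l).const_mul _)).mul_const _

end DampedWave

end

/-! ### Consequences of ultracontractivity: spectrum, Bernstein, smoothing -/

noncomputable section

namespace DampedWave

variable {X : Type*} [MeasurableSpace X] {μ : Measure X}

theorem ae_abs_le_of_eLpNorm_top_le {f : X → ℝ} {K : ℝ} (hK : 0 ≤ K)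
    (h : eLpNorm f ∞ μ ≤ ENNReal.ofReal K) : ∀ᵐ x ∂μ, |f x| ≤ K := by
  rw [eLpNorm_exponent_top] at h
  filter_upwards [enorm_ae_le_eLpNormEssSup f μ] with x hx
  have := hx.trans h
  rwa [← ofReal_norm, ENNReal.ofReal_le_ofReal_iff hK, Real.norm_eq_abs] at this

/-- Ultracontractivity of the heat semigroup, on its domain. -/
def Ultracontractive (E : ResolutionOfIdentity (Lp ℝ 2 μ)) (C α : ℝ) : Prop :=
  ∀ t, 0 < t → ∀ f, E.MemDom (fun l => Real.exp (-t * l)) f →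
    ∀ᵐ x ∂μ, |E.app (fun l => Real.exp (-t * l)) f x| ≤ C * t ^ (-α) * ‖f‖

theorem exists_ultracontractive {A : Lp ℝ 2 μ →ₗ.[ℝ] Lp ℝ 2 μ} {α : ℝ} (hA : AssumptionA A α) :
    ∃ C, 0 < C ∧ Ultracontractive (resolution A) C α := by
  obtain ⟨C, hC⟩ := hA.ultracontractive
  refine ⟨max C 1, by positivity, fun t ht f hf => ?_⟩
  have h := hC t ht f (Lp.memLp f)
  rw [heat, funcCalc_eq_app A (by fun_prop) hf, ← Lp.enorm_def f, ← ofReal_norm,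
    ← ENNReal.ofReal_mul' (norm_nonneg _)] at h
  have ht' : 0 < t ^ (-α) := Real.rpow_pos_of_pos ht _
  refine ae_abs_le_of_eLpNorm_top_le (by positivity) (h.trans (ENNReal.ofReal_le_ofReal ?_))
  gcongr
  exact le_max_left _ _

theorem Lp_eq_zero_of_ae_abs_le {f : Lp ℝ 2 μ} {K : ℝ → ℝ}
    (hf : ∀ t, 0 < t → ∀ᵐ x ∂μ, |f x| ≤ K t) (hK : Tendsto K atTop (𝓝 0)) : f = 0 := by
  rw [Lp.eq_zero_iff_ae_eq_zero]
  have h1 : ∀ᵐ x ∂μ, ∀ n : ℕ, |f x| ≤ K (n + 1) := ae_all_iff.2 fun n => hf _ (by positivity)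
  filter_upwards [h1] with x hx
  have h2 : Tendsto (fun n : ℕ => K (n + 1)) atTop (𝓝 0) :=
    hK.comp (tendsto_atTop_add_const_right _ _ tendsto_natCast_atTop_atTop)
  have := ge_of_tendsto' h2 hx
  simpa using this

namespace Ultracontractive

variable {E : ResolutionOfIdentity (Lp ℝ 2 μ)} {C α : ℝ} (hU : Ultracontractive E C α)
include hU

/-- On nonpositive frequencies `e^{tA}` is a contraction, and `E(S) g = e^{-tA} (e^{tA} E(S) g)`.
Ultracontractivity bounds the right side by `C t^{-α} ‖g‖` almost everywhere, and `t → ∞` leaves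
zero. The frequency `0` is included, so the kernel is excluded too. -/
theorem proj_Icc_neg_zero (hC : 0 < C) (hα : 0 < α) (n : ℕ) (g : Lp ℝ 2 μ) :
    E.proj (Icc (-(n : ℝ)) 0) g = 0 := by
  set S : Set ℝ := Icc (-(n : ℝ)) 0 with hS
  have hSm : MeasurableSet S := measurableSet_Icc
  refine Lp_eq_zero_of_ae_abs_le (K := fun t => C * t ^ (-α) * ‖g‖) (fun t ht => ?_) ?_
  · set φ : ℝ → ℝ := S.indicator (fun l => Real.exp (t * l)) with hφ
    have hφm : Measurable φ := Measurable.indicator (by fun_prop) hSm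
    have hφ1 : ∀ l, |φ l| ≤ 1 := by
      intro l
      by_cases hl : l ∈ S
      · rw [hφ, indicator_of_mem hl, abs_of_pos (Real.exp_pos _)]
        exact Real.exp_le_one_iff.2 (mul_nonpos_of_nonneg_of_nonpos ht.le hl.2)
      · simp [hφ, hl]
    have hdom : E.MemDom φ g := by
      refine E.memDom_mono (ψ := fun _ => 1) ?_ (ae_of_all _ fun l => by simpa using hφ1 l)
      exact (E.memDom_iff measurable_const g).2 (memLp_const 1)
    have hprod : (fun l => Real.exp (-t * l) * φ l) = ResolutionOfIdentity.ind hSm := by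
      ext l
      rw [ResolutionOfIdentity.ind_apply]
      by_cases hl : l ∈ S
      · simp [hφ, hl, ← Real.exp_add]
      · simp [hφ, hl]
    obtain ⟨h1, h2⟩ := E.app_app (φ := fun l => Real.exp (-t * l)) (by fun_prop) hφm hdom
      (by rw [hprod]; exact E.memDom_simpleFunc _ g)
    have h3 := hU t ht _ h1
    rw [h2, hprod, E.app_simpleFunc, ResolutionOfIdentity.ind, E.simpleOp_indicator, one_smul] at h3
    have h4 : ‖E.app φ g‖ ≤ ‖g‖ := by
      refine (sq_le_sq₀ (norm_nonneg _) (norm_nonneg _)).1 ?_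
      rw [E.norm_sq_app hφm hdom, ← E.measureReal_univ g]
      calc ∫ l, φ l ^ 2 ∂(E.measure g) ≤ ∫ _, (1 : ℝ) ∂(E.measure g) := by
            refine integral_mono ((E.memDom_iff hφm g).1 hdom).integrable_sq (integrable_const _) ?_
            intro l
            have := hφ1 l
            simp only
            rw [← sq_abs]
            nlinarith [abs_nonneg (φ l)]
        _ = _ := by simp
    have ht' : 0 < t ^ (-α) := Real.rpow_pos_of_pos ht _
    filter_upwards [h3] with x hx
    exact hx.trans (by gcongr)
  · have := ((tendsto_rpow_neg_atTop hα).const_mul C).mul_const ‖g‖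
    simpa using this

theorem proj_Iic_zero (hC : 0 < C) (hα : 0 < α) : E.proj (Iic 0) = 0 := by
  ext1 g
  have h := E.tendsto_proj_iUnion (S := fun n : ℕ => Icc (-(n : ℝ)) 0) (fun n => measurableSet_Icc)
    (fun m n hmn => Icc_subset_Icc_left (neg_le_neg (by exact_mod_cast hmn))) g
  have hU' : (⋃ n : ℕ, Icc (-(n : ℝ)) 0) = Iic 0 := by
    ext l
    simp only [mem_iUnion, mem_Icc, mem_Iic]
    refine ⟨fun ⟨_, h⟩ => h.2, fun h => ?_⟩
    obtain ⟨n, hn⟩ := exists_nat_ge (-l)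
    exact ⟨n, by linarith, h⟩
  rw [hU'] at h
  refine tendsto_nhds_unique h ?_
  simp_rw [hU.proj_Icc_neg_zero hC hα]
  exact tendsto_const_nhds

variable (hE : E.proj (Iic 0) = 0)
include hE

/-- Bernstein's inequality. -/
theorem ae_abs_proj_le {L : ℝ} (hL : 0 < L) (hC : 0 < C) {S : Set ℝ} (hS : MeasurableSet S)
    (hSL : S ⊆ Ioc 0 L) (f : Lp ℝ 2 μ) :
    ∀ᵐ x ∂μ, |E.proj S f x| ≤ C * Real.exp 1 * L ^ α * ‖E.proj S f‖ := by
  -- The heat time `1/L` is matched to the band: undoing `e^{-A/L}` costs at most a factor `e` on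
  -- `S`, and the ultracontractive factor becomes `L^α`.
  set φ : ℝ → ℝ := S.indicator (fun l => Real.exp (L⁻¹ * l)) with hφ
  have hφm : Measurable φ := Measurable.indicator (by fun_prop) hS
  have hφ1 : ∀ l, |φ l| ≤ Real.exp 1 := by
    intro l
    by_cases hl : l ∈ S
    · rw [hφ, indicator_of_mem hl, abs_of_pos (Real.exp_pos _)]
      refine Real.exp_le_exp.2 ?_
      rw [inv_mul_le_iff₀ hL]; linarith [(hSL hl).2]
    · simp [hφ, hl, (Real.exp_pos 1).le]
  have hb : IsBddSymbol φ := ⟨hφm, Real.exp 1, fun l _ => hφ1 l⟩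
  have hprod : (fun l => Real.exp (-L⁻¹ * l) * φ l) = S.indicator fun _ => 1 := by
    ext l
    by_cases hl : l ∈ S
    · simp [hφ, hl, ← Real.exp_add]
    · simp [hφ, hl]
  have hb' : IsBddSymbol fun l => Real.exp (-L⁻¹ * l) * φ l := by
    rw [hprod]
    refine ⟨measurable_const.indicator hS, 1, fun l _ => ?_⟩
    by_cases hl : l ∈ S <;> simp [hl]
  obtain ⟨h1, h2⟩ := ResolutionOfIdentity.app_op hE (φ := fun l => Real.exp (-L⁻¹ * l))
    (by fun_prop) hb hb' (E.proj S f)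
  have h3 := hU L⁻¹ (inv_pos.2 hL) _ h1
  have h5 : E.proj S (E.proj S f) = E.proj S f := by
    rw [← mul_apply_eq_comp, (E.isStarProjection S hS).isIdempotentElem.eq]
  rw [h2, hprod, ResolutionOfIdentity.op_indicator hE hS, h5, Real.rpow_neg (by positivity),
    Real.inv_rpow hL.le, inv_inv] at h3
  have h4 := ResolutionOfIdentity.norm_op_le hE hφm (fun l _ => hφ1 l) (E.proj S f)
  have hL' : 0 < L ^ α := Real.rpow_pos_of_pos hL _
  filter_upwards [h3] with x hx
  calc _ ≤ C * L ^ α * ‖E.op φ (E.proj S f)‖ := hx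
    _ ≤ C * L ^ α * (Real.exp 1 * ‖E.proj S f‖) := by gcongr
    _ = _ := by ring

/-- The heat semigroup from `L^r` to `L²`, `1 ≤ r ≤ 2`. -/
theorem norm_heat_le (hC : 0 < C) {r : ℝ} (hr1 : 1 ≤ r) (hr2 : r ≤ 2) {t : ℝ} (ht : 0 < t)
    (f : Lp ℝ 2 μ) (hf : MemLp f (ENNReal.ofReal r) μ) :
    ‖E.op (fun l => Real.exp (-t * l)) f‖ ≤
      C ^ (2 / r - 1) * t ^ (-(2 * α * (1 / r - 1 / 2))) *
        (eLpNorm f (ENNReal.ofReal r) μ).toReal := by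
  have hr0 : 0 < r := by linarith
  have hr' : 1 / r ≤ 1 := by rw [div_le_one hr0]; exact hr1
  have hr'' : 1 / 2 ≤ 1 / r := one_div_le_one_div_of_le hr0 hr2
  set e : ℝ → ℝ := fun l => Real.exp (-t * l) with he
  have hb : IsBddSymbol e := ⟨by fun_prop, 1, fun l hl => by
    rw [abs_of_pos (Real.exp_pos _)]
    exact Real.exp_le_one_iff.2 (by nlinarith)⟩
  -- Duality: `h = e^{-tA} f` and `k = e^{-tA} h` give `‖h‖² = ⟪k, f⟫`, where `k` is controlled both
  -- in `L²` and in sup norm by `‖h‖`.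
  set h := E.op e f with hh
  set k := E.op e h with hk
  rcases (norm_nonneg h).eq_or_lt with h0 | h0
  · rw [← h0]; positivity
  have hkn : ‖k‖ ≤ ‖h‖ := by
    have := ResolutionOfIdentity.norm_op_le hE hb.1 (M := 1) (fun l hl => by
      rw [abs_of_pos (Real.exp_pos _)]
      exact Real.exp_le_one_iff.2 (by nlinarith)) h
    simpa using this
  obtain ⟨K, hKdef⟩ : ∃ K, K = C * t ^ (-α) * ‖h‖ := ⟨_, rfl⟩
  have ht' : 0 < t ^ (-α) := Real.rpow_pos_of_pos ht _
  have hK : 0 < K := by rw [hKdef]; positivity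
  have hkK : ∀ᵐ x ∂μ, |k x| ≤ K := by
    have := hU t ht h (ResolutionOfIdentity.memDom_of_bdd hE hb h)
    rw [← ResolutionOfIdentity.op_apply hE hb] at this
    rw [hKdef]; exact this
  have hinner : ‖h‖ ^ 2 = inner ℝ k f := by
    rw [← real_inner_self_eq_norm_sq, hk, ResolutionOfIdentity.inner_op_left hE hb,
      real_inner_comm]
  set y := 1 / r with hy
  have hx0 : 0 ≤ 1 - y := by linarith
  have h1 : ENNReal.ofReal (‖h‖ ^ 2) ≤ ∫⁻ x, ‖k x‖ₑ * ‖f x‖ₑ ∂μ := by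
    rw [hinner, L2.inner_def]
    refine (ENNReal.ofReal_le_ofReal (Real.le_norm_self _)).trans ?_
    rw [ofReal_norm]
    refine (enorm_integral_le_lintegral_enorm _).trans (lintegral_mono fun x => ?_)
    simp [enorm_mul, mul_comm]
  have hKy : 0 ≤ 2 * y - 1 := by linarith
  -- With `y = 1/r`, split `|k| = |k|^{2y-1} |k|^{2(1-y)}`; the first factor is at most `K^{2y-1}`,
  -- and Hölder with weights `1 - y` and `y` handles the second against `f`.
  have h2 : ∫⁻ x, ‖k x‖ₑ * ‖f x‖ₑ ∂μ ≤
      ∫⁻ x, ENNReal.ofReal K ^ (2 * y - 1) * ((‖k x‖ₑ ^ (2 : ℝ)) ^ (1 - y) * (‖f x‖ₑ ^ r) ^ y)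
        ∂μ := by
    refine lintegral_mono_ae ?_
    filter_upwards [hkK] with x hx
    have hkx : ‖k x‖ₑ ≤ ENNReal.ofReal K := by
      rw [← ofReal_norm]; exact ENNReal.ofReal_le_ofReal hx
    rw [← ENNReal.rpow_mul, ← ENNReal.rpow_mul, hy, mul_one_div_cancel hr0.ne', ENNReal.rpow_one,
      ← mul_assoc]
    gcongr
    calc ‖k x‖ₑ = ‖k x‖ₑ ^ ((2 * (1 / r) - 1) + 2 * (1 - 1 / r)) := by
          ring_nf; rw [ENNReal.rpow_one]
      _ = ‖k x‖ₑ ^ (2 * (1 / r) - 1) * ‖k x‖ₑ ^ (2 * (1 - 1 / r)) :=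
          ENNReal.rpow_add_of_nonneg _ _ (by linarith) (by linarith)
      _ ≤ _ := by gcongr
  have h3 : ∫⁻ x, ((‖k x‖ₑ ^ (2 : ℝ)) ^ (1 - y) * (‖f x‖ₑ ^ r) ^ y) ∂μ ≤
      (∫⁻ x, ‖k x‖ₑ ^ (2 : ℝ) ∂μ) ^ (1 - y) * (∫⁻ x, ‖f x‖ₑ ^ r ∂μ) ^ y :=
    ENNReal.lintegral_mul_norm_pow_le ((Lp.aestronglyMeasurable k).enorm.pow_const _)
      ((Lp.aestronglyMeasurable f).enorm.pow_const _) hx0 (by positivity) (by ring)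
  have h4 : (∫⁻ x, ‖k x‖ₑ ^ (2 : ℝ) ∂μ) = ENNReal.ofReal (‖k‖ ^ 2) := by
    have := eLpNorm_eq_lintegral_rpow_enorm_toReal (p := 2) (μ := μ) (f := k) (by norm_num)
      (by norm_num)
    rw [← Lp.enorm_def, ENNReal.toReal_ofNat] at this
    rw [ENNReal.ofReal_pow (norm_nonneg _), ofReal_norm, this,
      ← ENNReal.rpow_natCast, ← ENNReal.rpow_mul]
    norm_num
  have h5 : (∫⁻ x, ‖f x‖ₑ ^ r ∂μ) ^ y = eLpNorm f (ENNReal.ofReal r) μ := by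
    rw [eLpNorm_eq_lintegral_rpow_enorm_toReal (by simpa using hr0) (by simp),
      ENNReal.toReal_ofReal hr0.le]
  have h6 : ENNReal.ofReal (‖h‖ ^ 2) ≤ ENNReal.ofReal
      (K ^ (2 * y - 1) * ((‖h‖ ^ 2) ^ (1 - y) * (eLpNorm f (ENNReal.ofReal r) μ).toReal)) := by
    refine (h1.trans h2).trans ?_
    rw [lintegral_const_mul' _ _ (by simp [hK])]
    rw [ENNReal.ofReal_mul (by positivity), ENNReal.ofReal_mul (by positivity),
      ENNReal.ofReal_toReal hf.eLpNorm_ne_top, ← ENNReal.ofReal_rpow_of_pos hK,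
      ← ENNReal.ofReal_rpow_of_nonneg (by positivity) hx0]
    gcongr
    refine h3.trans ?_
    rw [h5, h4]
    gcongr
  rw [ENNReal.ofReal_le_ofReal_iff (by positivity)] at h6
  have h7 : (‖h‖ ^ 2) ^ (1 - y) = ‖h‖ ^ (2 - 2 * y) := by
    rw [← Real.rpow_natCast, ← Real.rpow_mul h0.le]; congr 1; push_cast; ring
  have h8 : K ^ (2 * y - 1) = C ^ (2 * y - 1) * t ^ (-(2 * α * (y - 1 / 2))) * ‖h‖ ^ (2 * y - 1) := by
    rw [hKdef, Real.mul_rpow (by positivity) h0.le, Real.mul_rpow hC.le ht'.le,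
      ← Real.rpow_mul ht.le]
    congr 3; ring
  have h9 : ‖h‖ ^ (2 * y - 1) * ‖h‖ ^ (2 - 2 * y) = ‖h‖ := by
    rw [← Real.rpow_add h0]; ring_nf; rw [Real.rpow_one]
  have h10 : 2 / r - 1 = 2 * y - 1 := by rw [hy]; ring
  rw [h10]
  -- Since `K` itself contains `‖h‖`, the right side carries `‖h‖` to the power `(2y - 1) + (2 - 2y)
  -- = 1`, and one factor can be cancelled.
  rw [h7, h8] at h6
  refine le_of_mul_le_mul_right ?_ h0
  calc ‖h‖ * ‖h‖ = ‖h‖ ^ 2 := by ring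
    _ ≤ _ := h6
    _ = C ^ (2 * y - 1) * t ^ (-(2 * α * (y - 1 / 2))) * (eLpNorm f (ENNReal.ofReal r) μ).toReal *
        (‖h‖ ^ (2 * y - 1) * ‖h‖ ^ (2 - 2 * y)) := by ring
    _ = _ := by rw [h9]

end Ultracontractive

end DampedWave

end

/-! ### The Gagliardo–Nirenberg inequality by level sets -/

noncomputable section

namespace DampedWave

variable {X : Type*} [MeasurableSpace X] {μ : Measure X}

theorem ae_abs_le_of_tendsto {f : ℕ → Lp ℝ 2 μ} {g : Lp ℝ 2 μ} (h : Tendsto f atTop (𝓝 g)) {K : ℝ}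
    (hf : ∀ n, ∀ᵐ x ∂μ, |f n x| ≤ K) : ∀ᵐ x ∂μ, |g x| ≤ K := by
  obtain ⟨ns, -, hns⟩ := (tendstoInMeasure_of_tendsto_Lp h).exists_seq_tendsto_ae
  filter_upwards [hns, ae_all_iff.2 hf] with x hx hfx
  exact le_of_tendsto' hx.abs fun i => hfx (ns i)

theorem le_rpow_mul_rpow {x a y s : ℝ} (hx : 0 ≤ x) (ha : x ≤ a) (hy : x ≤ y) (hs0 : 0 ≤ s)
    (hs1 : s ≤ 1) : x ≤ a ^ (1 - s) * y ^ s := by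
  calc x = x ^ ((1 - s) + s) := by rw [sub_add_cancel, Real.rpow_one]
    _ = x ^ (1 - s) * x ^ s := Real.rpow_add_of_nonneg hx (by linarith) hs0
    _ ≤ _ := by
      have h1 : 0 ≤ 1 - s := by linarith
      have h2 : 0 ≤ a := hx.trans ha
      gcongr

theorem ResolutionOfIdentity.norm_proj_le_norm_app_sqrt
    {E : ResolutionOfIdentity (Lp ℝ 2 μ)} {f : Lp ℝ 2 μ} (hf : E.MemDom (fun l => √l) f) {c : ℝ} (hc : 0 < c)
    {S : Set ℝ} (hS : MeasurableSet S) (hSc : S ⊆ Ioi c) :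
    ‖E.proj S f‖ ≤ c ^ (-(1 / 2) : ℝ) * ‖E.app (fun l => √l) f‖ := by
  have hm : Measurable fun l : ℝ => √l := Real.continuous_sqrt.measurable
  have h1 : c * ‖E.proj S f‖ ^ 2 ≤ ‖E.app (fun l => √l) f‖ ^ 2 := by
    rw [E.norm_sq_app hm hf, ← E.measureReal_apply hS]
    calc c * (E.measure f).real S = ∫ l in S, c ∂(E.measure f) := by simp [mul_comm]
      _ ≤ ∫ l in S, √l ^ 2 ∂(E.measure f) := by
          refine setIntegral_mono_on (integrable_const _).integrableOn
            ((E.memDom_iff hm f).1 hf).integrable_sq.integrableOn hS fun l hl => ?_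
          have hl' : c < l := hSc hl
          rw [Real.sq_sqrt (by linarith)]; exact hl'.le
      _ ≤ _ := setIntegral_le_integral ((E.memDom_iff hm f).1 hf).integrable_sq
          (ae_of_all _ fun l => by positivity)
  have h2 : c ^ (-(1 / 2) : ℝ) = (√c)⁻¹ := by
    rw [Real.rpow_neg hc.le, Real.sqrt_eq_rpow]
  have hs : 0 < √c := Real.sqrt_pos.2 hc
  rw [h2, le_inv_mul_iff₀ hs]
  refine (sq_le_sq₀ (by positivity) (norm_nonneg _)).1 ?_
  rwa [mul_pow, Real.sq_sqrt hc.le]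

/-- The constant of the Gagliardo–Nirenberg inequality. -/
def gnConst (C p s σ : ℝ) : ℝ :=
  8 * p / (2 * p - 2) * (2 * (C * Real.exp 1 * 2 ^ (s / 2) * (1 - 2 ^ (-σ))⁻¹)) ^ (2 * p - 2)

namespace Ultracontractive

variable {E : ResolutionOfIdentity (Lp ℝ 2 μ)} {C α : ℝ} (hU : Ultracontractive E C α)
include hU

variable (hE : E.proj (Iic 0) = 0) (hC : 0 < C)
include hE hC

/-- The low frequencies of a function of `H¹(A)` are bounded. -/
theorem ae_abs_proj_Ioc_le {s σ : ℝ} (hs0 : 0 ≤ s) (hs1 : s ≤ 1) (hσ : σ = α - s / 2)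
    (hσ0 : 0 < σ) {L : ℝ} (hL : 0 < L) {f : Lp ℝ 2 μ} (hf : E.MemDom (fun l => √l) f) :
    ∀ᵐ x ∂μ, |E.proj (Ioc 0 L) f x| ≤ C * Real.exp 1 * 2 ^ (s / 2) * (1 - 2 ^ (-σ))⁻¹ *
      (‖f‖ ^ (1 - s) * ‖E.app (fun l => √l) f‖ ^ s) * L ^ σ := by
  set b := ‖E.app (fun l => √l) f‖ with hb
  have hb0 : 0 ≤ b := norm_nonneg _
  -- Dyadic bands of `(0, L]`. Bernstein costs `(L 2^{-j})^α` and the energy returns `(L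
  -- 2^{-j})^{-s/2}` up to a constant, so band `j` contributes a multiple of `2^{-σj}`, summable
  -- because `σ > 0`.
  set S : ℕ → Set ℝ := fun j => Ioc (L * 2⁻¹ ^ (j + 1)) (L * 2⁻¹ ^ j) with hSdef
  have hSm : ∀ j, MeasurableSet (S j) := fun j => measurableSet_Ioc
  have hanti : Antitone fun j : ℕ => L * (2⁻¹ : ℝ) ^ j := fun i j hij =>
    mul_le_mul_of_nonneg_left (pow_le_pow_of_le_one (by norm_num) (by norm_num) hij) hL.le
  have hdisj : Pairwise (Function.onFun Disjoint S) := by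
    have := hanti.pairwise_disjoint_on_Ioc_succ
    simpa [S, Nat.succ_eq_succ] using this
  have hUn : (⋃ j, S j) = Ioc 0 L := by
    ext l
    simp only [mem_iUnion, S, mem_Ioc]
    constructor
    · rintro ⟨j, h1, h2⟩
      refine ⟨lt_of_le_of_lt (by positivity) h1, h2.trans ?_⟩
      simpa using hanti (Nat.zero_le j)
    · rintro ⟨h1, h2⟩
      have hex : ∃ j : ℕ, L * 2⁻¹ ^ j < l := by
        obtain ⟨j, hj⟩ := exists_pow_lt_of_lt_one (div_pos h1 hL) (by norm_num : (2⁻¹ : ℝ) < 1)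
        exact ⟨j, by rw [lt_div_iff₀ hL] at hj; linarith⟩
      classical
      have hfind := Nat.find_spec hex
      have hne : Nat.find hex ≠ 0 := by
        intro h0
        rw [h0] at hfind
        simp at hfind
        linarith
      obtain ⟨j, hj⟩ := Nat.exists_eq_succ_of_ne_zero hne
      rw [hj] at hfind
      exact ⟨j, hfind, not_lt.1 (Nat.find_min hex (by omega))⟩
  have hsum := E.hasSum_proj S hSm hdisj f
  rw [hUn] at hsum
  set M := ‖f‖ ^ (1 - s) * b ^ s with hM
  have hM0 : 0 ≤ M := by positivity
  set r : ℝ := 2 ^ (-σ) with hr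
  have hr0 : 0 < r := by positivity
  have hr1 : r < 1 := Real.rpow_lt_one_of_one_lt_of_neg (by norm_num) (by linarith)
  set B := C * Real.exp 1 * 2 ^ (s / 2) * M * L ^ σ with hB
  have hB0 : 0 ≤ B := by positivity
  have hpiece : ∀ j, ∀ᵐ x ∂μ, |E.proj (S j) f x| ≤ B * r ^ j := by
    intro j
    have hLj : 0 < L * (2⁻¹ : ℝ) ^ j := by positivity
    have hLj' : 0 < L * (2⁻¹ : ℝ) ^ (j + 1) := by positivity
    have h1 := hU.ae_abs_proj_le hE hLj hC (hSm j)
      (fun l hl => ⟨lt_trans hLj' hl.1, hl.2⟩) f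
    have h2 := ResolutionOfIdentity.norm_proj_le_norm_app_sqrt hf hLj' (hSm j) (fun l hl => hl.1)
    -- The geometric mean of the trivial bound `‖f‖` and the bound by `‖A^{1/2} f‖` on the band.
    have h3 := le_rpow_mul_rpow (norm_nonneg _) (E.norm_proj_apply_le (hSm j) f) h2 hs0 hs1
    have h4 : ‖f‖ ^ (1 - s) * ((L * (2⁻¹ : ℝ) ^ (j + 1)) ^ (-(1 / 2) : ℝ) * b) ^ s =
        M * (L * (2⁻¹ : ℝ) ^ (j + 1)) ^ (-(s / 2)) := by
      rw [Real.mul_rpow (by positivity) hb0, ← Real.rpow_mul hLj'.le, hM]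
      have : -(1 / 2) * s = -(s / 2) := by ring
      rw [this]; ring
    rw [h4] at h3
    have h5 : (L * (2⁻¹ : ℝ) ^ j) ^ α * (L * (2⁻¹ : ℝ) ^ (j + 1)) ^ (-(s / 2)) =
        2 ^ (s / 2) * L ^ σ * r ^ j := by
      have e1 : L * (2⁻¹ : ℝ) ^ (j + 1) = (L * (2⁻¹ : ℝ) ^ j) * 2⁻¹ := by ring
      rw [e1, Real.mul_rpow hLj.le (by norm_num), ← mul_assoc, ← Real.rpow_add hLj,
        show α + -(s / 2) = σ by rw [hσ]; ring, Real.mul_rpow hL.le (by positivity)]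
      have e2 : ((2⁻¹ : ℝ) ^ j) ^ σ = r ^ j := by
        rw [← Real.rpow_natCast, ← Real.rpow_mul (by norm_num), mul_comm, Real.rpow_mul (by norm_num),
          Real.rpow_natCast, Real.inv_rpow (by norm_num), ← Real.rpow_neg (by norm_num)]
      have e3 : (2⁻¹ : ℝ) ^ (-(s / 2)) = 2 ^ (s / 2) := by
        rw [Real.inv_rpow (by norm_num), ← Real.rpow_neg (by norm_num), neg_neg]
      rw [e2, e3]; ring
    filter_upwards [h1] with x hx
    calc _ ≤ _ := hx
      _ ≤ C * Real.exp 1 * (L * (2⁻¹ : ℝ) ^ j) ^ α *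
          (M * (L * (2⁻¹ : ℝ) ^ (j + 1)) ^ (-(s / 2))) := by gcongr
      _ = C * Real.exp 1 * M * ((L * (2⁻¹ : ℝ) ^ j) ^ α *
          (L * (2⁻¹ : ℝ) ^ (j + 1)) ^ (-(s / 2))) := by ring
      _ = _ := by rw [h5, hB]; ring
  -- The partial sums converge only in `L²`, but a uniform sup bound passes to the limit along an
  -- almost everywhere convergent subsequence.
  have hfin : ∀ n, ∀ᵐ x ∂μ, |(∑ j ∈ Finset.range n, E.proj (S j) f : Lp ℝ 2 μ) x| ≤
      B * (1 - r)⁻¹ := by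
    intro n
    filter_upwards [Lp.coeFn_finsetSum (Finset.range n) (fun j => E.proj (S j) f),
      ae_all_iff.2 hpiece] with x hx hpx
    rw [hx, Finset.sum_apply]
    calc |∑ j ∈ Finset.range n, E.proj (S j) f x| ≤ ∑ j ∈ Finset.range n, |E.proj (S j) f x| :=
          Finset.abs_sum_le_sum_abs _ _
      _ ≤ ∑ j ∈ Finset.range n, B * r ^ j := Finset.sum_le_sum fun j _ => hpx j
      _ = B * ∑ j ∈ Finset.range n, r ^ j := by rw [Finset.mul_sum]
      _ ≤ B * (1 - r)⁻¹ := by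
          gcongr
          rw [← tsum_geometric_of_lt_one hr0.le hr1]
          exact (summable_geometric_of_lt_one hr0.le hr1).sum_le_tsum _ fun j _ => by positivity
  have := ae_abs_le_of_tendsto hsum.tendsto_sum_nat hfin
  filter_upwards [this] with x hx
  refine hx.trans (le_of_eq ?_)
  rw [hB]; ring

/-- The Gagliardo–Nirenberg inequality, the critical Sobolev exponent included. -/
theorem lintegral_rpow_le {p s σ : ℝ} (hp : 1 < p) (hs0 : 0 ≤ s) (hs1 : s ≤ 1)
    (hσ : σ = α - s / 2) (hσp : σ * (2 * p - 2) = 1) {f : Lp ℝ 2 μ}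
    (hf : E.MemDom (fun l => √l) f) :
    ∫⁻ x, ENNReal.ofReal (|f x| ^ (2 * p)) ∂μ ≤ ENNReal.ofReal (gnConst C p s σ *
      ((‖f‖ ^ (1 - s) * ‖E.app (fun l => √l) f‖ ^ s) ^ (2 * p - 2) *
        ‖E.app (fun l => √l) f‖ ^ 2)) := by
  have hp2 : 0 < 2 * p - 2 := by linarith
  have hσ0 : 0 < σ := by
    by_contra hcon
    nlinarith
  have hm : Measurable fun l : ℝ => √l := Real.continuous_sqrt.measurable
  have hb2 := E.norm_sq_app hm hf
  have hint := ((E.memDom_iff hm f).1 hf).integrable_sq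
  set b := ‖E.app (fun l => √l) f‖ with hb
  have hb0 : 0 ≤ b := norm_nonneg _
  obtain ⟨M, hM⟩ : ∃ M, M = ‖f‖ ^ (1 - s) * b ^ s := ⟨_, rfl⟩
  have hM0 : 0 ≤ M := by rw [hM]; positivity
  rw [← hM]
  obtain ⟨C₁, hC₁⟩ : ∃ C₁, C₁ = C * Real.exp 1 * 2 ^ (s / 2) * (1 - 2 ^ (-σ))⁻¹ := ⟨_, rfl⟩
  have hC₁0 : 0 < C₁ := by
    have : (2 : ℝ) ^ (-σ) < 1 := Real.rpow_lt_one_of_one_lt_of_neg (by norm_num) (by linarith)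
    have : 0 < 1 - (2 : ℝ) ^ (-σ) := by linarith
    rw [hC₁]; positivity
  -- If `M = 0` then `f = 0` or `A^{1/2} f = 0`, and the latter again forces `f = 0` since all
  -- frequencies are positive. Otherwise `M` may be divided by.
  rcases hM0.eq_or_lt with hM0 | hM0
  · have hf0 : f = 0 := by
      rw [hM, eq_comm, mul_eq_zero] at hM0
      have h0 : ‖f‖ = 0 ∨ b = 0 := by
        rcases hM0 with h | h
        · exact Or.inl ((Real.rpow_eq_zero_iff_of_nonneg (norm_nonneg _)).1 h).1
        · exact Or.inr ((Real.rpow_eq_zero_iff_of_nonneg hb0).1 h).1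
      rcases h0 with h | h
      · exact norm_eq_zero.1 h
      · rw [h, zero_pow two_ne_zero, eq_comm,
          integral_eq_zero_iff_of_nonneg (fun l => by positivity) hint] at hb2
        have : ∀ᵐ l ∂(E.measure f), False := by
          filter_upwards [hb2, ResolutionOfIdentity.ae_pos hE f] with l h1 h2
          have : 0 < √l := Real.sqrt_pos.2 h2
          simp only [Pi.zero_apply] at h1
          nlinarith
        have h3 : E.measure f = 0 := by
          rw [← ae_eq_bot]; exact eventually_false_iff_eq_bot.1 this
        have h4 := E.measureReal_univ f
        rw [h3] at h4
        simp at h4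
        simpa using h4.symm
    subst hf0
    have : ∫⁻ x, ENNReal.ofReal (|(0 : Lp ℝ 2 μ) x| ^ (2 * p)) ∂μ = 0 := by
      rw [lintegral_eq_zero_iff']
      · filter_upwards [Lp.coeFn_zero ℝ 2 μ] with x hx
        rw [hx]
        simp [Real.zero_rpow (by linarith : 2 * p ≠ 0)]
      · have := (Lp.aestronglyMeasurable (0 : Lp ℝ 2 μ)).aemeasurable
        exact (this.abs.pow_const _).ennreal_ofReal
    rw [this]; exact zero_le
  -- Chosen so that the sup bound `C₁ M L^σ` of the low frequencies equals `t/2` exactly when `c₀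
  -- L^σ = t`.
  set c₀ := 2 * C₁ * M with hc₀
  have hc₀0 : 0 < c₀ := by positivity
  have hfm := (Lp.aestronglyMeasurable f).aemeasurable
  rw [lintegral_rpow_eq_lintegral_meas_lt_mul μ (ae_of_all _ fun x => abs_nonneg _) hfm.abs
    (by linarith : 0 < 2 * p)]
  -- Where `|f| > t`, the part above the frequency `L(t)` exceeds `t/2`. Chebyshev gives `4/t²`
  -- times its squared norm, which is the spectral mass of `(L(t), ∞)`.
  have hlevel : ∀ t : ℝ, 0 < t → μ {a | t < |f a|} ≤
      ENNReal.ofReal (4 / t ^ 2) * E.measure f {l | t < c₀ * |l| ^ σ} := by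
    intro t ht
    obtain ⟨L, hL⟩ : ∃ L, L = (t / c₀) ^ (1 / σ) := ⟨_, rfl⟩
    have hL0 : 0 < L := by rw [hL]; positivity
    have hLσ : c₀ * L ^ σ = t := by
      rw [hL, ← Real.rpow_mul (by positivity), one_div_mul_cancel hσ0.ne', Real.rpow_one]
      field_simp
    have hlow := hU.ae_abs_proj_Ioc_le hE hC hs0 hs1 hσ hσ0 hL0 hf
    rw [← hC₁, ← hb, ← hM] at hlow
    have hsplit : f = E.proj (Ioc 0 L) f + E.proj (Ioi L) f := by
      have h1 := E.proj_union measurableSet_Ioc measurableSet_Ioi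
        (show Disjoint (Ioc 0 L) (Ioi L) from
          Set.disjoint_left.2 fun x hx hx' => not_lt.2 hx.2 hx')
      have h2 := E.proj_union measurableSet_Iic measurableSet_Ioi
        (show Disjoint (Iic (0 : ℝ)) (Ioi 0) from Set.Iic_disjoint_Ioi le_rfl)
      rw [Ioc_union_Ioi_eq_Ioi hL0.le] at h1
      rw [Iic_union_Ioi, E.proj_univ, hE, zero_add, h1] at h2
      calc f = (1 : Lp ℝ 2 μ →L[ℝ] Lp ℝ 2 μ) f := rfl
        _ = _ := by rw [h2]; rfl
    set h := E.proj (Ioi L) f with hh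
    have hsub : μ {a | t < |f a|} ≤ μ {x | ENNReal.ofReal (t / 2) ≤ ‖h x‖ₑ} := by
      refine measure_mono_ae ?_
      have h2 := Lp.coeFn_add (E.proj (Ioc 0 L) f) h
      rw [← hsplit] at h2
      filter_upwards [hlow, h2] with x hx hx2 (hx3 : t < |f x|)
      rw [Pi.add_apply] at hx2
      change ENNReal.ofReal (t / 2) ≤ ‖h x‖ₑ
      rw [← ofReal_norm, Real.norm_eq_abs]
      refine ENNReal.ofReal_le_ofReal ?_
      have h4 : C₁ * M * L ^ σ = t / 2 := by rw [← hLσ, hc₀]; ring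
      rw [h4] at hx
      rw [hx2] at hx3
      have := abs_add_le (E.proj (Ioc 0 L) f x) (h x)
      linarith
    refine hsub.trans ((meas_ge_le_mul_pow_eLpNorm_enorm μ (p := 2) (by norm_num) (by norm_num)
      (Lp.aestronglyMeasurable h) (by simpa using ht) (by simp)).trans ?_)
    rw [← Lp.enorm_def, ENNReal.toReal_ofNat, ← ofReal_norm]
    have h5 : ENNReal.ofReal ‖h‖ ^ (2 : ℝ) = E.measure f (Ioi L) := by
      rw [E.measure_apply measurableSet_Ioi, ENNReal.ofReal_pow (norm_nonneg _)]
      exact_mod_cast ENNReal.rpow_natCast _ 2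
    rw [h5]
    refine mul_le_mul' (le_of_eq ?_) (measure_mono fun l (hl : L < l) => ?_)
    · rw [← ENNReal.ofReal_inv_of_pos (by positivity), ENNReal.ofReal_rpow_of_pos (by positivity)]
      congr 1
      rw [show ((2 : ℝ)) = ((2 : ℕ) : ℝ) by norm_num, Real.rpow_natCast]
      field_simp
      norm_num
    · change t < c₀ * |l| ^ σ
      rw [← hLσ, abs_of_pos (hL0.trans hl)]
      gcongr
  have hlayer := lintegral_rpow_eq_lintegral_meas_lt_mul (E.measure f)
    (f := fun l => c₀ * |l| ^ σ) (ae_of_all _ fun l => by positivity) (by fun_prop) hp2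
  -- The layer cake formula is read backwards on the spectral measure; as `σ(2p - 2) = 1`, the
  -- resulting moment is exactly `∫ λ d‖E f‖² = b²`.
  have hmom : ∫⁻ l, ENNReal.ofReal ((c₀ * |l| ^ σ) ^ (2 * p - 2)) ∂(E.measure f) =
      ENNReal.ofReal (c₀ ^ (2 * p - 2) * b ^ 2) := by
    rw [hb2, ← integral_const_mul, ofReal_integral_eq_lintegral_ofReal (hint.const_mul _)
      (ae_of_all _ fun l => by positivity)]
    refine lintegral_congr_ae ?_
    filter_upwards [ResolutionOfIdentity.ae_pos hE f] with l hl
    rw [Real.mul_rpow hc₀0.le (by positivity), ← Real.rpow_mul (abs_nonneg l), hσp, Real.rpow_one,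
      abs_of_pos hl, Real.sq_sqrt hl.le]
  have hmid : ∫⁻ t in Ioi (0 : ℝ), μ {a | t < |f a|} * ENNReal.ofReal (t ^ (2 * p - 1)) ≤
      ENNReal.ofReal 4 * ∫⁻ t in Ioi (0 : ℝ), E.measure f {l | t < c₀ * |l| ^ σ} *
        ENNReal.ofReal (t ^ (2 * p - 2 - 1)) := by
    rw [← lintegral_const_mul' _ _ (by simp)]
    refine setLIntegral_mono' measurableSet_Ioi fun t (ht : 0 < t) => ?_
    calc μ {a | t < |f a|} * ENNReal.ofReal (t ^ (2 * p - 1))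
        ≤ (ENNReal.ofReal (4 / t ^ 2) * E.measure f {l | t < c₀ * |l| ^ σ}) *
            ENNReal.ofReal (t ^ (2 * p - 1)) := by gcongr; exact hlevel t ht
      _ = E.measure f {l | t < c₀ * |l| ^ σ} *
            (ENNReal.ofReal (4 / t ^ 2) * ENNReal.ofReal (t ^ (2 * p - 1))) := by ring
      _ = E.measure f {l | t < c₀ * |l| ^ σ} *
            (ENNReal.ofReal 4 * ENNReal.ofReal (t ^ (2 * p - 2 - 1))) := by
          congr 1
          rw [← ENNReal.ofReal_mul (by positivity), ← ENNReal.ofReal_mul (by positivity)]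
          congr 1
          have : t ^ (2 * p - 1) = t ^ (2 * p - 2 - 1) * t ^ 2 := by
            rw [← Real.rpow_natCast t 2, ← Real.rpow_add ht]; congr 1; push_cast; ring
          rw [this]; field_simp
      _ = _ := by ring
  rw [hmom] at hlayer
  have hI : ∫⁻ t in Ioi (0 : ℝ), E.measure f {l | t < c₀ * |l| ^ σ} *
      ENNReal.ofReal (t ^ (2 * p - 2 - 1)) =
      ENNReal.ofReal ((2 * p - 2)⁻¹ * (c₀ ^ (2 * p - 2) * b ^ 2)) := by
    rw [ENNReal.ofReal_mul (by positivity), hlayer, ← mul_assoc,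
      ← ENNReal.ofReal_mul (by positivity), inv_mul_cancel₀ hp2.ne', ENNReal.ofReal_one, one_mul]
  calc _ ≤ ENNReal.ofReal (2 * p) * (ENNReal.ofReal 4 *
        ENNReal.ofReal ((2 * p - 2)⁻¹ * (c₀ ^ (2 * p - 2) * b ^ 2))) := by
        rw [← hI]; gcongr
    _ = _ := by
        rw [← ENNReal.ofReal_mul (by norm_num), ← ENNReal.ofReal_mul (by linarith)]
        congr 1
        rw [gnConst, ← hC₁, hc₀, Real.mul_rpow (by positivity) hM0.le]
        field_simp
        ring

end Ultracontractive

end DampedWave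

end

/-! ### Decay of the linear propagators -/

noncomputable section

namespace DampedWave

variable {X : Type*} [MeasurableSpace X] {μ : Measure X}

section Linear

theorem exists_rpow_mul_exp_le {b : ℝ} (hb : 0 ≤ b) :
    ∃ c : ℝ, 0 < c ∧ ∀ t, 0 ≤ t → Real.exp (-(t / 8)) ≤ c * (1 + t) ^ (-b) := by
  obtain ⟨c, hc⟩ : ∃ c, c = 8 * max b 1 := ⟨_, rfl⟩
  have hc1 : 1 ≤ c := by rw [hc]; linarith [le_max_right b 1]
  refine ⟨c ^ b, by positivity, fun t ht => ?_⟩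
  have h1 : 1 + t ≤ c * Real.exp (t / c) := by
    have := Real.add_one_le_exp (t / c)
    have h2 : c * (t / c) = t := by field_simp
    nlinarith
  have h2 : (1 + t) ^ b ≤ c ^ b * Real.exp (t / 8) := by
    calc (1 + t) ^ b ≤ (c * Real.exp (t / c)) ^ b := by gcongr
      _ = c ^ b * Real.exp (t / c * b) := by
          rw [Real.mul_rpow (by positivity) (by positivity), ← Real.exp_mul]
      _ ≤ _ := by
          gcongr
          rw [div_mul_eq_mul_div, div_le_div_iff₀ (by positivity) (by norm_num), hc]
          nlinarith [le_max_left b 1]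
  rw [Real.rpow_neg (by positivity), Real.exp_neg, ← div_eq_mul_inv, le_div_iff₀ (by positivity),
    inv_mul_le_iff₀ (Real.exp_pos _), mul_comm]
  exact h2

/-- The decay exponent of the heat semigroup from `L^r` to `L²`. -/
def heatExp (α r : ℝ) : ℝ := 2 * α * (1 / r - 1 / 2)

theorem heatExp_nonneg {α r : ℝ} (hα : 0 ≤ α) (hr : 0 < r) (hr2 : r ≤ 2) : 0 ≤ heatExp α r := by
  have := one_div_le_one_div_of_le hr hr2
  unfold heatExp
  have : 0 ≤ 1 / r - 1 / 2 := by linarith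
  positivity

theorem isBddSymbol_heat {t : ℝ} (ht : 0 ≤ t) : IsBddSymbol fun l => Real.exp (-t * l) :=
  ⟨by fun_prop, 1, fun l hl => by
    rw [abs_of_pos (Real.exp_pos _)]
    exact Real.exp_le_one_iff.2 (by nlinarith)⟩

theorem isBddSymbol_gSymbol {t : ℝ} (ht : 0 ≤ t) : IsBddSymbol (gSymbol t) := by
  have h := (isBddSymbol_heat (by positivity : 0 ≤ t / 2)).add
    (isBddSymbol_const (Real.exp (-(t / 8))))
  exact h

/-- Families of symbols with the decay of the heat semigroup and a factor `(1 + t)^{-k}`. -/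
def HasDecay (m : ℝ → ℝ → ℝ) (k : ℝ) : Prop :=
  ∃ K, 0 ≤ K ∧ ∀ t, 0 ≤ t → ∀ l, 0 < l → (1 + t) ^ k * |m t l| ≤ K * gSymbol t l

theorem HasDecay.mono {m m' : ℝ → ℝ → ℝ} {k k' : ℝ} (hm : HasDecay m k) (hk : k' ≤ k)
    (h : ∀ t, 0 ≤ t → ∀ l, 0 < l → |m' t l| ≤ |m t l|) : HasDecay m' k' := by
  obtain ⟨K, hK, hm⟩ := hm
  refine ⟨K, hK, fun t ht l hl => le_trans ?_ (hm t ht l hl)⟩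
  have : (1 + t) ^ k' ≤ (1 + t) ^ k := Real.rpow_le_rpow_of_exponent_le (by linarith) hk
  have := h t ht l hl
  gcongr

theorem hasDecay_d : HasDecay dSymbol 0 :=
  ⟨600, by norm_num, fun t ht l hl => by simpa using abs_dSymbol_le ht hl⟩

theorem hasDecay_sqrt_d : HasDecay (fun t l => √l * dSymbol t l) (1 / 2) :=
  ⟨600, by norm_num, fun t ht l hl => by
    rw [← Real.sqrt_eq_rpow, abs_mul, abs_of_nonneg (Real.sqrt_nonneg l)]
    exact abs_sqrt_mul_dSymbol_le ht hl⟩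

theorem hasDecay_dt : HasDecay dtSymbol 1 :=
  ⟨600, by norm_num, fun t ht l hl => by simpa using abs_dtSymbol_le ht hl⟩

theorem hasDecay_dtt : HasDecay (fun t l => dttSymbol t l * jSymbol l) 1 :=
  ⟨1200, by norm_num, fun t ht l hl => by simpa using abs_dttSymbol_le ht hl⟩

variable {E : ResolutionOfIdentity (Lp ℝ 2 μ)} {C α : ℝ}

/-- For `t > 1` the heat part has its `L^r → L²` rate; for `t ≤ 1`, where that rate is singular, and
for the exponential part, boundedness on `L²` is used. Hence the sum of the two norms on the right.
-/
theorem Ultracontractive.exists_norm_gSymbol_le (hU : Ultracontractive E C α)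
    (hE : E.proj (Iic 0) = 0) (hC : 0 < C) (hα : 0 < α) {r : ℝ} (hr1 : 1 ≤ r) (hr2 : r ≤ 2) :
    ∃ c, 0 < c ∧ ∀ t, 0 ≤ t → ∀ f : Lp ℝ 2 μ, MemLp f (ENNReal.ofReal r) μ →
      ‖E.op (gSymbol t) f‖ ≤
        c * (1 + t) ^ (-heatExp α r) * ((eLpNorm f (ENNReal.ofReal r) μ).toReal + ‖f‖) := by
  set b := heatExp α r with hb
  have hb0 : 0 ≤ b := heatExp_nonneg hα.le (by linarith) hr2
  obtain ⟨c, hc0, hc⟩ := exists_rpow_mul_exp_le hb0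
  refine ⟨2 ^ b + C ^ (2 / r - 1) * 4 ^ b + c, by positivity, fun t ht f hf => ?_⟩
  set n := (eLpNorm f (ENNReal.ofReal r) μ).toReal with hn
  have hn0 : 0 ≤ n := ENNReal.toReal_nonneg
  have hf0 := norm_nonneg f
  have hp : 0 < (1 + t) ^ (-b) := by positivity
  have h1 : E.op (gSymbol t) f =
      E.op (fun l => Real.exp (-(t / 2) * l)) f + Real.exp (-(t / 8)) • f := by
    have := ResolutionOfIdentity.op_add hE (isBddSymbol_heat (by positivity : 0 ≤ t / 2))
      (isBddSymbol_const (Real.exp (-(t / 8)))) f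
    rw [ResolutionOfIdentity.op_const hE] at this
    exact this
  have h2 : ‖E.op (fun l => Real.exp (-(t / 2) * l)) f‖ ≤
      (2 ^ b + C ^ (2 / r - 1) * 4 ^ b) * (1 + t) ^ (-b) * (n + ‖f‖) := by
    rcases le_or_gt t 1 with ht1 | ht1
    · have h3 := ResolutionOfIdentity.norm_op_le hE (isBddSymbol_heat (by positivity : 0 ≤ t / 2)).1
        (M := 1) (fun l hl => by
          rw [abs_of_pos (Real.exp_pos _)]
          exact Real.exp_le_one_iff.2 (by nlinarith)) f
      have h4 : 1 ≤ 2 ^ b * (1 + t) ^ (-b) := by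
        rw [Real.rpow_neg (by positivity), ← div_eq_mul_inv, one_le_div (by positivity)]
        gcongr
        linarith
      calc _ ≤ 1 * ‖f‖ := h3
        _ ≤ (2 ^ b * (1 + t) ^ (-b)) * (n + ‖f‖) := by gcongr; linarith
        _ ≤ _ := by
          rw [add_mul]
          gcongr
          have : 0 ≤ C ^ (2 / r - 1) * 4 ^ b * (1 + t) ^ (-b) := by positivity
          linarith
    · have h3 := hU.norm_heat_le hE hC hr1 hr2 (t := t / 2) (by positivity) f hf
      have h4 : (t / 2) ^ (-b) ≤ 4 ^ b * (1 + t) ^ (-b) := by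
        rw [Real.rpow_neg (by positivity), Real.rpow_neg (by positivity), ← div_eq_mul_inv,
          inv_le_comm₀ (by positivity) (by positivity), inv_div, div_le_iff₀ (by positivity),
          ← Real.mul_rpow (by positivity) (by norm_num)]
        gcongr
        linarith
      calc _ ≤ C ^ (2 / r - 1) * (t / 2) ^ (-b) * n := h3
        _ ≤ C ^ (2 / r - 1) * (4 ^ b * (1 + t) ^ (-b)) * (n + ‖f‖) := by gcongr; linarith
        _ ≤ _ := by
          have : 0 ≤ 2 ^ b * (1 + t) ^ (-b) * (n + ‖f‖) := by positivity
          linarith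
  rw [h1]
  calc _ ≤ ‖E.op (fun l => Real.exp (-(t / 2) * l)) f‖ + ‖Real.exp (-(t / 8)) • f‖ := norm_add_le _ _
    _ ≤ (2 ^ b + C ^ (2 / r - 1) * 4 ^ b) * (1 + t) ^ (-b) * (n + ‖f‖) +
        c * (1 + t) ^ (-b) * (n + ‖f‖) := by
        rw [norm_smul, Real.norm_eq_abs, abs_of_pos (Real.exp_pos _)]
        gcongr
        · exact hc t ht
        · linarith
    _ = _ := by ring

/-- In `L²`, pointwise domination of symbols is domination of norms, so every propagator inherits
the decay of `gSymbol`, with its own factor `(1 + t)^{-k}`. -/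
theorem Ultracontractive.exists_norm_op_le (hU : Ultracontractive E C α)
    (hE : E.proj (Iic 0) = 0) (hC : 0 < C) (hα : 0 < α) {r : ℝ} (hr1 : 1 ≤ r) (hr2 : r ≤ 2)
    {m : ℝ → ℝ → ℝ} (hm : IsSymbolFamily m) {k : ℝ} (hk : HasDecay m k) :
    ∃ c, 0 < c ∧ ∀ t, 0 ≤ t → ∀ f : Lp ℝ 2 μ, MemLp f (ENNReal.ofReal r) μ →
      ‖E.op (m t) f‖ ≤
        c * (1 + t) ^ (-k - heatExp α r) * ((eLpNorm f (ENNReal.ofReal r) μ).toReal + ‖f‖) := by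
  obtain ⟨c, hc0, hc⟩ := hU.exists_norm_gSymbol_le hE hC hα hr1 hr2
  obtain ⟨K, hK0, hK⟩ := hk
  refine ⟨(K + 1) * c, by positivity, fun t ht f hf => ?_⟩
  have h1 := hc t ht f hf
  set n := (eLpNorm f (ENNReal.ofReal r) μ).toReal with hn
  have hn0 : 0 ≤ n := ENNReal.toReal_nonneg
  have hb := isBddSymbol_gSymbol ht
  have ht1 : 0 < 1 + t := by linarith
  have h2 : ‖E.op (m t) f‖ ≤ (1 + t) ^ (-k) * K * ‖E.op (gSymbol t) f‖ := by
    have := ResolutionOfIdentity.norm_op_mono hE (hm.isBddSymbol t)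
      ((isBddSymbol_const ((1 + t) ^ (-k) * K)).mul hb) (fun l hl => ?_) f
    · rwa [ResolutionOfIdentity.op_const_mul hE _ hb, norm_smul, Real.norm_eq_abs,
        abs_of_nonneg (by positivity)] at this
    · rw [abs_mul, abs_of_pos (gSymbol_pos t l),
        abs_of_nonneg (show 0 ≤ (1 + t) ^ (-k) * K by positivity), mul_assoc,
        Real.rpow_neg ht1.le, ← div_eq_inv_mul, le_div_iff₀ (by positivity), mul_comm]
      exact hK t ht l hl
  have h3 : (1 + t) ^ (-k - heatExp α r) = (1 + t) ^ (-k) * (1 + t) ^ (-heatExp α r) := by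
    rw [← Real.rpow_add ht1]; congr 1
  rw [h3]
  calc _ ≤ _ := h2
    _ ≤ (1 + t) ^ (-k) * (K + 1) * (c * (1 + t) ^ (-heatExp α r) * (n + ‖f‖)) := by
        gcongr; linarith
    _ = _ := by ring

end Linear

/-! ### Size and Lipschitz estimates for the superposition operator -/

section Nonlinearity

theorem IsNonlinearity.exists_const {F : ℝ → ℝ} {p : ℝ} (hF : IsNonlinearity F p) :
    ∃ c, 0 < c ∧ ∀ z₁ z₂ : ℝ, |F z₁ - F z₂| ≤ c * (|z₁| + |z₂|) ^ (p - 1) * |z₁ - z₂| := by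
  obtain ⟨C, hC⟩ := hF.lipschitz
  refine ⟨max C 1, by positivity, fun z₁ z₂ => (hC z₁ z₂).trans ?_⟩
  gcongr
  exact le_max_left _ _

theorem abs_le_of_nonlinearity {F : ℝ → ℝ} {p c : ℝ} (hF0 : F 0 = 0) (hp : 1 < p)
    (hc : ∀ z₁ z₂ : ℝ, |F z₁ - F z₂| ≤ c * (|z₁| + |z₂|) ^ (p - 1) * |z₁ - z₂|) (z : ℝ) :
    |F z| ≤ c * |z| ^ p := by
  have h := hc z 0
  rw [hF0, sub_zero, abs_zero, add_zero, sub_zero, mul_assoc] at h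
  refine h.trans (le_of_eq ?_)
  congr 1
  rw [← Real.rpow_add_one' (abs_nonneg z) (by linarith), sub_add_cancel]

theorem lintegral_sq_eq (f : Lp ℝ 2 μ) : ∫⁻ x, ENNReal.ofReal (|f x| ^ (2 : ℝ)) ∂μ =
    ENNReal.ofReal (‖f‖ ^ 2) := by
  have := eLpNorm_eq_lintegral_rpow_enorm_toReal (p := 2) (μ := μ) (f := f) (by norm_num)
    (by norm_num)
  rw [← Lp.enorm_def, ENNReal.toReal_ofNat] at this
  rw [ENNReal.ofReal_pow (norm_nonneg _), ofReal_norm, this, ← ENNReal.rpow_natCast,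
    ← ENNReal.rpow_mul]
  norm_num
  refine lintegral_congr fun x => ?_
  rw [← ofReal_norm, ← ENNReal.ofReal_pow (norm_nonneg _)]
  simp

/-- Interpolation between `L²` and `L^{2p}` for the nonlinearity. -/
theorem eLpNorm_comp_le {F : ℝ → ℝ} {p c : ℝ} (hp : 1 < p) (hc0 : 0 < c)
    (hc : ∀ z, |F z| ≤ c * |z| ^ p) {f : Lp ℝ 2 μ} {a B : ℝ} (ha : ‖f‖ ≤ a)
    (hB0 : 0 ≤ B) (hB : ∫⁻ x, ENNReal.ofReal (|f x| ^ (2 * p)) ∂μ ≤ ENNReal.ofReal B) {r θ : ℝ}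
    (hr : 0 < r) (hθ0 : 0 ≤ θ) (hθ1 : θ ≤ 1) (hθ : p * r = 2 * (1 - θ) + 2 * p * θ) :
    eLpNorm (fun x => F (f x)) (ENNReal.ofReal r) μ ≤
      ENNReal.ofReal (c * ((a ^ 2) ^ ((1 - θ) / r) * B ^ (θ / r))) := by
  have hfm := (Lp.aestronglyMeasurable f).aemeasurable
  have ha0 : 0 ≤ a := (norm_nonneg _).trans ha
  rw [eLpNorm_eq_lintegral_rpow_enorm_toReal (by simpa using hr) (by simp),
    ENNReal.toReal_ofReal hr.le]
  have h1 : ∫⁻ x, ‖F (f x)‖ₑ ^ r ∂μ ≤ ∫⁻ x, ENNReal.ofReal (c ^ r) *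
      (ENNReal.ofReal (|f x| ^ (2 : ℝ)) ^ (1 - θ) * ENNReal.ofReal (|f x| ^ (2 * p)) ^ θ) ∂μ := by
    refine lintegral_mono fun x => ?_
    rw [ENNReal.ofReal_rpow_of_nonneg (by positivity) (by linarith),
      ENNReal.ofReal_rpow_of_nonneg (by positivity) hθ0, ← ENNReal.ofReal_mul (by positivity),
      ← ENNReal.ofReal_mul (by positivity), ← ofReal_norm, Real.norm_eq_abs,
      ENNReal.ofReal_rpow_of_nonneg (abs_nonneg _) hr.le]
    refine ENNReal.ofReal_le_ofReal ?_
    calc |F (f x)| ^ r ≤ (c * |f x| ^ p) ^ r := by gcongr; exact hc _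
      _ = c ^ r * |f x| ^ (p * r) := by
          rw [Real.mul_rpow hc0.le (by positivity), ← Real.rpow_mul (abs_nonneg _)]
      _ = _ := by
          rw [hθ, Real.rpow_add_of_nonneg (abs_nonneg _) (by nlinarith) (by positivity),
            ← Real.rpow_mul (abs_nonneg _), ← Real.rpow_mul (abs_nonneg _)]
  have h2 : ∫⁻ x, (ENNReal.ofReal (|f x| ^ (2 : ℝ)) ^ (1 - θ) *
      ENNReal.ofReal (|f x| ^ (2 * p)) ^ θ) ∂μ ≤
      ENNReal.ofReal (a ^ 2) ^ (1 - θ) * ENNReal.ofReal B ^ θ := by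
    refine (ENNReal.lintegral_mul_norm_pow_le ?_ ?_ (by linarith) hθ0 (by ring)).trans ?_
    · exact (hfm.abs.pow_const _).ennreal_ofReal
    · exact (hfm.abs.pow_const _).ennreal_ofReal
    · rw [lintegral_sq_eq]
      gcongr
  have h3 : ∫⁻ x, ‖F (f x)‖ₑ ^ r ∂μ ≤
      ENNReal.ofReal (c ^ r * ((a ^ 2) ^ (1 - θ) * B ^ θ)) := by
    refine h1.trans ?_
    rw [lintegral_const_mul' _ _ (by simp), ENNReal.ofReal_mul (by positivity),
      ENNReal.ofReal_mul (by positivity),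
      ← ENNReal.ofReal_rpow_of_nonneg (x := a ^ 2) (by positivity) (by linarith),
      ← ENNReal.ofReal_rpow_of_nonneg hB0 hθ0]
    gcongr
  refine (ENNReal.rpow_le_rpow h3 (by positivity)).trans (le_of_eq ?_)
  rw [ENNReal.ofReal_rpow_of_nonneg (by positivity) (by positivity)]
  congr 1
  rw [Real.mul_rpow (by positivity) (by positivity), Real.mul_rpow (by positivity) (by positivity),
    ← Real.rpow_mul hc0.le, ← Real.rpow_mul (by positivity), ← Real.rpow_mul hB0,
    mul_one_div_cancel hr.ne', Real.rpow_one, mul_one_div, mul_one_div]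

theorem memLp_comp {F : ℝ → ℝ} (hF : Continuous F) {f : Lp ℝ 2 μ} {r : ℝ≥0∞} {K : ℝ}
    (h : eLpNorm (fun x => F (f x)) r μ ≤ ENNReal.ofReal K) : MemLp (fun x => F (f x)) r μ :=
  ⟨hF.comp_aestronglyMeasurable (Lp.aestronglyMeasurable f), h.trans_lt ENNReal.ofReal_lt_top⟩

theorem superpose_ae_eq {F : ℝ → ℝ} {f : Lp ℝ 2 μ} (h : MemLp (fun x => F (f x)) 2 μ) :
    superpose F f =ᵐ[μ] fun x => F (f x) := by
  rw [superpose, dif_pos h]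
  exact h.coeFn_toLp

/-- The Lipschitz estimate for the nonlinearity. -/
theorem norm_superpose_sub_le {F : ℝ → ℝ} {p c : ℝ} (hp : 1 < p) (hc0 : 0 < c)
    (hc : ∀ z₁ z₂ : ℝ, |F z₁ - F z₂| ≤ c * (|z₁| + |z₂|) ^ (p - 1) * |z₁ - z₂|)
    {f g : Lp ℝ 2 μ} (hf : MemLp (fun x => F (f x)) 2 μ) (hg : MemLp (fun x => F (g x)) 2 μ)
    {B B' : ℝ} (hB0 : 0 ≤ B) (hB0' : 0 ≤ B')
    (hBf : ∫⁻ x, ENNReal.ofReal (|f x| ^ (2 * p)) ∂μ ≤ ENNReal.ofReal B)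
    (hBg : ∫⁻ x, ENNReal.ofReal (|g x| ^ (2 * p)) ∂μ ≤ ENNReal.ofReal B)
    (hBfg : ∫⁻ x, ENNReal.ofReal (|(f - g : Lp ℝ 2 μ) x| ^ (2 * p)) ∂μ ≤ ENNReal.ofReal B') :
    ‖superpose F f - superpose F g‖ ≤
      c * ((2 ^ (2 * p) * (B + B)) ^ ((p - 1) / (2 * p)) * B' ^ (1 / (2 * p))) := by
  have hp0 : 0 < p := by linarith
  have hfm := (Lp.aestronglyMeasurable f).aemeasurable
  have hgm := (Lp.aestronglyMeasurable g).aemeasurable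
  have hfgm := (Lp.aestronglyMeasurable (f - g)).aemeasurable
  have hexp : 0 ≤ (p - 1) / p := div_nonneg (by linarith) hp0.le
  have h0 : ∫⁻ x, ENNReal.ofReal ((|f x| + |g x|) ^ (2 * p)) ∂μ ≤
      ENNReal.ofReal (2 ^ (2 * p) * (B + B)) := by
    calc ∫⁻ x, ENNReal.ofReal ((|f x| + |g x|) ^ (2 * p)) ∂μ
        ≤ ∫⁻ x, ENNReal.ofReal (2 ^ (2 * p)) *
            (ENNReal.ofReal (|f x| ^ (2 * p)) + ENNReal.ofReal (|g x| ^ (2 * p))) ∂μ := by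
          refine lintegral_mono fun x => ?_
          rw [← ENNReal.ofReal_add (by positivity) (by positivity),
            ← ENNReal.ofReal_mul (by positivity)]
          refine ENNReal.ofReal_le_ofReal ?_
          have hmax : (max |f x| |g x|) ^ (2 * p) ≤ |f x| ^ (2 * p) + |g x| ^ (2 * p) := by
            rcases le_total |f x| |g x| with h | h
            · rw [max_eq_right h]; linarith [Real.rpow_nonneg (abs_nonneg (f x)) (2 * p)]
            · rw [max_eq_left h]; linarith [Real.rpow_nonneg (abs_nonneg (g x)) (2 * p)]
          calc (|f x| + |g x|) ^ (2 * p) ≤ (2 * max |f x| |g x|) ^ (2 * p) := by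
                gcongr
                linarith [le_max_left |f x| |g x|, le_max_right |f x| |g x|]
            _ = 2 ^ (2 * p) * (max |f x| |g x|) ^ (2 * p) :=
                Real.mul_rpow (by norm_num) (le_max_of_le_left (abs_nonneg _))
            _ ≤ _ := by gcongr
      _ = ENNReal.ofReal (2 ^ (2 * p)) * (∫⁻ x, ENNReal.ofReal (|f x| ^ (2 * p)) ∂μ +
            ∫⁻ x, ENNReal.ofReal (|g x| ^ (2 * p)) ∂μ) := by
          rw [lintegral_const_mul' _ _ (by simp),
            lintegral_add_left' (hfm.abs.pow_const _).ennreal_ofReal]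
      _ ≤ _ := by
          rw [ENNReal.ofReal_mul (by positivity), ENNReal.ofReal_add hB0 hB0]
          gcongr
  -- Preparation for Hölder with weights `(p - 1)/p` and `1/p`, which puts both `|f| + |g|` and `f -
  -- g` in `L^{2p}`.
  have h1 : ENNReal.ofReal (‖superpose F f - superpose F g‖ ^ 2) ≤ ∫⁻ x, ENNReal.ofReal (c ^ 2) *
      (ENNReal.ofReal ((|f x| + |g x|) ^ (2 * p)) ^ ((p - 1) / p) *
        ENNReal.ofReal (|(f - g : Lp ℝ 2 μ) x| ^ (2 * p)) ^ (1 / p)) ∂μ := by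
    rw [← lintegral_sq_eq]
    refine lintegral_mono_ae ?_
    filter_upwards [Lp.coeFn_sub (superpose F f) (superpose F g), superpose_ae_eq hf,
      superpose_ae_eq hg, Lp.coeFn_sub f g] with x h2 h3 h4 h5
    rw [h2, h5, Pi.sub_apply, Pi.sub_apply, h3, h4,
      ENNReal.ofReal_rpow_of_nonneg (by positivity) hexp,
      ENNReal.ofReal_rpow_of_nonneg (by positivity) (by positivity),
      ← ENNReal.ofReal_mul (by positivity), ← ENNReal.ofReal_mul (by positivity)]
    refine ENNReal.ofReal_le_ofReal ?_
    calc |F (f x) - F (g x)| ^ (2 : ℝ)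
        ≤ (c * (|f x| + |g x|) ^ (p - 1) * |f x - g x|) ^ (2 : ℝ) := by gcongr; exact hc _ _
      _ = _ := by
          rw [Real.mul_rpow (by positivity) (by positivity),
            Real.mul_rpow (by positivity) (by positivity), mul_assoc,
            ← Real.rpow_mul (by positivity), ← Real.rpow_mul (by positivity),
            ← Real.rpow_mul (by positivity)]
          have e1 : 2 * p * ((p - 1) / p) = (p - 1) * 2 := by field_simp
          have e2 : 2 * p * (1 / p) = 2 := by field_simp
          rw [e1, e2, Real.rpow_ofNat c 2]
  have h2 : ∫⁻ x, (ENNReal.ofReal ((|f x| + |g x|) ^ (2 * p)) ^ ((p - 1) / p) *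
        ENNReal.ofReal (|(f - g : Lp ℝ 2 μ) x| ^ (2 * p)) ^ (1 / p)) ∂μ ≤
      ENNReal.ofReal (2 ^ (2 * p) * (B + B)) ^ ((p - 1) / p) * ENNReal.ofReal B' ^ (1 / p) := by
    refine (ENNReal.lintegral_mul_norm_pow_le ?_ ?_ hexp (by positivity) (by field_simp; ring)).trans
      (by gcongr)
    · exact ((hfm.abs.add hgm.abs).pow_const _).ennreal_ofReal
    · exact (hfgm.abs.pow_const _).ennreal_ofReal
  have h3 : ENNReal.ofReal (‖superpose F f - superpose F g‖ ^ 2) ≤ ENNReal.ofReal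
      (c ^ 2 * ((2 ^ (2 * p) * (B + B)) ^ ((p - 1) / p) * B' ^ (1 / p))) := by
    refine h1.trans ?_
    rw [lintegral_const_mul' _ _ (by simp), ENNReal.ofReal_mul (by positivity),
      ENNReal.ofReal_mul (by positivity), ← ENNReal.ofReal_rpow_of_nonneg (by positivity) hexp,
      ← ENNReal.ofReal_rpow_of_nonneg hB0' (by positivity)]
    gcongr
  rw [ENNReal.ofReal_le_ofReal_iff (by positivity)] at h3
  refine (sq_le_sq₀ (norm_nonneg _) (by positivity)).1 (h3.trans (le_of_eq ?_))
  rw [mul_pow, mul_pow, ← Real.rpow_natCast (_ ^ ((p - 1) / (2 * p))),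
    ← Real.rpow_natCast (B' ^ _), ← Real.rpow_mul (by positivity), ← Real.rpow_mul hB0']
  congr 3
  · push_cast; field_simp
  · push_cast; field_simp

end Nonlinearity

end DampedWave

end

/-! ### Duhamel integrals: differentiation and time decay -/

noncomputable section

namespace DampedWave

section Calculus

variable {H : Type*} [NormedAddCommGroup H] [InnerProductSpace ℝ H] [CompleteSpace H]
variable {E : ResolutionOfIdentity H} (hE : E.proj (Iic 0) = 0)
include hE

theorem continuous_uncurry_duhamel {m : ℝ → ℝ → ℝ} (hm : IsSymbolFamily m) {g : ℝ → H}
    (hg : Continuous g) :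
    Continuous (Function.uncurry fun t τ : ℝ => E.op (m (t - τ)) (g τ)) := by
  have h := ResolutionOfIdentity.continuous_op_uncurry hE hm
  have h2 : Continuous fun x : ℝ × ℝ => (x.1 - x.2, g x.2) := by fun_prop
  exact h.comp h2

theorem continuous_duhamel_integrand {m : ℝ → ℝ → ℝ} (hm : IsSymbolFamily m) {g : ℝ → H}
    (hg : Continuous g) (t : ℝ) : Continuous fun τ : ℝ => E.op (m (t - τ)) (g τ) := by
  have := (continuous_uncurry_duhamel hE hm hg).comp (by fun_prop : Continuous fun τ : ℝ => (t, τ))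
  exact this

theorem continuous_duhamel {m : ℝ → ℝ → ℝ} (hm : IsSymbolFamily m) {g : ℝ → H}
    (hg : Continuous g) : Continuous fun t => ∫ τ in (0 : ℝ)..t, E.op (m (t - τ)) (g τ) :=
  intervalIntegral.continuous_parametric_intervalIntegral_of_continuous
    (continuous_uncurry_duhamel hE hm hg) continuous_id

/-- The time occurs in the integrand and as upper limit. With the limit frozen at `t` one
differentiates under the integral sign; the remaining integral over `[t, s]` is `o(s - t)`, because
the integrand is jointly continuous and vanishes on the diagonal, `m 0` being zero. -/
theorem hasDerivAt_duhamel {m n : ℝ → ℝ → ℝ} (hm : IsSymbolFamily m) (hn : IsSymbolFamily n)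
    (h : ∀ l, 0 < l → ∀ t, HasDerivAt (fun s => m s l) (n t l) t) (h0 : ∀ l, m 0 l = 0)
    {g : ℝ → H} (hg : Continuous g) (t : ℝ) :
    HasDerivAt (fun t => ∫ τ in (0 : ℝ)..t, E.op (m (t - τ)) (g τ))
      (∫ τ in (0 : ℝ)..t, E.op (n (t - τ)) (g τ)) t := by
  have hP : HasDerivAt (fun s => ∫ τ in (0 : ℝ)..t, E.op (m (s - τ)) (g τ))
      (∫ τ in (0 : ℝ)..t, E.op (n (t - τ)) (g τ)) t := by
    obtain ⟨M, hM⟩ := hn.bounded (2 * |t| + 1)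
    refine (intervalIntegral.hasDerivAt_integral_of_dominated_loc_of_deriv_le
      (F := fun s τ => E.op (m (s - τ)) (g τ)) (F' := fun s τ => E.op (n (s - τ)) (g τ))
      (bound := fun τ => M * ‖g τ‖) (s := Metric.ball t 1) (Metric.ball_mem_nhds t one_pos)
      (Eventually.of_forall fun s =>
        (continuous_duhamel_integrand hE hm hg s).aestronglyMeasurable)
      ((continuous_duhamel_integrand hE hm hg t).intervalIntegrable _ _)
      (continuous_duhamel_integrand hE hn hg t).aestronglyMeasurable
      (ae_of_all _ fun τ hτ s hs => ?_) ((hg.norm.const_mul M).intervalIntegrable _ _)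
      (ae_of_all _ fun τ _ s _ => ?_)).2
    · refine ResolutionOfIdentity.norm_op_le hE (hn.measurable _) (hM _ ?_) _
      rw [Metric.mem_ball, Real.dist_eq] at hs
      have h1 : |τ| ≤ |t| := by
        rcases mem_uIoc.1 hτ with h | h
        · rw [abs_of_pos h.1, abs_of_pos (h.1.trans_le h.2)]; exact h.2
        · rw [abs_of_nonpos h.2, abs_of_neg (h.1.trans_le h.2)]; linarith [h.1]
      have h2 := abs_sub s τ
      have h3 := abs_sub_abs_le_abs_sub s t
      linarith
    · have := ResolutionOfIdentity.hasDerivAt_op hE hm hn h (g τ) (s - τ)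
      exact HasDerivAt.comp_sub_const s τ this
  have hQ : HasDerivAt (fun s => ∫ τ in t..s, E.op (m (s - τ)) (g τ)) 0 t := by
    rw [hasDerivAt_iff_isLittleO]
    simp only [intervalIntegral.integral_same, smul_zero, sub_zero]
    rw [Asymptotics.isLittleO_iff]
    intro ε hε
    have hc := (continuous_uncurry_duhamel hE hm hg).tendsto (t, t)
    have hz : Function.uncurry (fun t τ : ℝ => E.op (m (t - τ)) (g τ)) (t, t) = 0 := by
      have : m 0 = fun _ => 0 := funext h0
      simp [Function.uncurry, this, ResolutionOfIdentity.op_const hE]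
    rw [hz] at hc
    obtain ⟨δ, hδ, hball⟩ := Metric.eventually_nhds_iff.1
      (Metric.tendsto_nhds.1 hc ε hε)
    filter_upwards [Metric.ball_mem_nhds t hδ] with s hs
    rw [Metric.mem_ball] at hs
    rw [Real.norm_eq_abs]
    refine intervalIntegral.norm_integral_le_of_norm_le_const fun τ hτ => ?_
    have := hball (y := (s, τ)) (by
      rw [Prod.dist_eq]
      refine max_lt hs (lt_of_le_of_lt ?_ hs)
      rw [Real.dist_eq, Real.dist_eq]
      exact abs_sub_left_of_mem_uIcc (uIoc_subset_uIcc hτ))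
    rw [dist_zero_right] at this
    exact this.le
  have := hP.add hQ
  rw [add_zero] at this
  refine this.congr_of_eventuallyEq (Eventually.of_forall fun s => ?_)
  exact (intervalIntegral.integral_add_adjacent_intervals
    ((continuous_duhamel_integrand hE hm hg s).intervalIntegrable _ _)
    ((continuous_duhamel_integrand hE hm hg s).intervalIntegrable _ _)).symm

end Calculus

theorem continuousOn_one_add_rpow (a t : ℝ) (ht : 0 ≤ t) :
    ContinuousOn (fun τ : ℝ => (1 + τ) ^ a) (uIcc 0 t) := by
  refine ContinuousOn.rpow_const (by fun_prop) fun τ hτ => Or.inl ?_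
  rw [uIcc_of_le ht] at hτ
  linarith [hτ.1]

theorem integral_one_add_rpow {a : ℝ} (ha : a ≠ 0) {t : ℝ} (ht : 0 ≤ t) :
    ∫ τ in (0 : ℝ)..t, (1 + τ) ^ (a - 1) = ((1 + t) ^ a - 1) / a := by
  rw [intervalIntegral.integral_comp_add_left (fun x => x ^ (a - 1)), integral_rpow]
  · simp
  · right
    refine ⟨fun h => ha (by linarith), fun h => ?_⟩
    rw [uIcc_of_le (by linarith)] at h
    linarith [h.1]

theorem integral_one_add_inv {t : ℝ} (ht : 0 ≤ t) :
    ∫ τ in (0 : ℝ)..t, (1 + τ) ^ (-1 : ℝ) = Real.log (1 + t) := by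
  simp_rw [Real.rpow_neg_one]
  rw [intervalIntegral.integral_comp_add_left (fun x => x⁻¹), integral_inv]
  · simp
  · intro h
    rw [uIcc_of_le (by linarith)] at h
    linarith [h.1]

section Decay

variable {X : Type*} [MeasurableSpace X] {μ : Measure X}
variable {E : ResolutionOfIdentity (Lp ℝ 2 μ)} {C α : ℝ}

theorem half_rpow_le {x t a : ℝ} (ht : 0 ≤ t) (hx : (1 + t) / 2 ≤ x) (ha : 0 ≤ a) :
    x ^ (-a) ≤ 2 ^ a * (1 + t) ^ (-a) := by
  have hx0 : 0 < x := by linarith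
  rw [Real.rpow_neg hx0.le, Real.rpow_neg (by positivity), ← div_eq_mul_inv,
    inv_le_comm₀ (by positivity) (by positivity), inv_div, div_le_iff₀ (by positivity),
    ← Real.mul_rpow hx0.le (by norm_num)]
  gcongr
  linarith

/-- The integral is cut at `t/2`. For `τ ≤ t/2` the propagator has run for at least `t/2` and its
full `L^r → L²` rate `k + β + η` comes out, leaving the source integrated in `L^r`. For `τ ≥ t/2`
the source has its full `L²` rate `κ + β`, leaving the propagator integrated with rate `k` alone.
The hypotheses on `Θ` bound these two leftover integrals. -/
theorem Ultracontractive.exists_norm_duhamel_le (hU : Ultracontractive E C α)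
    (hE : E.proj (Iic 0) = 0) (hC : 0 < C) (hα : 0 < α) {r : ℝ} (hr1 : 1 ≤ r) (hr2 : r ≤ 2)
    {m : ℝ → ℝ → ℝ} (hm : IsSymbolFamily m) {k : ℝ} (hk : HasDecay m k) (hk0 : 0 ≤ k)
    {β κ η c₁ : ℝ} {Θ : ℝ → ℝ} (hβ : 0 ≤ β) (hκ : 0 ≤ κ) (hη : 0 ≤ η)
    (hr : heatExp α r = β + η) (hc₁ : 0 < c₁)
    (hΦ : ∀ t, 0 ≤ t → (1 + t) ^ (-η) * ∫ τ in (0 : ℝ)..t, (1 + τ) ^ (-(κ - η)) ≤ c₁ * Θ t)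
    (hΨ : ∀ t, 0 ≤ t → (1 + t) ^ (-κ) * ∫ τ in (0 : ℝ)..t, (1 + τ) ^ (-k) ≤
      c₁ * ((1 + t) ^ (-k) * Θ t)) :
    ∃ c, 0 < c ∧ ∀ G, 0 ≤ G → ∀ g : ℝ → Lp ℝ 2 μ, Continuous g →
      (∀ τ, 0 ≤ τ → ‖g τ‖ ≤ G * (1 + τ) ^ (-(κ + β))) →
      (∀ τ, 0 ≤ τ → MemLp (g τ) (ENNReal.ofReal r) μ ∧
        (eLpNorm (g τ) (ENNReal.ofReal r) μ).toReal ≤ G * (1 + τ) ^ (-(κ - η))) →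
      ∀ t, 0 ≤ t → ‖∫ τ in (0 : ℝ)..t, E.op (m (t - τ)) (g τ)‖ ≤
        c * G * ((1 + t) ^ (-(β + k)) * Θ t) := by
  obtain ⟨c, hc0, hc⟩ := hU.exists_norm_op_le hE hC hα hr1 hr2 hm hk
  obtain ⟨d, hd0, hd⟩ := hU.exists_norm_op_le hE hC hα one_le_two le_rfl hm hk
  refine ⟨(c * 2 ^ (k + β + η) * 2 + d * 2 * 2 ^ (κ + β)) * c₁, by positivity,
    fun G hG g hg hg2 hgr t ht => ?_⟩
  have hpt : ∀ τ ∈ Ioc 0 t, ‖E.op (m (t - τ)) (g τ)‖ ≤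
      G * (c * 2 ^ (k + β + η) * 2) * ((1 + t) ^ (-(k + β + η)) * (1 + τ) ^ (-(κ - η))) +
      G * (d * 2 * 2 ^ (κ + β)) * ((1 + t) ^ (-(κ + β)) * (1 + (t - τ)) ^ (-k)) := by
    intro τ hτ
    have hτ0 : 0 ≤ τ := hτ.1.le
    have htτ : 0 ≤ t - τ := by linarith [hτ.2]
    have hA : 0 ≤ G * (c * 2 ^ (k + β + η) * 2) *
        ((1 + t) ^ (-(k + β + η)) * (1 + τ) ^ (-(κ - η))) := by positivity
    have hB : 0 ≤ G * (d * 2 * 2 ^ (κ + β)) *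
        ((1 + t) ^ (-(κ + β)) * (1 + (t - τ)) ^ (-k)) := by positivity
    rcases le_total τ (t / 2) with h | h
    · refine le_trans ?_ (le_add_of_nonneg_right hB)
      obtain ⟨h1, h2⟩ := hgr τ hτ0
      have h3 := hc (t - τ) htτ (g τ) h1
      -- The linear estimate needs the `L²` norm of the source as well; its rate is better, since `κ
      -- - η ≤ κ + β`.
      have h4 : ‖g τ‖ ≤ G * (1 + τ) ^ (-(κ - η)) := by
        refine (hg2 τ hτ0).trans ?_
        gcongr
        · linarith
        · linarith
      have h5 := half_rpow_le (x := 1 + (t - τ)) (a := k + β + η) ht (by linarith) (by positivity)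
      have h6 : -k - heatExp α r = -(k + β + η) := by rw [hr]; ring
      rw [h6] at h3
      calc _ ≤ _ := h3
        _ ≤ c * (2 ^ (k + β + η) * (1 + t) ^ (-(k + β + η))) *
            (G * (1 + τ) ^ (-(κ - η)) + G * (1 + τ) ^ (-(κ - η))) := by gcongr
        _ = _ := by ring
    · refine le_trans ?_ (le_add_of_nonneg_left hA)
      have h1 : MemLp (g τ) (ENNReal.ofReal 2) μ := by
        rw [ENNReal.ofReal_ofNat]; exact Lp.memLp _
      have h3 := hd (t - τ) htτ (g τ) h1
      rw [ENNReal.ofReal_ofNat, ← Lp.norm_def] at h3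
      have h6 : -k - heatExp α 2 = -k := by simp [heatExp]
      rw [h6] at h3
      have h5 := half_rpow_le (x := 1 + τ) (a := κ + β) ht (by linarith) (by positivity)
      have h7 : ‖g τ‖ ≤ G * (2 ^ (κ + β) * (1 + t) ^ (-(κ + β))) :=
        (hg2 τ hτ0).trans (by gcongr)
      calc _ ≤ _ := h3
        _ ≤ d * (1 + (t - τ)) ^ (-k) * (G * (2 ^ (κ + β) * (1 + t) ^ (-(κ + β))) +
            G * (2 ^ (κ + β) * (1 + t) ^ (-(κ + β)))) := by gcongr
        _ = _ := by ring
  have hi1 : IntervalIntegrable (fun τ : ℝ => (1 + τ) ^ (-(κ - η))) volume 0 t :=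
    (continuousOn_one_add_rpow _ t ht).intervalIntegrable
  have hi2 : IntervalIntegrable (fun τ : ℝ => (1 + (t - τ)) ^ (-k)) volume 0 t := by
    refine ContinuousOn.intervalIntegrable (ContinuousOn.rpow_const (by fun_prop) fun τ hτ => ?_)
    rw [uIcc_of_le ht] at hτ
    left; linarith [hτ.2]
  have hcomp : ∫ τ in (0 : ℝ)..t, (1 + (t - τ)) ^ (-k) = ∫ τ in (0 : ℝ)..t, (1 + τ) ^ (-k) := by
    rw [intervalIntegral.integral_comp_sub_left (fun x => (1 + x) ^ (-k))]; simp
  refine (intervalIntegral.norm_integral_le_of_norm_le ht (ae_of_all _ hpt)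
    (((hi1.const_mul _).const_mul _).add ((hi2.const_mul _).const_mul _))).trans ?_
  rw [intervalIntegral.integral_add ((hi1.const_mul _).const_mul _) ((hi2.const_mul _).const_mul _)]
  simp only [intervalIntegral.integral_const_mul]
  rw [hcomp]
  have ht1 : 0 < 1 + t := by linarith
  have e1 : (1 + t) ^ (-(k + β + η)) = (1 + t) ^ (-(β + k)) * (1 + t) ^ (-η) := by
    rw [← Real.rpow_add ht1]; congr 1; ring
  have e2 : (1 + t) ^ (-(κ + β)) = (1 + t) ^ (-β) * (1 + t) ^ (-κ) := by
    rw [← Real.rpow_add ht1]; congr 1; ring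
  have e3 : (1 + t) ^ (-(β + k)) = (1 + t) ^ (-β) * (1 + t) ^ (-k) := by
    rw [← Real.rpow_add ht1]; congr 1; ring
  have k1 := hΦ t ht
  have k2 := hΨ t ht
  set I₁ := ∫ τ in (0 : ℝ)..t, (1 + τ) ^ (-(κ - η)) with hI₁
  set I₂ := ∫ τ in (0 : ℝ)..t, (1 + τ) ^ (-k) with hI₂
  calc _ = G * (c * 2 ^ (k + β + η) * 2) * (1 + t) ^ (-(β + k)) * ((1 + t) ^ (-η) * I₁) +
        G * (d * 2 * 2 ^ (κ + β)) * (1 + t) ^ (-β) * ((1 + t) ^ (-κ) * I₂) := by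
        rw [e1, e2]; ring
    _ ≤ G * (c * 2 ^ (k + β + η) * 2) * (1 + t) ^ (-(β + k)) * (c₁ * Θ t) +
        G * (d * 2 * 2 ^ (κ + β)) * (1 + t) ^ (-β) * (c₁ * ((1 + t) ^ (-k) * Θ t)) := by
        gcongr
    _ = _ := by rw [e3]; ring

end Decay

end DampedWave

end

/-! ### Volterra equations with a locally Lipschitz nonlinearity -/

noncomputable section

namespace DampedWave

section Volterra

variable {H : Type*} [NormedAddCommGroup H] [NormedSpace ℝ H]

/-- The data of the Volterra equation `w(t) = U(t) + ∫₀ᵗ S(t - τ) N(w(τ)) dτ`. -/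
structure IsVolterra (S : ℝ → H →L[ℝ] H) (N : H → H) (M : ℝ) : Prop where
  continuous : Continuous fun x : ℝ × H => S x.1 x.2
  nonneg : 0 ≤ M
  bound : ∀ t, 0 ≤ t → ∀ v, ‖S t v‖ ≤ M * ‖v‖
  lipschitz : ∀ ρ, ∃ L, 0 ≤ L ∧ ∀ w v, ‖w‖ ≤ ρ → ‖v‖ ≤ ρ → ‖N w - N v‖ ≤ L * ‖w - v‖

/-- The right-hand side of the Volterra equation, frozen for negative times. -/
def volterra (S : ℝ → H →L[ℝ] H) (N : H → H) (U : ℝ → H) (w : ℝ → H) (t : ℝ) : H :=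
  U (max t 0) + ∫ τ in (0 : ℝ)..(max t 0), S (max t 0 - τ) (N (w τ))

variable {S : ℝ → H →L[ℝ] H} {N : H → H} {M : ℝ} (h : IsVolterra S N M)
include h

theorem IsVolterra.continuous_nonlinearity : Continuous N := by
  refine continuous_iff_continuousAt.2 fun w => ?_
  obtain ⟨L, hL0, hL⟩ := h.lipschitz (‖w‖ + 1)
  rw [ContinuousAt, tendsto_iff_norm_sub_tendsto_zero]
  have h1 : Tendsto (fun v => L * ‖v - w‖) (𝓝 w) (𝓝 0) := by
    have : Continuous fun v => L * ‖v - w‖ := by fun_prop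
    simpa using this.tendsto w
  refine squeeze_zero' (Eventually.of_forall fun v => norm_nonneg _) ?_ h1
  filter_upwards [Metric.ball_mem_nhds w one_pos] with v hv
  rw [mem_ball_iff_norm] at hv
  refine hL v w ?_ (by linarith)
  have := norm_sub_norm_le v w
  linarith

theorem IsVolterra.continuous_integrand {w : ℝ → H} (hw : Continuous w) :
    Continuous (Function.uncurry fun t τ : ℝ => S (t - τ) (N (w τ))) := by
  have hN := h.continuous_nonlinearity
  have h2 : Continuous fun x : ℝ × ℝ => (x.1 - x.2, N (w x.2)) := by fun_prop
  exact h.continuous.comp h2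

theorem IsVolterra.continuous_integrand_right {w : ℝ → H} (hw : Continuous w) (t : ℝ) :
    Continuous fun τ : ℝ => S (t - τ) (N (w τ)) := by
  exact (h.continuous_integrand hw).comp (by fun_prop : Continuous fun τ : ℝ => (t, τ))

theorem IsVolterra.continuous_volterra {U w : ℝ → H} (hU : Continuous U) (hw : Continuous w) :
    Continuous (volterra S N U w) := by
  have h1 : Continuous fun t => ∫ τ in (0 : ℝ)..t, S (t - τ) (N (w τ)) :=
    intervalIntegral.continuous_parametric_intervalIntegral_of_continuous
      (h.continuous_integrand hw) continuous_id
  have h2 : Continuous fun t : ℝ => max t 0 := by fun_prop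
  exact (hU.comp h2).add (h1.comp h2)

/-- The right-hand side is a contraction for an exponentially weighted norm. -/
theorem IsVolterra.norm_integral_sub_le {w v : ℝ → H} (hw : Continuous w) (hv : Continuous v)
    {ρ L a D t : ℝ} (ha : 0 < a) (hD : 0 ≤ D) (hL0 : 0 ≤ L)
    (hL : ∀ w v, ‖w‖ ≤ ρ → ‖v‖ ≤ ρ → ‖N w - N v‖ ≤ L * ‖w - v‖) (haL : 2 * (M * L) ≤ a)
    (ht : 0 ≤ t) (hwρ : ∀ τ ∈ Icc 0 t, ‖w τ‖ ≤ ρ) (hvρ : ∀ τ ∈ Icc 0 t, ‖v τ‖ ≤ ρ)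
    (hwv : ∀ τ ∈ Icc 0 t, ‖w τ - v τ‖ ≤ D * Real.exp (a * τ)) :
    ‖(∫ τ in (0 : ℝ)..t, S (t - τ) (N (w τ))) - ∫ τ in (0 : ℝ)..t, S (t - τ) (N (v τ))‖ ≤
      D / 2 * Real.exp (a * t) := by
  rw [← intervalIntegral.integral_sub
    ((h.continuous_integrand_right hw t).intervalIntegrable _ _)
    ((h.continuous_integrand_right hv t).intervalIntegrable _ _)]
  have hM := h.nonneg
  have hpt : ∀ τ ∈ Ioc 0 t, ‖S (t - τ) (N (w τ)) - S (t - τ) (N (v τ))‖ ≤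
      M * L * D * Real.exp (a * τ) := by
    intro τ hτ
    have hτ' : τ ∈ Icc 0 t := ⟨hτ.1.le, hτ.2⟩
    rw [← map_sub]
    calc _ ≤ M * ‖N (w τ) - N (v τ)‖ := h.bound _ (by linarith [hτ.2]) _
      _ ≤ M * (L * (D * Real.exp (a * τ))) := by
          gcongr
          exact (hL _ _ (hwρ τ hτ') (hvρ τ hτ')).trans (by gcongr; exact hwv τ hτ')
      _ = _ := by ring
  refine (intervalIntegral.norm_integral_le_of_norm_le ht (ae_of_all _ hpt)
    (Continuous.intervalIntegrable (by fun_prop) _ _)).trans ?_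
  have hint : ∫ τ in (0 : ℝ)..t, Real.exp (a * τ) = (Real.exp (a * t) - 1) / a := by
    rw [intervalIntegral.integral_comp_mul_left (fun x => Real.exp x) ha.ne', integral_exp]
    simp [div_eq_inv_mul]
  rw [intervalIntegral.integral_const_mul, hint, mul_div_assoc', div_le_iff₀ ha]
  have he := Real.exp_pos (a * t)
  have h1 : 0 ≤ M * L * D := by positivity
  calc M * L * D * (Real.exp (a * t) - 1) ≤ M * L * D * Real.exp (a * t) := by gcongr; linarith
    _ = 2 * (M * L) * (D / 2 * Real.exp (a * t)) := by ring
    _ ≤ a * (D / 2 * Real.exp (a * t)) := by gcongr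
    _ = _ := by ring

variable [CompleteSpace H]

/-- Existence for the Volterra equation in an invariant family of closed sets. -/
theorem IsVolterra.exists_solution {U : ℝ → H} (hU : Continuous U) {K : ℝ → Set H} {ρ : ℝ}
    (hKc : ∀ t, 0 ≤ t → IsClosed (K t)) (hK0 : ∀ t, 0 ≤ t → 0 ∈ K t)
    (hKρ : ∀ t, 0 ≤ t → ∀ v ∈ K t, ‖v‖ ≤ ρ)
    (hinv : ∀ w : ℝ → H, Continuous w → (∀ t, 0 ≤ t → w t ∈ K t) →
      ∀ t, 0 ≤ t → U t + ∫ τ in (0 : ℝ)..t, S (t - τ) (N (w τ)) ∈ K t) :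
    ∃ w : ℝ → H, Continuous w ∧ (∀ t, 0 ≤ t → w t ∈ K t) ∧
      ∀ t, 0 ≤ t → w t = U t + ∫ τ in (0 : ℝ)..t, S (t - τ) (N (w τ)) := by
  obtain ⟨L, hL0, hL⟩ := h.lipschitz ρ
  have hM := h.nonneg
  have hρ : 0 ≤ ρ := by simpa using hKρ 0 le_rfl 0 (hK0 0 le_rfl)
  -- The weight `e^{-at}` with `a ≥ 2ML` makes the integral operator a contraction with factor `1/2`
  -- on the whole half line; the summand `1` keeps `a` positive.
  obtain ⟨a, ha⟩ : ∃ a, a = 2 * (M * L) + 1 := ⟨_, rfl⟩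
  have ha0 : 0 < a := by rw [ha]; positivity
  -- Picard iteration from `0`. Invariance keeps the iterates in `K`, hence in the ball of radius
  -- `ρ`, so one Lipschitz constant serves all steps.
  let W : ℕ → ℝ → H := fun n => (volterra S N U)^[n] 0
  have hWs : ∀ n, W (n + 1) = volterra S N U (W n) := fun n =>
    Function.iterate_succ_apply' _ _ _
  have hWc : ∀ n, Continuous (W n) := by
    intro n
    induction n with
    | zero => exact continuous_const
    | succ n ih => rw [hWs]; exact h.continuous_volterra hU ih
  have hv : ∀ w : ℝ → H, ∀ t, 0 ≤ t →
      volterra S N U w t = U t + ∫ τ in (0 : ℝ)..t, S (t - τ) (N (w τ)) := by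
    intro w t ht
    rw [volterra, max_eq_left ht]
  have hWK : ∀ n, ∀ t, 0 ≤ t → W n t ∈ K t := by
    intro n
    induction n with
    | zero => exact fun t ht => hK0 t ht
    | succ n ih =>
      intro t ht
      rw [hWs, hv _ t ht]
      exact hinv _ (hWc n) ih t ht
  have hstep : ∀ n, ∀ t, 0 ≤ t → ‖W n t - W (n + 1) t‖ ≤ 2 * ρ / 2 ^ n * Real.exp (a * t) := by
    intro n
    induction n with
    | zero =>
      intro t ht
      have h1 := hKρ t ht _ (hWK 0 t ht)
      have h2 := hKρ t ht _ (hWK 1 t ht)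
      have h3 := norm_sub_le (W 0 t) (W 1 t)
      have h4 : 1 ≤ Real.exp (a * t) := Real.one_le_exp (by positivity)
      simp only [pow_zero, div_one, zero_add]
      nlinarith
    | succ n ih =>
      intro t ht
      have := h.norm_integral_sub_le (hWc n) (hWc (n + 1)) (D := 2 * ρ / 2 ^ n) ha0 (by positivity)
        hL0 hL (by rw [ha]; linarith) ht (fun τ hτ => hKρ τ hτ.1 _ (hWK n τ hτ.1))
        (fun τ hτ => hKρ τ hτ.1 _ (hWK (n + 1) τ hτ.1)) (fun τ hτ => ih τ hτ.1)
      rw [hWs n, hWs (n + 1), hv _ t ht, hv _ t ht, add_sub_add_left_eq_sub]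
      refine this.trans (le_of_eq ?_)
      rw [pow_succ]; field_simp
  -- The iterates are constant on negative times, so estimates on `[0, ∞)` give locally uniform
  -- convergence, and a continuous limit, on the whole line.
  have hWmax : ∀ n t, W n t = W n (max t 0) := by
    intro n t
    cases n with
    | zero => rfl
    | succ n => rw [hWs]; simp only [volterra]; rw [max_eq_left (le_max_right t 0)]
  have hcau : ∀ t, ∀ n, dist (W n t) (W (n + 1) t) ≤
      2 * (2 * ρ * Real.exp (a * max t 0)) / 2 / 2 ^ n := by
    intro t n
    rw [dist_eq_norm, hWmax n t, hWmax (n + 1) t]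
    refine (hstep n _ (le_max_right _ _)).trans (le_of_eq ?_)
    field_simp
  choose w hw using fun t => cauchySeq_tendsto_of_complete (cauchySeq_of_le_geometric_two (hcau t))
  have hdist : ∀ t n, dist (W n t) (w t) ≤ 2 * (2 * ρ * Real.exp (a * max t 0)) / 2 ^ n :=
    fun t n => dist_le_of_le_geometric_two_of_tendsto (hcau t) (hw t) n
  have hwc : Continuous w := by
    have hloc : TendstoLocallyUniformly W w atTop := by
      rw [Metric.tendstoLocallyUniformly_iff]
      intro ε hε t
      refine ⟨Metric.ball t 1, Metric.ball_mem_nhds t one_pos, ?_⟩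
      have h1 : Tendsto (fun n : ℕ => 2 * (2 * ρ * Real.exp (a * (|t| + 1))) / 2 ^ n) atTop (𝓝 0) :=
        tendsto_const_nhds.div_atTop (tendsto_pow_atTop_atTop_of_one_lt (by norm_num))
      filter_upwards [h1.eventually (gt_mem_nhds hε)] with n hn s hs
      rw [dist_comm]
      refine ((hdist s n).trans ?_).trans_lt hn
      gcongr
      rw [Metric.mem_ball, Real.dist_eq] at hs
      have := abs_sub_abs_le_abs_sub s t
      refine max_le (by linarith [le_abs_self s]) (by positivity)
    exact hloc.continuous (Frequently.of_forall hWc)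
  have hwK : ∀ t, 0 ≤ t → w t ∈ K t := fun t ht =>
    (hKc t ht).mem_of_tendsto (hw t) (Eventually.of_forall fun n => hWK n t ht)
  refine ⟨w, hwc, hwK, fun t ht => ?_⟩
  have hlim : Tendsto (fun n => W (n + 1) t) atTop
      (𝓝 (U t + ∫ τ in (0 : ℝ)..t, S (t - τ) (N (w τ)))) := by
    rw [tendsto_iff_norm_sub_tendsto_zero]
    have h1 : Tendsto (fun n : ℕ => 2 * (2 * ρ) / 2 ^ n / 2 * Real.exp (a * t)) atTop (𝓝 0) := by
      have : Tendsto (fun n : ℕ => 2 * (2 * ρ) / (2 : ℝ) ^ n) atTop (𝓝 0) :=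
        tendsto_const_nhds.div_atTop (tendsto_pow_atTop_atTop_of_one_lt (by norm_num))
      simpa using (this.div_const 2).mul_const (Real.exp (a * t))
    refine squeeze_zero (fun n => norm_nonneg _) (fun n => ?_) h1
    rw [hWs, hv _ t ht, add_sub_add_left_eq_sub]
    refine h.norm_integral_sub_le (hWc n) hwc ha0 (by positivity) hL0 hL (by rw [ha]; linarith) ht
      (fun τ hτ => hKρ τ hτ.1 _ (hWK n τ hτ.1)) (fun τ hτ => hKρ τ hτ.1 _ (hwK τ hτ.1))
      (fun τ hτ => ?_)
    rw [← dist_eq_norm]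
    refine (hdist τ n).trans (le_of_eq ?_)
    rw [max_eq_left hτ.1]; ring
  exact tendsto_nhds_unique ((tendsto_add_atTop_iff_nat 1).2 (hw t)) hlim

omit [CompleteSpace H] in
/-- Uniqueness for the Volterra equation. -/
theorem IsVolterra.unique {U w v : ℝ → H} (hw : Continuous w) (hv : Continuous v)
    (hwe : ∀ t, 0 ≤ t → w t = U t + ∫ τ in (0 : ℝ)..t, S (t - τ) (N (w τ)))
    (hve : ∀ t, 0 ≤ t → v t = U t + ∫ τ in (0 : ℝ)..t, S (t - τ) (N (v τ))) :
    ∀ t, 0 ≤ t → w t = v t := by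
  intro T hT
  have hM := h.nonneg
  have hcomp : IsCompact (Icc 0 T) := isCompact_Icc
  have hne : (Icc 0 T).Nonempty := ⟨0, le_rfl, hT⟩
  obtain ⟨ρ₁, hρ₁⟩ := hcomp.exists_bound_of_continuousOn hw.continuousOn
  obtain ⟨ρ₂, hρ₂⟩ := hcomp.exists_bound_of_continuousOn hv.continuousOn
  obtain ⟨L, hL0, hL⟩ := h.lipschitz (max ρ₁ ρ₂)
  obtain ⟨a, ha⟩ : ∃ a, a = 2 * (M * L) + 1 := ⟨_, rfl⟩
  have ha0 : 0 < a := by rw [ha]; positivity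
  -- At a maximum point of the weighted difference the contraction gives `D ≤ D/2` for the maximum
  -- `D`.
  obtain ⟨t, ht, hmax⟩ := hcomp.exists_isMaxOn hne
    (f := fun t => Real.exp (-(a * t)) * ‖w t - v t‖) (Continuous.continuousOn (by fun_prop))
  obtain ⟨D, hD⟩ : ∃ D, D = Real.exp (-(a * t)) * ‖w t - v t‖ := ⟨_, rfl⟩
  have hD0 : 0 ≤ D := by rw [hD]; positivity
  have hb : ∀ τ ∈ Icc 0 T, ‖w τ - v τ‖ ≤ D * Real.exp (a * τ) := by
    intro τ hτ
    have h1 : Real.exp (-(a * τ)) * ‖w τ - v τ‖ ≤ D := by rw [hD]; exact hmax hτ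
    rw [Real.exp_neg, inv_mul_le_iff₀ (Real.exp_pos _)] at h1
    linarith
  have key := h.norm_integral_sub_le hw hv ha0 hD0 hL0 hL (by rw [ha]; linarith) ht.1
    (fun τ hτ => (hρ₁ τ ⟨hτ.1, hτ.2.trans ht.2⟩).trans (le_max_left _ _))
    (fun τ hτ => (hρ₂ τ ⟨hτ.1, hτ.2.trans ht.2⟩).trans (le_max_right _ _))
    (fun τ hτ => hb τ ⟨hτ.1, hτ.2.trans ht.2⟩)
  have h1 : ‖w t - v t‖ ≤ D / 2 * Real.exp (a * t) := by
    rw [hwe t ht.1, hve t ht.1, add_sub_add_left_eq_sub]; exact key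
  have h2 : D ≤ D / 2 := by
    nth_rewrite 1 [hD]
    rw [Real.exp_neg, inv_mul_le_iff₀ (Real.exp_pos _)]
    linarith
  have h3 := hb T ⟨hT, le_rfl⟩
  have h4 : D = 0 := by linarith
  rw [h4, zero_mul] at h3
  exact sub_eq_zero.1 (norm_le_zero_iff.1 h3)

end Volterra

end DampedWave

end

/-! ### `H¹(A)` as the range of `(1 + A)^{-1/2}`, and the nonlinearity on it -/

noncomputable section

namespace DampedWave

variable {X : Type*} [MeasurableSpace X] {μ : Measure X}
variable {E : ResolutionOfIdentity (Lp ℝ 2 μ)} {C α : ℝ}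

/-- Below frequency `1/4` the factor `(1 + λ)^{-1/2}` is at least `1/2` and may be inserted freely;
above it the heat factor already decays like `e^{-t/8}`. So for `u₀ = (1 + A)^{-1/2} w₀` the `L^q`
norm falls on `u₀`, and `w₀` meets only exponential decay. -/
theorem gSymbol_le {t l : ℝ} (ht : 0 ≤ t) (hl : 0 < l) :
    gSymbol t l ≤ 2 * (gSymbol t l * jSymbol l + Real.exp (-(t / 8))) := by
  have hg := gSymbol_pos t l
  have hj := jSymbol_nonneg l
  have he := Real.exp_pos (-(t / 8))
  rcases le_or_gt (1 / 4) l with h | h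
  · have h1 : Real.exp (-(t / 2) * l) ≤ Real.exp (-(t / 8)) := Real.exp_le_exp.2 (by nlinarith)
    have h2 : gSymbol t l ≤ 2 * Real.exp (-(t / 8)) := by unfold gSymbol; linarith
    nlinarith
  · have h1 : 1 / 2 ≤ jSymbol l := by
      unfold jSymbol
      rw [one_div]
      refine inv_anti₀ (Real.sqrt_pos.2 (by linarith)) ?_
      exact Real.sqrt_le_iff.2 ⟨by norm_num, by linarith⟩
    nlinarith

/-- Decay for data in `H¹(A)`, written as `(1 + A)^{-1/2} w`. -/
theorem Ultracontractive.exists_norm_op_sobolev_le (hU : Ultracontractive E C α)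
    (hE : E.proj (Iic 0) = 0) (hC : 0 < C) (hα : 0 < α) {r : ℝ} (hr1 : 1 ≤ r) (hr2 : r ≤ 2)
    {m : ℝ → ℝ → ℝ} (hm : IsSymbolFamily m) {k : ℝ} (hk : HasDecay m k) :
    ∃ c, 0 < c ∧ ∀ t, 0 ≤ t → ∀ w : Lp ℝ 2 μ, MemLp (E.op jSymbol w) (ENNReal.ofReal r) μ →
      ‖E.op (m t) w‖ ≤ c * (1 + t) ^ (-k - heatExp α r) *
        ((eLpNorm (E.op jSymbol w) (ENNReal.ofReal r) μ).toReal + ‖w‖) := by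
  obtain ⟨c, hc0, hc⟩ := hU.exists_norm_gSymbol_le hE hC hα hr1 hr2
  obtain ⟨d, hd0, hd⟩ := exists_rpow_mul_exp_le (heatExp_nonneg hα.le (by linarith : 0 < r) hr2)
  obtain ⟨K, hK0, hK⟩ := hk
  refine ⟨2 * (K + 1) * (c + d), by positivity, fun t ht w hw => ?_⟩
  have h1 := hc t ht _ hw
  have h1' := hd t ht
  set n := (eLpNorm (E.op jSymbol w) (ENNReal.ofReal r) μ).toReal with hn
  have hn0 : 0 ≤ n := ENNReal.toReal_nonneg
  have hb := isBddSymbol_gSymbol ht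
  have ht1 : 0 < 1 + t := by linarith
  have hjw : ‖E.op jSymbol w‖ ≤ ‖w‖ := by
    have := ResolutionOfIdentity.norm_op_le hE measurable_jSymbol (M := 1) (fun l hl => by
      rw [abs_of_nonneg (jSymbol_nonneg l)]; exact jSymbol_le_one hl) w
    simpa using this
  have hbj := hb.mul isBddSymbol_jSymbol
  have hbs := hbj.add (isBddSymbol_const (Real.exp (-(t / 8))))
  have h2 : ‖E.op (m t) w‖ ≤ (1 + t) ^ (-k) * (2 * (K + 1)) *
      ‖E.op (gSymbol t) (E.op jSymbol w) + Real.exp (-(t / 8)) • w‖ := by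
    have := ResolutionOfIdentity.norm_op_mono hE (hm.isBddSymbol t)
      ((isBddSymbol_const ((1 + t) ^ (-k) * (2 * (K + 1)))).mul hbs) (fun l hl => ?_) w
    · rwa [ResolutionOfIdentity.op_const_mul hE _ hbs, norm_smul, Real.norm_eq_abs,
        abs_of_nonneg (show 0 ≤ (1 + t) ^ (-k) * (2 * (K + 1)) by positivity),
        ResolutionOfIdentity.op_add hE hbj (isBddSymbol_const _),
        ResolutionOfIdentity.op_mul hE hb isBddSymbol_jSymbol,
        ResolutionOfIdentity.op_const hE] at this
    · have hg := gSymbol_pos t l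
      have hj := jSymbol_nonneg l
      have he := Real.exp_pos (-(t / 8))
      rw [abs_of_nonneg (show 0 ≤ (1 + t) ^ (-k) * (2 * (K + 1)) *
        (gSymbol t l * jSymbol l + Real.exp (-(t / 8))) by positivity), mul_assoc,
        Real.rpow_neg ht1.le, ← div_eq_inv_mul, le_div_iff₀ (by positivity), mul_comm]
      refine (hK t ht l hl).trans ?_
      have := gSymbol_le ht hl
      calc K * gSymbol t l ≤ (K + 1) * gSymbol t l := by gcongr; linarith
        _ ≤ (K + 1) * (2 * (gSymbol t l * jSymbol l + Real.exp (-(t / 8)))) := by gcongr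
        _ = _ := by ring
  have h3 : (1 + t) ^ (-k - heatExp α r) = (1 + t) ^ (-k) * (1 + t) ^ (-heatExp α r) := by
    rw [← Real.rpow_add ht1]; congr 1
  have h4 : ‖E.op (gSymbol t) (E.op jSymbol w) + Real.exp (-(t / 8)) • w‖ ≤
      (c + d) * (1 + t) ^ (-heatExp α r) * (n + ‖w‖) := by
    calc _ ≤ _ := norm_add_le _ _
      _ ≤ c * (1 + t) ^ (-heatExp α r) * (n + ‖w‖) + d * (1 + t) ^ (-heatExp α r) * (n + ‖w‖) := by
          rw [norm_smul, Real.norm_eq_abs, abs_of_pos (Real.exp_pos _)]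
          gcongr
          · exact h1.trans (by gcongr)
          · linarith
      _ = _ := by ring
  rw [h3]
  calc _ ≤ _ := h2
    _ ≤ (1 + t) ^ (-k) * (2 * (K + 1)) * ((c + d) * (1 + t) ^ (-heatExp α r) * (n + ‖w‖)) := by
        gcongr
    _ = _ := by ring

/-- The symbol of `A^{1/2} (1 + A)^{-1/2}`. -/
def kSymbol (l : ℝ) : ℝ := √l * jSymbol l

theorem isBddSymbol_kSymbol : IsBddSymbol kSymbol :=
  ⟨Real.continuous_sqrt.measurable.mul measurable_jSymbol, 1, fun l _ => by
    rw [kSymbol, abs_of_nonneg (mul_nonneg (Real.sqrt_nonneg l) (jSymbol_nonneg l))]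
    exact sqrt_mul_jSymbol_le l⟩

theorem j_mul_weight_eq {l : ℝ} (hl : 0 < l) : (1 + l) ^ ((1 : ℝ) / 2) * jSymbol l = 1 := by
  rw [jSymbol, ← Real.sqrt_eq_rpow]
  exact mul_inv_cancel₀ (Real.sqrt_pos.2 (by linarith)).ne'

section Sobolev

variable (hE : E.proj (Iic 0) = 0)
include hE

theorem norm_j_le (w : Lp ℝ 2 μ) : ‖E.op jSymbol w‖ ≤ ‖w‖ := by
  have := ResolutionOfIdentity.norm_op_le hE measurable_jSymbol (M := 1) (fun l hl => by
    rw [abs_of_nonneg (jSymbol_nonneg l)]; exact jSymbol_le_one hl) w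
  simpa using this

theorem norm_k_le (w : Lp ℝ 2 μ) : ‖E.op kSymbol w‖ ≤ ‖w‖ := by
  have := ResolutionOfIdentity.norm_op_le hE isBddSymbol_kSymbol.1 (M := 1) (fun l hl => by
    rw [kSymbol, abs_of_nonneg (mul_nonneg (Real.sqrt_nonneg l) (jSymbol_nonneg l))]
    exact sqrt_mul_jSymbol_le l) w
  simpa using this

/-- The squares of the two symbols add up to `1`, so bounds on `u` and `A^{1/2} u` control `w`. -/
theorem norm_le_j_add_k (w : Lp ℝ 2 μ) : ‖w‖ ≤ ‖E.op jSymbol w‖ + ‖E.op kSymbol w‖ := by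
  have h1 := ResolutionOfIdentity.norm_sq_op hE isBddSymbol_jSymbol w
  have h2 := ResolutionOfIdentity.norm_sq_op hE isBddSymbol_kSymbol w
  have hi1 := ((E.memDom_iff isBddSymbol_jSymbol.1 w).1
    (ResolutionOfIdentity.memDom_of_bdd hE isBddSymbol_jSymbol w)).integrable_sq
  have hi2 := ((E.memDom_iff isBddSymbol_kSymbol.1 w).1
    (ResolutionOfIdentity.memDom_of_bdd hE isBddSymbol_kSymbol w)).integrable_sq
  have h3 : ‖w‖ ^ 2 = ‖E.op jSymbol w‖ ^ 2 + ‖E.op kSymbol w‖ ^ 2 := by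
    rw [h1, h2, ← integral_add hi1 hi2, ← E.measureReal_univ w]
    have : ∫ _, (1 : ℝ) ∂(E.measure w) = (E.measure w).real univ := by simp
    rw [← this]
    refine integral_congr_ae ?_
    filter_upwards [ResolutionOfIdentity.ae_pos hE w] with l hl
    have hs : (0 : ℝ) ≤ 1 + l := by linarith
    rw [kSymbol, jSymbol, mul_pow, inv_pow, Real.sq_sqrt hs, Real.sq_sqrt hl.le]
    field_simp
  refine (sq_le_sq₀ (norm_nonneg _) (by positivity)).1 ?_
  nlinarith [norm_nonneg (E.op jSymbol w), norm_nonneg (E.op kSymbol w)]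

theorem app_sqrt_j (w : Lp ℝ 2 μ) : E.MemDom (fun l => √l) (E.op jSymbol w) ∧
    E.app (fun l => √l) (E.op jSymbol w) = E.op kSymbol w :=
  ResolutionOfIdentity.app_op hE Real.continuous_sqrt.measurable isBddSymbol_jSymbol
    isBddSymbol_kSymbol w

theorem app_weight_j (w : Lp ℝ 2 μ) :
    E.MemDom (fun l => (1 + l) ^ ((1 : ℝ) / 2)) (E.op jSymbol w) ∧
      E.app (fun l => (1 + l) ^ ((1 : ℝ) / 2)) (E.op jSymbol w) = w := by
  have hm : Measurable fun l : ℝ => (1 + l) ^ ((1 : ℝ) / 2) := by fun_prop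
  have hb : IsBddSymbol fun l : ℝ => (1 + l) ^ ((1 : ℝ) / 2) * jSymbol l :=
    ⟨hm.mul measurable_jSymbol, 1, fun l hl => by
      beta_reduce; rw [j_mul_weight_eq hl]; simp⟩
  obtain ⟨h1, h2⟩ := ResolutionOfIdentity.app_op hE hm isBddSymbol_jSymbol hb w
  refine ⟨h1, h2.trans ?_⟩
  have h3 := ResolutionOfIdentity.op_congr hE hb (measurable_const (a := (1 : ℝ)))
    (fun l hl => j_mul_weight_eq hl)
  rw [h3, ResolutionOfIdentity.op_const hE, one_smul]

theorem j_app_weight {f : Lp ℝ 2 μ} (hf : E.MemDom (fun l => (1 + l) ^ ((1 : ℝ) / 2)) f) :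
    E.op jSymbol (E.app (fun l => (1 + l) ^ ((1 : ℝ) / 2)) f) = f := by
  have hm : Measurable fun l : ℝ => (1 + l) ^ ((1 : ℝ) / 2) := by fun_prop
  have hb : IsBddSymbol fun l : ℝ => jSymbol l * (1 + l) ^ ((1 : ℝ) / 2) :=
    ⟨measurable_jSymbol.mul hm, 1, fun l hl => by
      beta_reduce; rw [mul_comm, j_mul_weight_eq hl]; simp⟩
  rw [ResolutionOfIdentity.op_app hE isBddSymbol_jSymbol hm hb hf,
    ResolutionOfIdentity.op_congr hE hb (measurable_const (a := (1 : ℝ)))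
    (fun l hl => by rw [mul_comm, j_mul_weight_eq hl]), ResolutionOfIdentity.op_const hE,
    one_smul]

theorem j_injective {v w : Lp ℝ 2 μ} (h : E.op jSymbol v = E.op jSymbol w) : v = w := by
  rw [← (app_weight_j hE v).2, h, (app_weight_j hE w).2]

end Sobolev

/-- The exponents of the Gagliardo–Nirenberg inequality. -/
structure GNExponents (α p s σ : ℝ) : Prop where
  one_lt : 1 < p
  nonneg : 0 ≤ s
  le_one : s ≤ 1
  eq : σ = α - s / 2
  mul_eq : σ * (2 * p - 2) = 1

theorem gnConst_nonneg {C p s σ : ℝ} (hC : 0 < C) (h : GNExponents α p s σ) :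
    0 ≤ gnConst C p s σ := by
  have hp := h.one_lt
  have hσ0 : 0 < σ := by
    by_contra hcon
    nlinarith [h.mul_eq]
  have : (2 : ℝ) ^ (-σ) < 1 := Real.rpow_lt_one_of_one_lt_of_neg (by norm_num) (by linarith)
  have h1 : 0 < 1 - (2 : ℝ) ^ (-σ) := by linarith
  have h2 : 0 < 2 * p - 2 := by linarith
  unfold gnConst
  positivity

theorem Ultracontractive.lintegral_j_le (hU : Ultracontractive E C α) (hE : E.proj (Iic 0) = 0)
    (hC : 0 < C) {p s σ : ℝ} (h : GNExponents α p s σ) {w : Lp ℝ 2 μ} {a b : ℝ}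
    (ha : ‖E.op jSymbol w‖ ≤ a) (hb : ‖E.op kSymbol w‖ ≤ b) :
    ∫⁻ x, ENNReal.ofReal (|E.op jSymbol w x| ^ (2 * p)) ∂μ ≤ ENNReal.ofReal (gnConst C p s σ *
      ((a ^ (1 - s) * b ^ s) ^ (2 * p - 2) * b ^ 2)) := by
  obtain ⟨h1, h2⟩ := app_sqrt_j hE w
  have := hU.lintegral_rpow_le hE hC h.one_lt h.nonneg h.le_one h.eq h.mul_eq h1
  rw [h2] at this
  refine this.trans (ENNReal.ofReal_le_ofReal ?_)
  have hg := gnConst_nonneg hC h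
  have h3 : 0 ≤ 2 * p - 2 := by linarith [h.one_lt]
  have h4 : 0 ≤ 1 - s := by linarith [h.le_one]
  have h5 := h.nonneg
  have ha0 : 0 ≤ a := (norm_nonneg _).trans ha
  have hb0 : 0 ≤ b := (norm_nonneg _).trans hb
  gcongr

theorem Ultracontractive.lintegral_j_le_norm (hU : Ultracontractive E C α)
    (hE : E.proj (Iic 0) = 0) (hC : 0 < C) {p s σ : ℝ} (h : GNExponents α p s σ) {w : Lp ℝ 2 μ}
    {ρ : ℝ} (hρ : ‖w‖ ≤ ρ) :
    ∫⁻ x, ENNReal.ofReal (|E.op jSymbol w x| ^ (2 * p)) ∂μ ≤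
      ENNReal.ofReal (gnConst C p s σ * ρ ^ (2 * p)) := by
  refine (hU.lintegral_j_le hE hC h ((norm_j_le hE w).trans hρ)
    ((norm_k_le hE w).trans hρ)).trans (le_of_eq ?_)
  have hρ0 : 0 ≤ ρ := (norm_nonneg _).trans hρ
  have hp := h.one_lt
  congr 2
  rw [← Real.rpow_add_of_nonneg hρ0 (by linarith [h.le_one]) h.nonneg, sub_add_cancel,
    Real.rpow_one, ← Real.rpow_natCast ρ 2, ← Real.rpow_add_of_nonneg hρ0 (by linarith)
    (by norm_num)]
  congr 1; push_cast; ring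

section Nonlinear

variable (hU : Ultracontractive E C α) (hE : E.proj (Iic 0) = 0) (hC : 0 < C) {p s σ : ℝ}
  (h : GNExponents α p s σ) {F : ℝ → ℝ} (hF : IsNonlinearity F p)
include hU hE hC h hF

theorem memLp_nonlinearity (w : Lp ℝ 2 μ) : MemLp (fun x => F (E.op jSymbol w x)) 2 μ := by
  obtain ⟨c, hc0, hc⟩ := hF.exists_const
  have hp := h.one_lt
  have h1 := eLpNorm_comp_le hp hc0 (abs_le_of_nonlinearity hF.map_zero hp hc)
    (f := E.op jSymbol w) le_rfl
    (mul_nonneg (gnConst_nonneg hC h) (by positivity))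
    (hU.lintegral_j_le_norm hE hC h (w := w) le_rfl) (r := 2) (θ := 1) (by norm_num) (by norm_num)
    le_rfl (by ring)
  rw [ENNReal.ofReal_ofNat] at h1
  exact memLp_comp hF.contDiff.continuous h1

/-- By linearity of `(1 + A)^{-1/2}`, Gagliardo–Nirenberg also bounds the `L^{2p}` norm of the
difference by `‖w - v‖`, which enters Hölder to the first power. -/
theorem lipschitz_nonlinearity (ρ : ℝ) : ∃ L, 0 ≤ L ∧ ∀ w v : Lp ℝ 2 μ, ‖w‖ ≤ ρ → ‖v‖ ≤ ρ →
    ‖superpose F (E.op jSymbol w) - superpose F (E.op jSymbol v)‖ ≤ L * ‖w - v‖ := by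
  obtain ⟨c, hc0, hc⟩ := hF.exists_const
  have hp := h.one_lt
  have hg := gnConst_nonneg hC h
  rcases lt_or_ge ρ 0 with hρ | hρ
  · exact ⟨0, le_rfl, fun w v hw _ => absurd ((norm_nonneg w).trans hw) (not_le.2 hρ)⟩
  refine ⟨c * ((2 ^ (2 * p) * (gnConst C p s σ * ρ ^ (2 * p) + gnConst C p s σ * ρ ^ (2 * p))) ^
    ((p - 1) / (2 * p)) * gnConst C p s σ ^ (1 / (2 * p))), by positivity, fun w v hw hv => ?_⟩
  have := norm_superpose_sub_le hp hc0 hc (memLp_nonlinearity hU hE hC h hF w)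
    (memLp_nonlinearity hU hE hC h hF v) (B := gnConst C p s σ * ρ ^ (2 * p))
    (B' := gnConst C p s σ * ‖w - v‖ ^ (2 * p)) (by positivity) (by positivity)
    (hU.lintegral_j_le_norm hE hC h hw) (hU.lintegral_j_le_norm hE hC h hv) (by
      rw [← map_sub]; exact hU.lintegral_j_le_norm hE hC h le_rfl)
  refine this.trans (le_of_eq ?_)
  rw [Real.mul_rpow hg (by positivity), ← Real.rpow_mul (norm_nonneg _),
    mul_one_div_cancel (by linarith), Real.rpow_one]
  ring

/-- The constant comes from `√(1 + λ) ≤ 1 + √λ` and `gSymbol ≤ 2`: two terms of at most `600 · 2`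
each, uniformly for `t ≥ 0`. -/
theorem isVolterra : IsVolterra (fun t => E.op (sSymbol t))
    (fun w : Lp ℝ 2 μ => superpose F (E.op jSymbol w)) 2400 where
  continuous := ResolutionOfIdentity.continuous_op_uncurry hE isSymbolFamily_s
  nonneg := by norm_num
  bound t ht v := by
    refine ResolutionOfIdentity.norm_op_le hE (isSymbolFamily_s.measurable t) (fun l hl => ?_) v
    have h1 := abs_dSymbol_le ht hl
    have h2 := abs_sqrt_mul_dSymbol_le ht hl
    have h3 : gSymbol t l ≤ 2 := by
      unfold gSymbol
      have h4 : Real.exp (-(t / 2) * l) ≤ 1 := Real.exp_le_one_iff.2 (by nlinarith)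
      have h5 : Real.exp (-(t / 8)) ≤ 1 := Real.exp_le_one_iff.2 (by linarith)
      linarith
    have h4 : √(1 + l) ≤ 1 + √l := by
      refine Real.sqrt_le_iff.2 ⟨by positivity, ?_⟩
      nlinarith [Real.sq_sqrt hl.le, Real.sqrt_nonneg l]
    have h5 : 1 ≤ √(1 + t) := Real.one_le_sqrt.2 (by linarith)
    have h6 : 0 ≤ √l * |dSymbol t l| := by positivity
    rw [sSymbol, abs_mul, abs_of_nonneg (Real.sqrt_nonneg _)]
    calc √(1 + l) * |dSymbol t l| ≤ (1 + √l) * |dSymbol t l| := by gcongr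
      _ ≤ 2400 := by nlinarith
  lipschitz := lipschitz_nonlinearity hU hE hC h hF

/-- Decay of the nonlinearity in `L^r`. -/
theorem exists_nonlinearity_decay {q r : ℝ} (hr1 : 1 ≤ r) (hrp : 2 / p ≤ r) (hr2 : r ≤ 2) :
    ∃ c, 0 < c ∧ ∀ R, 0 ≤ R → ∀ t, 0 ≤ t → ∀ w : Lp ℝ 2 μ,
      ‖E.op jSymbol w‖ ≤ R * (1 + t) ^ (-heatExp α q) →
      ‖E.op kSymbol w‖ ≤ R * (1 + t) ^ (-(heatExp α q + 1 / 2)) →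
      MemLp (superpose F (E.op jSymbol w)) (ENNReal.ofReal r) μ ∧
        (eLpNorm (superpose F (E.op jSymbol w)) (ENNReal.ofReal r) μ).toReal ≤
          c * R ^ p * (1 + t) ^ (-(2 * α * p / q - 2 * α / r)) := by
  obtain ⟨c, hc0, hc⟩ := hF.exists_const
  have hp := h.one_lt
  have hg := gnConst_nonneg hC h
  have hr0 : 0 < r := by linarith
  -- The solution of `p r = 2(1 - θ) + 2pθ`; `2/p ≤ r ≤ 2` is exactly `0 ≤ θ ≤ 1`.
  obtain ⟨θ, hθ⟩ : ∃ θ, θ = (p * r - 2) / (2 * p - 2) := ⟨_, rfl⟩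
  have hp2 : 0 < 2 * p - 2 := by linarith
  have hpr : 2 ≤ p * r := by rw [div_le_iff₀ (by linarith)] at hrp; linarith
  have hθ0 : 0 ≤ θ := by rw [hθ]; exact div_nonneg (by linarith) hp2.le
  have hθ1 : θ ≤ 1 := by rw [hθ, div_le_one hp2]; nlinarith
  have hθ2 : θ * (2 * p - 2) = p * r - 2 := by rw [hθ, div_mul_cancel₀ _ hp2.ne']
  set β := heatExp α q with hβ
  refine ⟨c * (gnConst C p s σ ^ (θ / r) + 1), by positivity, fun R hR t ht w ha hb => ?_⟩
  have ht1 : 0 < 1 + t := by linarith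
  have hB := hU.lintegral_j_le hE hC h ha hb
  have key := eLpNorm_comp_le hp hc0 (abs_le_of_nonlinearity hF.map_zero hp hc)
    (f := E.op jSymbol w) ha (by positivity) hB (r := r) (θ := θ) hr0 hθ0 hθ1 (by linarith)
  have hae := superpose_ae_eq (memLp_nonlinearity hU hE hC h hF w)
  have hm : MemLp (superpose F (E.op jSymbol w)) (ENNReal.ofReal r) μ :=
    (memLp_comp hF.contDiff.continuous key).ae_eq hae.symm
  refine ⟨hm, ?_⟩
  rw [← eLpNorm_congr_ae hae] at key
  refine (ENNReal.toReal_le_of_le_ofReal (by positivity) key).trans ?_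
  have hs1 : 0 ≤ 1 - s := by linarith [h.le_one]
  have hs0 := h.nonneg
  set τ := 1 + t with hτ
  have e1 : (R * τ ^ (-β)) ^ (1 - s) * (R * τ ^ (-(β + 1 / 2))) ^ s = R * τ ^ (-(β + s / 2)) := by
    rw [Real.mul_rpow hR (by positivity), Real.mul_rpow hR (by positivity), ← Real.rpow_mul ht1.le,
      ← Real.rpow_mul ht1.le]
    have a1 : R ^ (1 - s) * R ^ s = R := by
      rw [← Real.rpow_add_of_nonneg hR hs1 hs0, sub_add_cancel, Real.rpow_one]
    have a2 : τ ^ (-β * (1 - s)) * τ ^ (-(β + 1 / 2) * s) = τ ^ (-(β + s / 2)) := by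
      rw [← Real.rpow_add ht1]; congr 1; ring
    rw [← a2]
    nth_rewrite 3 [← a1]
    ring
  -- The parameter `s` drops out: `(α - s/2)(2p - 2) = 1` turns `s(p - 1) + 1` into `2α(p - 1)`.
  have e2 : (R * τ ^ (-(β + s / 2))) ^ (2 * p - 2) * (R * τ ^ (-(β + 1 / 2))) ^ 2 =
      R ^ (2 * p) * τ ^ (-(2 * p * β + 2 * α * (p - 1))) := by
    rw [Real.mul_rpow hR (by positivity), mul_pow, ← Real.rpow_mul ht1.le,
      ← Real.rpow_natCast (τ ^ _) 2, ← Real.rpow_mul ht1.le, ← Real.rpow_natCast R 2]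
    have a1 : R ^ (2 * p - 2) * R ^ ((2 : ℕ) : ℝ) = R ^ (2 * p) := by
      rw [← Real.rpow_add_of_nonneg hR hp2.le (by positivity)]; congr 1; push_cast; ring
    have a2 : τ ^ (-(β + s / 2) * (2 * p - 2)) * τ ^ (-(β + 1 / 2) * ((2 : ℕ) : ℝ)) =
        τ ^ (-(2 * p * β + 2 * α * (p - 1))) := by
      rw [← Real.rpow_add ht1]
      congr 1
      have := h.mul_eq
      rw [h.eq] at this
      push_cast
      linarith
    rw [← a1, ← a2]
    ring
  have e3 : ((R * τ ^ (-β)) ^ 2) ^ ((1 - θ) / r) *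
      (gnConst C p s σ * (R ^ (2 * p) * τ ^ (-(2 * p * β + 2 * α * (p - 1))))) ^ (θ / r) =
      gnConst C p s σ ^ (θ / r) * R ^ p * τ ^ (-(2 * α * p / q - 2 * α / r)) := by
    rw [Real.mul_rpow hg (by positivity), Real.mul_rpow (by positivity) (by positivity), mul_pow,
      Real.mul_rpow (by positivity) (by positivity), ← Real.rpow_natCast R 2,
      ← Real.rpow_natCast (τ ^ _) 2, ← Real.rpow_mul ht1.le, ← Real.rpow_mul ht1.le,
      ← Real.rpow_mul ht1.le, ← Real.rpow_mul hR, ← Real.rpow_mul hR]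
    have hθr : 0 ≤ θ / r := by positivity
    have hθr' : 0 ≤ (1 - θ) / r := div_nonneg (by linarith) hr0.le
    have hθ3 : 2 * (1 - θ) + 2 * p * θ = p * r := by linarith
    have a1 : R ^ (((2 : ℕ) : ℝ) * ((1 - θ) / r)) * R ^ (2 * p * (θ / r)) = R ^ p := by
      rw [← Real.rpow_add_of_nonneg hR (by positivity) (by positivity)]
      congr 1
      push_cast
      field_simp
      linarith
    have a2 : τ ^ (-β * ((2 : ℕ) : ℝ) * ((1 - θ) / r)) *
        τ ^ (-(2 * p * β + 2 * α * (p - 1)) * (θ / r)) =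
        τ ^ (-(2 * α * p / q - 2 * α / r)) := by
      rw [← Real.rpow_add ht1]
      congr 1
      have b1 : -β * ((2 : ℕ) : ℝ) * ((1 - θ) / r) +
          -(2 * p * β + 2 * α * (p - 1)) * (θ / r) =
          -(β * (2 * (1 - θ) + 2 * p * θ) + α * (θ * (2 * p - 2))) / r := by
        push_cast; ring
      rw [b1, hθ3, hθ2, hβ, heatExp]
      field_simp
      ring
    rw [← a1, ← a2]
    ring
  rw [e1, e2, e3]
  have hRp : 0 ≤ R ^ p * τ ^ (-(2 * α * p / q - 2 * α / r)) := by positivity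
  calc _ = c * gnConst C p s σ ^ (θ / r) * (R ^ p * τ ^ (-(2 * α * p / q - 2 * α / r))) := by ring
    _ ≤ c * (gnConst C p s σ ^ (θ / r) + 1) * (R ^ p * τ ^ (-(2 * α * p / q - 2 * α / r))) := by
        gcongr; linarith
    _ = _ := by ring

end Nonlinear

end DampedWave

end

/-! ### Time integrals, the choice of source exponent, decay of the Duhamel term -/

noncomputable section

namespace DampedWave

/-- `Θ` absorbs the loss in the time integral of a propagator of decay rate `k` against a source
of decay rate `κ`. -/
def IsTimeWeight (κ k : ℝ) (Θ : ℝ → ℝ) : Prop :=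
  ∃ c, 0 < c ∧ ∀ t, 0 ≤ t → 1 ≤ c * Θ t ∧
    (1 + t) ^ (-κ) * ∫ τ in (0 : ℝ)..t, (1 + τ) ^ (-k) ≤ c * ((1 + t) ^ (-k) * Θ t)

/-- For `k ≤ 1/2` the integral is at most `2(1 + t)^{1-k}`, and `κ ≥ 1` absorbs the excess power. So
`u` and `A^{1/2} u` carry no logarithm even when `κ = 1`. -/
theorem isTimeWeight_one {κ k : ℝ} (hκ : 1 ≤ κ) (hk : k ≤ 1 / 2) :
    IsTimeWeight κ k fun _ => 1 := by
  refine ⟨2, two_pos, fun t ht => ⟨by norm_num, ?_⟩⟩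
  have ht1 : 1 ≤ 1 + t := by linarith
  have ht0 : 0 < 1 + t := by linarith
  have h1 := integral_one_add_rpow (a := 1 - k) (by linarith) ht
  rw [show 1 - k - 1 = -k by ring] at h1
  have h2 : ((1 + t) ^ (1 - k) - 1) / (1 - k) ≤ 2 * (1 + t) ^ (1 - k) := by
    rw [div_le_iff₀ (by linarith)]
    have : 0 < (1 + t) ^ (1 - k) := by positivity
    nlinarith
  rw [h1, mul_one]
  have h3 : (1 + t) ^ (-κ) ≤ (1 + t) ^ (-1 : ℝ) :=
    Real.rpow_le_rpow_of_exponent_le ht1 (by linarith)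
  calc _ ≤ (1 + t) ^ (-κ) * (2 * (1 + t) ^ (1 - k)) := by gcongr
    _ ≤ (1 + t) ^ (-1 : ℝ) * (2 * (1 + t) ^ (1 - k)) := by gcongr
    _ = 2 * ((1 + t) ^ (-1 : ℝ) * (1 + t) ^ (1 - k)) := by ring
    _ = _ := by rw [← Real.rpow_add ht0]; congr 2; ring

theorem half_le_log {t : ℝ} (ht : 0 ≤ t) : 1 / 2 ≤ Real.log (2 + t) := by
  have h1 := Real.log_two_gt_d9
  have h2 : Real.log 2 ≤ Real.log (2 + t) := Real.log_le_log two_pos (by linarith)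
  linarith

/-- For `k = 1` the integral is `log(1 + t)`, absorbed by a small power when `κ > 1` and kept when
`κ = 1`. The weight uses `log(2 + t)`, which stays away from zero at `t = 0`. -/
theorem isTimeWeight_log {κ : ℝ} (hκ : 1 ≤ κ) :
    IsTimeWeight κ 1 fun t => Real.log (2 + t) ^ (if 1 < κ then (0 : ℝ) else 1) := by
  split_ifs with h
  · refine ⟨1 + 1 / (κ - 1), ?_, fun t ht => ?_⟩
    · have : 0 < 1 / (κ - 1) := by rw [one_div, inv_pos]; linarith
      linarith
    have hk : 0 < κ - 1 := by linarith
    have hk' : 0 < 1 / (κ - 1) := by positivity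
    have ht0 : 0 < 1 + t := by linarith
    beta_reduce
    rw [Real.rpow_zero, integral_one_add_inv ht]
    refine ⟨by linarith, ?_⟩
    have h1 := Real.log_le_rpow_div ht0.le hk
    have h2 : (1 + t) ^ (-κ) * (1 + t) ^ (κ - 1) = (1 + t) ^ (-1 : ℝ) := by
      rw [← Real.rpow_add ht0]; congr 1; ring
    calc _ ≤ (1 + t) ^ (-κ) * ((1 + t) ^ (κ - 1) / (κ - 1)) := by gcongr
      _ = 1 / (κ - 1) * ((1 + t) ^ (-κ) * (1 + t) ^ (κ - 1)) := by ring
      _ = 1 / (κ - 1) * ((1 + t) ^ (-1 : ℝ) * 1) := by rw [h2, mul_one]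
      _ ≤ _ := by gcongr; linarith
  · obtain rfl : κ = 1 := by linarith
    refine ⟨2, two_pos, fun t ht => ?_⟩
    have h0 := half_le_log ht
    beta_reduce
    rw [Real.rpow_one, integral_one_add_inv ht]
    refine ⟨by linarith, ?_⟩
    have h1 : Real.log (1 + t) ≤ Real.log (2 + t) := Real.log_le_log (by linarith) (by linarith)
    have h2 : 0 < (1 + t) ^ (-1 : ℝ) := by positivity
    nlinarith

/-- The Lebesgue exponent in which the source is measured for small times. -/
theorem exists_source_exponent {α p q : ℝ} (hα : 0 < α) (hq1 : 1 ≤ q) (hq2 : q ≤ 2)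
    (hqp : 2 / p ≤ q) (hqα : q ≤ 2 * α * (p - 1)) (h1 : 1 < 2 * α * (p - 1))
    (h2 : 2 / p < 2 * α * (p - 1)) :
    ∃ r η c, 1 ≤ r ∧ 2 / p ≤ r ∧ r ≤ 2 ∧ 0 ≤ η ∧ 0 < c ∧ η = 2 * α * (1 / r - 1 / q) ∧
      ∀ t, 0 ≤ t → (1 + t) ^ (-η) *
        ∫ τ in (0 : ℝ)..t, (1 + τ) ^ (-(2 * α * (p - 1) / q - η)) ≤ c := by
  have hq0 : 0 < q := by linarith
  rcases hqα.lt_or_eq with h | h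
  · have hκ : 1 < 2 * α * (p - 1) / q := (one_lt_div hq0).2 h
    set κ := 2 * α * (p - 1) / q
    refine ⟨q, 0, 1 / (κ - 1), hq1, hqp, hq2, le_rfl, ?_, by simp, fun t ht => ?_⟩
    · have : 0 < κ - 1 := by linarith
      positivity
    have h3 := integral_one_add_rpow (a := 1 - κ) (by linarith) ht
    rw [show 1 - κ - 1 = -κ by ring] at h3
    rw [sub_zero, neg_zero, Real.rpow_zero, one_mul, h3, ← neg_div_neg_eq, neg_sub, neg_sub]
    have : 0 < κ - 1 := by linarith
    gcongr
    have : 0 < (1 + t) ^ (1 - κ) := by positivity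
    linarith
  · have hr : max 1 (2 / p) < q := by rw [h]; exact max_lt h1 h2
    set r := max 1 (2 / p)
    have hr0 : 0 < r := lt_max_of_lt_left one_pos
    have hη : 0 < 2 * α * (1 / r - 1 / q) := by
      have := one_div_lt_one_div_of_lt hr0 hr
      have : 0 < 1 / r - 1 / q := by linarith
      positivity
    set η := 2 * α * (1 / r - 1 / q) with hηdef
    refine ⟨r, η, 1 / η, le_max_left _ _, le_max_right _ _, by linarith, hη.le, by positivity, rfl,
      fun t ht => ?_⟩
    have hκ : 2 * α * (p - 1) / q = 1 := by rw [← h]; exact div_self hq0.ne'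
    have h3 := integral_one_add_rpow hη.ne' ht
    have ht0 : 0 < 1 + t := by linarith
    rw [hκ, neg_sub, h3, Real.rpow_neg ht0.le, mul_div_assoc']
    gcongr
    have : 0 < (1 + t) ^ η := by positivity
    rw [inv_mul_le_iff₀ this]
    linarith

variable {X : Type*} [MeasurableSpace X] {μ : Measure X}
variable {E : ResolutionOfIdentity (Lp ℝ 2 μ)} {C α : ℝ}

/-- The time-decay class of the solution, in terms of `w = (1 + A)^{1/2} u`. -/
def decaySet (E : ResolutionOfIdentity (Lp ℝ 2 μ)) (β R t : ℝ) : Set (Lp ℝ 2 μ) :=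
  {w | ‖E.op jSymbol w‖ ≤ R * (1 + t) ^ (-β) ∧ ‖E.op kSymbol w‖ ≤ R * (1 + t) ^ (-(β + 1 / 2))}

/-- The hypotheses on the exponents. -/
structure Admissible (α p q s σ : ℝ) : Prop where
  gn : GNExponents α p s σ
  alpha_pos : 0 < α
  one_le : 1 ≤ q
  le_two : q ≤ 2
  two_div_le : 2 / p ≤ q
  le_mul : q ≤ 2 * α * (p - 1)
  one_lt_mul : 1 < 2 * α * (p - 1)
  two_div_lt : 2 / p < 2 * α * (p - 1)

variable (hU : Ultracontractive E C α) (hE : E.proj (Iic 0) = 0) (hC : 0 < C) {p q s σ : ℝ}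
  (h : Admissible α p q s σ) {F : ℝ → ℝ} (hF : IsNonlinearity F p)
include hU hE hC h hF

/-- Decay of the Duhamel term. -/
theorem exists_norm_duhamel_nonlinearity_le {m : ℝ → ℝ → ℝ} (hm : IsSymbolFamily m) {k : ℝ}
    (hk : HasDecay m k) (hk0 : 0 ≤ k) {Θ : ℝ → ℝ}
    (hΘ : IsTimeWeight (2 * α * (p - 1) / q) k Θ) :
    ∃ c, 0 < c ∧ ∀ R, 0 ≤ R → ∀ w : ℝ → Lp ℝ 2 μ, Continuous w →
      (∀ t, 0 ≤ t → w t ∈ decaySet E (heatExp α q) R t) → ∀ t, 0 ≤ t →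
      ‖∫ τ in (0 : ℝ)..t, E.op (m (t - τ)) (superpose F (E.op jSymbol (w τ)))‖ ≤
        c * R ^ p * ((1 + t) ^ (-(heatExp α q + k)) * Θ t) := by
  have hα := h.alpha_pos
  have hp := h.gn.one_lt
  have hq0 : 0 < q := by linarith [h.one_le]
  obtain ⟨c₁, hc₁, hΘ⟩ := hΘ
  obtain ⟨r, η, c₀, hr1, hrp, hr2, hη, hc₀, hηr, hΦ⟩ := exists_source_exponent hα h.one_le
    h.le_two h.two_div_le h.le_mul h.one_lt_mul h.two_div_lt
  have hr0 : 0 < r := by linarith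
  obtain ⟨d, hd0, hd⟩ := exists_nonlinearity_decay hU hE hC h.gn hF (q := q) hr1 hrp hr2
  obtain ⟨e, he0, he⟩ := exists_nonlinearity_decay hU hE hC h.gn hF (q := q) (r := 2)
    one_le_two (by rw [div_le_iff₀ (by linarith)]; linarith) le_rfl
  -- The rates of the source: `κ - η` in `L^r` and, in the next identity, `κ + β` in `L²`.
  have e1 : 2 * α * p / q - 2 * α / r = 2 * α * (p - 1) / q - η := by
    rw [hηr]; ring
  have e2 : 2 * α * p / q - 2 * α / 2 = 2 * α * (p - 1) / q + heatExp α q := by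
    rw [heatExp]; ring
  have hβ := heatExp_nonneg hα.le hq0 h.le_two
  have hκ : 0 ≤ 2 * α * (p - 1) / q := div_nonneg (by linarith [h.one_lt_mul]) hq0.le
  obtain ⟨c, hc0, hc⟩ := hU.exists_norm_duhamel_le hE hC hα hr1 hr2 hm hk hk0 (c₁ := (c₀ + 1) * c₁)
    (Θ := Θ) hβ hκ hη (by rw [hηr, heatExp, heatExp]; ring) (by positivity)
    (fun t ht => by
      have h1 := hΦ t ht
      have h2 := (hΘ t ht).1
      nlinarith)
    (fun t ht => by
      have h1 := (hΘ t ht).1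
      have h2 := (hΘ t ht).2
      have h3 : 0 < (1 + t) ^ (-k) := by positivity
      have h4 : 0 < Θ t := by by_contra hcon; nlinarith
      have h5 : 0 < c₁ * ((1 + t) ^ (-k) * Θ t) := by positivity
      nlinarith)
  refine ⟨c * (d + e), by positivity, fun R hR w hw hwK t ht => ?_⟩
  have hg : Continuous fun τ => superpose F (E.op jSymbol (w τ)) :=
    (isVolterra hU hE hC h.gn hF).continuous_nonlinearity.comp hw
  refine (hc ((d + e) * R ^ p) (by positivity) _ hg (fun τ hτ => ?_) (fun τ hτ => ?_) t ht).trans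
    (le_of_eq (by ring))
  · have := (he R hR τ hτ (w τ) (hwK τ hτ).1 (hwK τ hτ).2).2
    rw [ENNReal.ofReal_ofNat, ← Lp.norm_def, e2] at this
    refine this.trans ?_
    gcongr
    linarith
  · obtain ⟨h1, h2⟩ := hd R hR τ hτ (w τ) (hwK τ hτ).1 (hwK τ hτ).2
    refine ⟨h1, h2.trans ?_⟩
    rw [e1]
    gcongr
    linarith

end DampedWave

end

/-! ### Invariant decay sets and small-data solutions -/

noncomputable section

namespace DampedWave

variable {X : Type*} [MeasurableSpace X] {μ : Measure X}
variable {E : ResolutionOfIdentity (Lp ℝ 2 μ)} {C α : ℝ}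

/-- The size of the data `((1 + A)^{-1/2} w₀, u₁)`. -/
def dataNorm (E : ResolutionOfIdentity (Lp ℝ 2 μ)) (q : ℝ) (w₀ u₁ : Lp ℝ 2 μ) : ℝ :=
  (eLpNorm (E.op jSymbol w₀) (ENNReal.ofReal q) μ).toReal + ‖w₀‖ +
    (eLpNorm u₁ (ENNReal.ofReal q) μ).toReal + ‖u₁‖

theorem dataNorm_nonneg (q : ℝ) (w₀ u₁ : Lp ℝ 2 μ) : 0 ≤ dataNorm E q w₀ u₁ := by
  unfold dataNorm; positivity

section Symbols

variable (hE : E.proj (Iic 0) = 0)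
include hE

theorem j_op_s (t : ℝ) (f : Lp ℝ 2 μ) :
    E.op jSymbol (E.op (sSymbol t) f) = E.op (dSymbol t) f := by
  rw [← ResolutionOfIdentity.op_mul hE isBddSymbol_jSymbol (isSymbolFamily_s.isBddSymbol t),
    ResolutionOfIdentity.op_congr hE
      (isBddSymbol_jSymbol.mul (isSymbolFamily_s.isBddSymbol t)) (measurable_dSymbol t)]
  intro l hl
  have : √(1 + l) ≠ 0 := (Real.sqrt_pos.2 (by linarith)).ne'
  rw [jSymbol, sSymbol, inv_mul_cancel_left₀ this]

theorem k_op_s (t : ℝ) (f : Lp ℝ 2 μ) :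
    E.op kSymbol (E.op (sSymbol t) f) = E.op (fun l => √l * dSymbol t l) f := by
  rw [← ResolutionOfIdentity.op_mul hE isBddSymbol_kSymbol (isSymbolFamily_s.isBddSymbol t),
    ResolutionOfIdentity.op_congr hE
      (isBddSymbol_kSymbol.mul (isSymbolFamily_s.isBddSymbol t)) (isSymbolFamily_sqrt_d.measurable t)]
  intro l hl
  have : √(1 + l) ≠ 0 := (Real.sqrt_pos.2 (by linarith)).ne'
  rw [kSymbol, jSymbol, sSymbol, mul_assoc, inv_mul_cancel_left₀ this]

theorem op_op_dt {φ : ℝ → ℝ} (hφ : IsBddSymbol φ) (t : ℝ) (f : Lp ℝ 2 μ) :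
    E.op φ (E.op (dtSymbol t) f) = E.op (fun l => dtSymbol t l * φ l) f := by
  rw [← ResolutionOfIdentity.op_mul hE hφ (isSymbolFamily_dt.isBddSymbol t)]
  congr 2
  ext l; ring

end Symbols

/-- The linear evolution in terms of `w = (1 + A)^{1/2} u`. -/
def linearFlow (E : ResolutionOfIdentity (Lp ℝ 2 μ)) (w₀ u₁ : Lp ℝ 2 μ) (t : ℝ) : Lp ℝ 2 μ :=
  E.op (sSymbol t) (E.op jSymbol w₀ + u₁) + E.op (dtSymbol t) w₀

section Linear

variable (hU : Ultracontractive E C α) (hE : E.proj (Iic 0) = 0) (hC : 0 < C) (hα : 0 < α)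
  {q : ℝ} (hq1 : 1 ≤ q) (hq2 : q ≤ 2)
include hU hE hC hα hq1 hq2

/-- The second family acts on `w₀` and not on `u₀`, so it may contain the factor `(1 + λ)^{-1/2}`;
without that factor `∂ₜ²𝒟` is not a bounded symbol. -/
theorem exists_norm_linear_le {m n : ℝ → ℝ → ℝ} (hm : IsSymbolFamily m) (hn : IsSymbolFamily n)
    {k : ℝ} (hmk : HasDecay m k) (hnk : HasDecay n k) :
    ∃ c, 0 < c ∧ ∀ w₀ u₁ : Lp ℝ 2 μ, MemLp (E.op jSymbol w₀) (ENNReal.ofReal q) μ →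
      MemLp u₁ (ENNReal.ofReal q) μ → ∀ t, 0 ≤ t →
      ‖E.op (m t) (E.op jSymbol w₀ + u₁) + E.op (n t) w₀‖ ≤
        c * dataNorm E q w₀ u₁ * (1 + t) ^ (-(heatExp α q + k)) := by
  obtain ⟨c, hc0, hc⟩ := hU.exists_norm_op_le hE hC hα hq1 hq2 hm hmk
  obtain ⟨d, hd0, hd⟩ := hU.exists_norm_op_sobolev_le hE hC hα hq1 hq2 hn hnk
  refine ⟨c + d, by positivity, fun w₀ u₁ hw hu t ht => ?_⟩
  have hsum : MemLp (E.op jSymbol w₀ + u₁ : Lp ℝ 2 μ) (ENNReal.ofReal q) μ :=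
    (hw.add hu).ae_eq (Lp.coeFn_add _ _).symm
  have h1 := hc t ht _ hsum
  have h2 := hd t ht w₀ hw
  have h3 : (eLpNorm (E.op jSymbol w₀ + u₁ : Lp ℝ 2 μ) (ENNReal.ofReal q) μ).toReal ≤
      (eLpNorm (E.op jSymbol w₀) (ENNReal.ofReal q) μ).toReal +
        (eLpNorm u₁ (ENNReal.ofReal q) μ).toReal := by
    rw [← ENNReal.toReal_add hw.2.ne hu.2.ne, eLpNorm_congr_ae (Lp.coeFn_add _ _)]
    exact ENNReal.toReal_mono (ENNReal.add_ne_top.2 ⟨hw.2.ne, hu.2.ne⟩)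
      (eLpNorm_add_le hw.1 hu.1 (by rw [← ENNReal.ofReal_one]; exact ENNReal.ofReal_le_ofReal hq1))
  have h4 : ‖E.op jSymbol w₀ + u₁‖ ≤ ‖w₀‖ + ‖u₁‖ :=
    (norm_add_le _ _).trans (by gcongr; exact norm_j_le hE w₀)
  have h5 : -k - heatExp α q = -(heatExp α q + k) := by ring
  rw [h5] at h1 h2
  have h6 : 0 ≤ (eLpNorm u₁ (ENNReal.ofReal q) μ).toReal := ENNReal.toReal_nonneg
  have h7 := norm_nonneg u₁
  have h8 : 0 < (1 + t) ^ (-(heatExp α q + k)) := by positivity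
  calc _ ≤ _ := norm_add_le _ _
    _ ≤ c * (1 + t) ^ (-(heatExp α q + k)) * dataNorm E q w₀ u₁ +
        d * (1 + t) ^ (-(heatExp α q + k)) * dataNorm E q w₀ u₁ := by
        refine add_le_add (h1.trans ?_) (h2.trans ?_)
        · refine mul_le_mul_of_nonneg_left ?_ (by positivity)
          unfold dataNorm; linarith
        · refine mul_le_mul_of_nonneg_left ?_ (by positivity)
          unfold dataNorm; linarith
    _ = _ := by ring

theorem exists_linearFlow_mem :
    ∃ c, 0 < c ∧ ∀ w₀ u₁ : Lp ℝ 2 μ, MemLp (E.op jSymbol w₀) (ENNReal.ofReal q) μ →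
      MemLp u₁ (ENNReal.ofReal q) μ → ∀ t, 0 ≤ t →
      linearFlow E w₀ u₁ t ∈ decaySet E (heatExp α q) (c * dataNorm E q w₀ u₁) t := by
  obtain ⟨c, hc0, hc⟩ := exists_norm_linear_le hU hE hC hα hq1 hq2 isSymbolFamily_d
    (isSymbolFamily_dt.mul_symbol isBddSymbol_jSymbol) hasDecay_d
    (hasDecay_dt.mono zero_le_one fun t _ l hl => by
      rw [abs_mul, abs_of_nonneg (jSymbol_nonneg l)]
      exact mul_le_of_le_one_right (abs_nonneg _) (jSymbol_le_one hl))
  obtain ⟨d, hd0, hd⟩ := exists_norm_linear_le hU hE hC hα hq1 hq2 isSymbolFamily_sqrt_d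
    (isSymbolFamily_dt.mul_symbol isBddSymbol_kSymbol) hasDecay_sqrt_d
    (hasDecay_dt.mono (by norm_num) fun t _ l hl => by
      have : 0 ≤ kSymbol l := mul_nonneg (Real.sqrt_nonneg l) (jSymbol_nonneg l)
      rw [abs_mul, abs_of_nonneg this]
      exact mul_le_of_le_one_right (abs_nonneg _) (sqrt_mul_jSymbol_le l))
  refine ⟨c + d, by positivity, fun w₀ u₁ hw hu t ht => ⟨?_, ?_⟩⟩
  · have := hc w₀ u₁ hw hu t ht
    rw [linearFlow, map_add, j_op_s hE, op_op_dt hE isBddSymbol_jSymbol]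
    rw [add_zero] at this
    refine this.trans ?_
    have := dataNorm_nonneg (E := E) q w₀ u₁
    gcongr
    linarith
  · have := hd w₀ u₁ hw hu t ht
    rw [linearFlow, map_add, k_op_s hE, op_op_dt hE isBddSymbol_kSymbol]
    refine this.trans ?_
    have := dataNorm_nonneg (E := E) q w₀ u₁
    gcongr
    linarith

end Linear

section DecaySet

theorem isClosed_decaySet (β R t : ℝ) : IsClosed (decaySet E β R t) :=
  (isClosed_le (E.op jSymbol).continuous.norm continuous_const).inter
    (isClosed_le (E.op kSymbol).continuous.norm continuous_const)

theorem add_mem_decaySet {β R R' t : ℝ} {v w : Lp ℝ 2 μ} (hv : v ∈ decaySet E β R t)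
    (hw : w ∈ decaySet E β R' t) : v + w ∈ decaySet E β (R + R') t := by
  refine ⟨?_, ?_⟩
  · rw [map_add, add_mul]; exact (norm_add_le _ _).trans (add_le_add hv.1 hw.1)
  · rw [map_add, add_mul]; exact (norm_add_le _ _).trans (add_le_add hv.2 hw.2)

theorem decaySet_mono {β R R' t : ℝ} (ht : 0 ≤ t) (h : R ≤ R') :
    decaySet E β R t ⊆ decaySet E β R' t := fun _ hv =>
  ⟨hv.1.trans (by gcongr), hv.2.trans (by gcongr)⟩

theorem norm_le_of_mem_decaySet (hE : E.proj (Iic 0) = 0) {β R t : ℝ} (hβ : 0 ≤ β) (hR : 0 ≤ R)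
    (ht : 0 ≤ t) {w : Lp ℝ 2 μ} (hw : w ∈ decaySet E β R t) : ‖w‖ ≤ 2 * R := by
  have h1 := norm_le_j_add_k hE w
  have h2 : (1 + t) ^ (-β) ≤ 1 := Real.rpow_le_one_of_one_le_of_nonpos (by linarith) (by linarith)
  have h3 : (1 + t) ^ (-(β + 1 / 2)) ≤ 1 :=
    Real.rpow_le_one_of_one_le_of_nonpos (by linarith) (by linarith)
  have h4 := hw.1
  have h5 := hw.2
  nlinarith

end DecaySet

variable (hU : Ultracontractive E C α) (hE : E.proj (Iic 0) = 0) (hC : 0 < C) {p q s σ : ℝ}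
  (h : Admissible α p q s σ) {F : ℝ → ℝ} (hF : IsNonlinearity F p)
include hU hE hC h hF

theorem exists_duhamel_mem :
    ∃ c, 0 < c ∧ ∀ R, 0 ≤ R → ∀ w : ℝ → Lp ℝ 2 μ, Continuous w →
      (∀ t, 0 ≤ t → w t ∈ decaySet E (heatExp α q) R t) → ∀ t, 0 ≤ t →
      ∫ τ in (0 : ℝ)..t, E.op (sSymbol (t - τ)) (superpose F (E.op jSymbol (w τ))) ∈
        decaySet E (heatExp α q) (c * R ^ p) t := by
  have hq0 : 0 < q := by linarith [h.one_le]
  have hκ : 1 ≤ 2 * α * (p - 1) / q := (one_le_div hq0).2 h.le_mul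
  obtain ⟨c, hc0, hc⟩ := exists_norm_duhamel_nonlinearity_le hU hE hC h hF isSymbolFamily_d
    hasDecay_d le_rfl (isTimeWeight_one hκ (by norm_num))
  obtain ⟨d, hd0, hd⟩ := exists_norm_duhamel_nonlinearity_le hU hE hC h hF isSymbolFamily_sqrt_d
    hasDecay_sqrt_d (by norm_num) (isTimeWeight_one hκ le_rfl)
  refine ⟨c + d, by positivity, fun R hR w hw hwK t ht => ?_⟩
  have hi : IntervalIntegrable (fun τ => E.op (sSymbol (t - τ)) (superpose F (E.op jSymbol (w τ))))
      volume 0 t :=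
    ((isVolterra hU hE hC h.gn hF).continuous_integrand_right hw t).intervalIntegrable _ _
  have h1 := hc R hR w hw hwK t ht
  have h2 := hd R hR w hw hwK t ht
  rw [mul_one] at h1 h2
  rw [add_zero] at h1
  refine ⟨?_, ?_⟩
  · rw [← ContinuousLinearMap.intervalIntegral_comp_comm _ hi]
    simp_rw [j_op_s hE]
    refine h1.trans ?_
    gcongr
    linarith
  · rw [← ContinuousLinearMap.intervalIntegral_comp_comm _ hi]
    simp_rw [k_op_s hE]
    refine h2.trans ?_
    gcongr
    linarith

/-- Global solutions for small data, in terms of `w = (1 + A)^{1/2} u`. -/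
theorem exists_small_solution :
    ∃ ε, 0 < ε ∧ ∃ c, 0 < c ∧ ∀ w₀ u₁ : Lp ℝ 2 μ,
      MemLp (E.op jSymbol w₀) (ENNReal.ofReal q) μ → MemLp u₁ (ENNReal.ofReal q) μ →
      dataNorm E q w₀ u₁ ≤ ε → ∃ w : ℝ → Lp ℝ 2 μ, Continuous w ∧
        (∀ t, 0 ≤ t → w t = linearFlow E w₀ u₁ t +
          ∫ τ in (0 : ℝ)..t, E.op (sSymbol (t - τ)) (superpose F (E.op jSymbol (w τ)))) ∧
        ∀ t, 0 ≤ t → w t ∈ decaySet E (heatExp α q) (c * dataNorm E q w₀ u₁) t ∧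
          ‖E.op (dtSymbol t) (E.op jSymbol w₀ + u₁) +
            E.op (fun l => dttSymbol t l * jSymbol l) w₀ +
            ∫ τ in (0 : ℝ)..t, E.op (dtSymbol (t - τ)) (superpose F (E.op jSymbol (w τ)))‖ ≤
          c * dataNorm E q w₀ u₁ * ((1 + t) ^ (-(heatExp α q + 1)) *
            Real.log (2 + t) ^ (if q < 2 * α * (p - 1) then (0 : ℝ) else 1)) := by
  have hq0 : 0 < q := by linarith [h.one_le]
  have hκ : 1 ≤ 2 * α * (p - 1) / q := (one_le_div hq0).2 h.le_mul
  have hp := h.gn.one_lt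
  have hβ := heatExp_nonneg h.alpha_pos.le hq0 h.le_two
  have hlog := isTimeWeight_log hκ
  simp_rw [one_lt_div hq0] at hlog
  set Θ : ℝ → ℝ := fun t => Real.log (2 + t) ^ (if q < 2 * α * (p - 1) then (0 : ℝ) else 1) with hΘ
  obtain ⟨a, ha0, ha⟩ := exists_linearFlow_mem hU hE hC h.alpha_pos h.one_le h.le_two
  obtain ⟨b, hb0, hb⟩ := exists_duhamel_mem hU hE hC h hF
  obtain ⟨a', ha'0, ha'⟩ := exists_norm_linear_le hU hE hC h.alpha_pos h.one_le h.le_two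
    isSymbolFamily_dt isSymbolFamily_dtt hasDecay_dt hasDecay_dtt
  obtain ⟨b', hb'0, hb'⟩ := exists_norm_duhamel_nonlinearity_le hU hE hC h hF isSymbolFamily_dt
    hasDecay_dt zero_le_one hlog
  obtain ⟨e, he0, he⟩ := hlog
  have hp1 : 0 < p - 1 := by linarith
  -- With `R = 2aD`, the condition `D ≤ ε` says `R^{p-1} ≤ 1/(2b)`, so linear and Duhamel parts each
  -- take at most `R/2`.
  obtain ⟨ε, hε⟩ : ∃ ε, ε = (1 / (2 * b)) ^ (1 / (p - 1)) / (2 * a) := ⟨_, rfl⟩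
  -- The three terms come from the radius `R = 2aD`, from `1 ≤ e Θ` in the linear part of the
  -- velocity, and from `R^p ≤ R/(2b) = (a/b) D` in its Duhamel part.
  refine ⟨ε, by rw [hε]; positivity, 2 * a + a' * e + b' * (a / b), by positivity,
    fun w₀ u₁ hw₀ hu₁ hD => ?_⟩
  have hD0 := dataNorm_nonneg (E := E) q w₀ u₁
  set D := dataNorm E q w₀ u₁ with hDdef
  obtain ⟨R, hR⟩ : ∃ R, R = 2 * a * D := ⟨_, rfl⟩
  have hR0 : 0 ≤ R := by rw [hR]; positivity
  have hRp : R ^ p ≤ R * (1 / (2 * b)) := by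
    have h1 : R ^ p = R * R ^ (p - 1) := by
      nth_rewrite 2 [← Real.rpow_one R]
      rw [← Real.rpow_add_of_nonneg hR0 zero_le_one hp1.le]; congr 1; ring
    have h2 : R ≤ (1 / (2 * b)) ^ (1 / (p - 1)) := by
      rw [hR]
      calc 2 * a * D ≤ 2 * a * ε := by gcongr
        _ = _ := by rw [hε, mul_div_cancel₀ _ (by positivity)]
    have h3 : R ^ (p - 1) ≤ 1 / (2 * b) := by
      calc R ^ (p - 1) ≤ ((1 / (2 * b)) ^ (1 / (p - 1))) ^ (p - 1) := by gcongr
        _ = _ := by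
          rw [← Real.rpow_mul (by positivity), one_div_mul_cancel hp1.ne', Real.rpow_one]
    rw [h1]
    gcongr
  have hcl : a * D + b * R ^ p ≤ R := by
    have : b * R ^ p ≤ b * (R * (1 / (2 * b))) := by gcongr
    have h2 : b * (R * (1 / (2 * b))) = R / 2 := by field_simp
    rw [h2] at this
    linarith
  -- The decay set involves `u` and `A^{1/2} u` only; these already control the source, so the
  -- velocity, and with it the logarithm, stays outside the fixed point argument.
  obtain ⟨w, hwc, hwK, hw⟩ := (isVolterra hU hE hC h.gn hF).exists_solution
    (U := linearFlow E w₀ u₁) (K := fun t => decaySet E (heatExp α q) R t) (ρ := 2 * R)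
    ((ResolutionOfIdentity.continuous_op hE isSymbolFamily_s _).add
      (ResolutionOfIdentity.continuous_op hE isSymbolFamily_dt _))
    (fun t _ => isClosed_decaySet _ _ _)
    (fun t ht => ⟨by rw [map_zero, norm_zero]; positivity, by rw [map_zero, norm_zero]; positivity⟩)
    (fun t ht v hv => norm_le_of_mem_decaySet hE hβ hR0 ht hv)
    (fun w hwc hwK t ht => decaySet_mono ht hcl
      (add_mem_decaySet (ha w₀ u₁ hw₀ hu₁ t ht) (hb R hR0 w hwc hwK t ht)))
  refine ⟨w, hwc, hw, fun t ht => ⟨decaySet_mono ht ?_ (hwK t ht), ?_⟩⟩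
  · rw [hR]
    have : 0 ≤ (a' * e + b' * (a / b)) * D := by positivity
    linarith
  · have h1 := ha' w₀ u₁ hw₀ hu₁ t ht
    have h2 := hb' R hR0 w hwc hwK t ht
    have h3 := (he t ht).1
    have hΘ0 : 0 < Θ t := by by_contra hcon; nlinarith
    have h4 : b' * R ^ p ≤ b' * (a / b) * D := by
      calc b' * R ^ p ≤ b' * (R * (1 / (2 * b))) := by gcongr
        _ = _ := by rw [hR]; field_simp
    have hx : 0 < (1 + t) ^ (-(heatExp α q + 1)) := by positivity
    set x := (1 + t) ^ (-(heatExp α q + 1))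
    calc _ ≤ _ := norm_add_le _ _
      _ ≤ a' * D * x * 1 + b' * (a / b) * D * (x * Θ t) := by
          refine add_le_add (h1.trans (by rw [mul_one])) (h2.trans ?_)
          gcongr
      _ ≤ a' * D * x * (e * Θ t) + b' * (a / b) * D * (x * Θ t) := by gcongr
      _ = (a' * e + b' * (a / b)) * D * (x * Θ t) := by ring
      _ ≤ _ := by gcongr; linarith

end DampedWave

end

/-! ### Exponents, and the passage between `w` and mild solutions -/

noncomputable section

namespace DampedWave

variable {X : Type*} [MeasurableSpace X] {μ : Measure X}

/-- The scaling relation `(α - s/2)(2p - 2) = 1` determines `s`. Then `s ≥ 0` follows from `p > 1 +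
1/(2α)`, and `s ≤ 1` is the energy-subcritical or critical condition `p ≤ 2α/(2α - 1)`, automatic
for `α ≤ 1/2`. -/
theorem admissible_of_bounds {α p q : ℝ} (hα : 0 < α) (hp : 1 < p)
    (hsuper : 1 + 1 / (2 * α) < p) (hsuper' : 2 / p < 2 * α * (p - 1))
    (hqp : q ∈ Icc (max 1 (2 / p)) (min 2 (2 * α * (p - 1))))
    (hadd : 1 / 2 < α → p ≤ 2 * α / (2 * α - 1)) :
    Admissible α p q (2 * α - 1 / (p - 1)) (1 / (2 * (p - 1))) := by
  have hp1 : 0 < p - 1 := by linarith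
  have h1 : 1 < 2 * α * (p - 1) := by
    have : 1 / (2 * α) < p - 1 := by linarith
    rw [div_lt_iff₀ (by positivity)] at this
    linarith
  refine ⟨⟨hp, ?_, ?_, ?_, ?_⟩, hα, (le_max_left _ _).trans hqp.1, hqp.2.trans (min_le_left _ _),
    (le_max_right _ _).trans hqp.1, hqp.2.trans (min_le_right _ _), h1, hsuper'⟩
  · have : 1 / (p - 1) < 2 * α := by rw [div_lt_iff₀ hp1]; exact h1
    linarith
  · have : 2 * α - 1 ≤ 1 / (p - 1) := by
      rw [le_div_iff₀ hp1]
      rcases lt_or_ge (1 / 2) α with h | h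
      · have h2 := hadd h
        rw [le_div_iff₀ (by linarith)] at h2
        linarith
      · nlinarith
    linarith
  · field_simp
    ring
  · field_simp

section Dictionary

variable {A : Lp ℝ 2 μ →ₗ.[ℝ] Lp ℝ 2 μ} (hE : (resolution A).proj (Iic 0) = 0)
include hE

theorem propD_eq (t : ℝ) (f : Lp ℝ 2 μ) : propD A t f = (resolution A).op (dSymbol t) f := by
  have hb := isSymbolFamily_d.isBddSymbol t
  rw [ResolutionOfIdentity.op_apply hE hb]
  exact funcCalc_eq_app A hb.1 (ResolutionOfIdentity.memDom_of_bdd hE hb f)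

theorem propDt_eq (t : ℝ) (f : Lp ℝ 2 μ) : propDt A t f = (resolution A).op (dtSymbol t) f := by
  have hb := isSymbolFamily_dt.isBddSymbol t
  rw [ResolutionOfIdentity.op_apply hE hb, propDt]
  simp_rw [deriv_dSymbol]
  exact funcCalc_eq_app A hb.1 (ResolutionOfIdentity.memDom_of_bdd hE hb f)

theorem sqrtOp_j (w : Lp ℝ 2 μ) :
    sqrtOp A ((resolution A).op jSymbol w) = (resolution A).op kSymbol w := by
  obtain ⟨h1, h2⟩ := app_sqrt_j hE w
  rw [sqrtOp]
  simp_rw [← Real.sqrt_eq_rpow]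
  rw [funcCalc_eq_app A Real.continuous_sqrt.measurable h1, h2]

theorem memSobolev_j (w : Lp ℝ 2 μ) : MemSobolev A 1 ((resolution A).op jSymbol w) :=
  (app_weight_j hE w).1

theorem sobolevNorm_j (w : Lp ℝ 2 μ) : sobolevNorm A 1 ((resolution A).op jSymbol w) = ‖w‖ := by
  obtain ⟨h1, h2⟩ := app_weight_j hE w
  rw [sobolevNorm, funcCalc_eq_app A (by fun_prop) h1, h2]

theorem exists_j_eq {f : Lp ℝ 2 μ} (hf : MemSobolev A 1 f) :
    ∃ w, (resolution A).op jSymbol w = f :=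
  ⟨_, j_app_weight hE hf⟩

theorem dataSize_j (q : ℝ) (w₀ u₁ : Lp ℝ 2 μ) :
    dataSize A q ((resolution A).op jSymbol w₀) u₁ = dataNorm (resolution A) q w₀ u₁ := by
  rw [dataSize, dataNorm, sobolevNorm_j hE]

theorem j_linearFlow (w₀ u₁ : Lp ℝ 2 μ) (t : ℝ) :
    (resolution A).op jSymbol (linearFlow (resolution A) w₀ u₁ t) =
      linearSol A ((resolution A).op jSymbol w₀) u₁ t := by
  rw [linearFlow, map_add, j_op_s hE, op_op_dt hE isBddSymbol_jSymbol, linearSol, propD_eq hE,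
    propDt_eq hE, ResolutionOfIdentity.op_mul hE (isSymbolFamily_dt.isBddSymbol t)
    isBddSymbol_jSymbol]

theorem j_duhamel {g : ℝ → Lp ℝ 2 μ} (hg : Continuous g) (t : ℝ) :
    (resolution A).op jSymbol (∫ τ in (0 : ℝ)..t, (resolution A).op (sSymbol (t - τ)) (g τ)) =
      ∫ τ in (0 : ℝ)..t, propD A (t - τ) (g τ) := by
  rw [← ContinuousLinearMap.intervalIntegral_comp_comm _
    ((continuous_duhamel_integrand hE isSymbolFamily_s hg t).intervalIntegrable _ _)]
  simp_rw [j_op_s hE, propD_eq hE]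

/-- Functions in `C([0, ∞); H¹(A))` are of the form `(1 + A)^{-1/2} w` with `w` continuous. -/
theorem exists_continuous_j_eq {v : ℝ → Lp ℝ 2 μ} (hv : ContinuousInSobolev A 1 v (Ici 0)) :
    ∃ w : ℝ → Lp ℝ 2 μ, Continuous w ∧ ∀ t, 0 ≤ t → (resolution A).op jSymbol (w t) = v t := by
  choose w hw using fun t : Ici (0 : ℝ) => exists_j_eq hE (hv.1 t t.2)
  have hwc : Continuous w := by
    refine continuous_iff_continuousAt.2 fun t => ?_
    rw [ContinuousAt, tendsto_iff_norm_sub_tendsto_zero]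
    have h1 := (hv.2 t t.2).comp (tendsto_nhdsWithin_iff.2
      ⟨continuous_subtype_val.tendsto t, Eventually.of_forall fun x => x.2⟩)
    refine h1.congr fun τ => ?_
    rw [Function.comp_apply, ← hw τ, ← hw t, ← map_sub, sobolevNorm_j hE]
  refine ⟨fun t => w ⟨max t 0, mem_Ici.2 (le_max_right _ _)⟩,
    hwc.comp ((continuous_id.max continuous_const).subtype_mk _), fun t ht => ?_⟩
  rw [hw]
  exact congrArg v (max_eq_left ht)

/-- The solution and its time derivative. -/
theorem hasDerivAt_mild (w₀ u₁ : Lp ℝ 2 μ) {g : ℝ → Lp ℝ 2 μ} (hg : Continuous g) (t : ℝ) :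
    HasDerivAt (fun t => linearSol A ((resolution A).op jSymbol w₀) u₁ t +
        ∫ τ in (0 : ℝ)..t, propD A (t - τ) (g τ))
      ((resolution A).op (dtSymbol t) ((resolution A).op jSymbol w₀ + u₁) +
        (resolution A).op (fun l => dttSymbol t l * jSymbol l) w₀ +
        ∫ τ in (0 : ℝ)..t, (resolution A).op (dtSymbol (t - τ)) (g τ)) t := by
  have h1 := ResolutionOfIdentity.hasDerivAt_op hE isSymbolFamily_d isSymbolFamily_dt
    (fun l _ t => hasDerivAt_dSymbol l t) ((resolution A).op jSymbol w₀ + u₁) t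
  have h2 := ResolutionOfIdentity.hasDerivAt_op hE
    (isSymbolFamily_dt.mul_symbol isBddSymbol_jSymbol) isSymbolFamily_dtt
    (fun l _ t => (hasDerivAt_dtSymbol l t).mul_const _) w₀ t
  have h3 := hasDerivAt_duhamel hE isSymbolFamily_d isSymbolFamily_dt
    (fun l _ t => hasDerivAt_dSymbol l t) dSymbol_zero hg t
  refine ((h1.add h2).add h3).congr_of_eventuallyEq (Eventually.of_forall fun t => ?_)
  simp only [Pi.add_apply, linearSol, propD_eq hE, propDt_eq hE]
  rw [ResolutionOfIdentity.op_mul hE (isSymbolFamily_dt.isBddSymbol t) isBddSymbol_jSymbol]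

theorem continuous_deriv_mild (w₀ u₁ : Lp ℝ 2 μ) {g : ℝ → Lp ℝ 2 μ} (hg : Continuous g) :
    Continuous fun t => (resolution A).op (dtSymbol t) ((resolution A).op jSymbol w₀ + u₁) +
        (resolution A).op (fun l => dttSymbol t l * jSymbol l) w₀ +
        ∫ τ in (0 : ℝ)..t, (resolution A).op (dtSymbol (t - τ)) (g τ) :=
  ((ResolutionOfIdentity.continuous_op hE isSymbolFamily_dt _).add
    (ResolutionOfIdentity.continuous_op hE isSymbolFamily_dtt _)).add
    (continuous_duhamel hE isSymbolFamily_dt hg)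

theorem linearSol_zero (u₀ u₁ : Lp ℝ 2 μ) : linearSol A u₀ u₁ 0 = u₀ := by
  have h1 : dSymbol 0 = fun _ => 0 := funext dSymbol_zero
  have h2 : dtSymbol 0 = fun _ => 1 := funext dtSymbol_zero
  rw [linearSol, propD_eq hE, propDt_eq hE, h1, h2, ResolutionOfIdentity.op_const hE,
    ResolutionOfIdentity.op_const hE, zero_smul, zero_add, one_smul]

/-- Since `∂ₜ𝒟(0) = 1` and `∂ₜ²𝒟(0) = -1`, the two contributions of `u₀` cancel. -/
theorem deriv_linearSol_zero (w₀ u₁ : Lp ℝ 2 μ) :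
    (resolution A).op (dtSymbol 0) ((resolution A).op jSymbol w₀ + u₁) +
      (resolution A).op (fun l => dttSymbol 0 l * jSymbol l) w₀ = u₁ := by
  have h2 : dtSymbol 0 = fun _ => 1 := funext dtSymbol_zero
  have h3 : (fun l => dttSymbol 0 l * jSymbol l) = fun l => -1 * jSymbol l := by
    ext l; rw [dttSymbol, dSymbol_zero, dtSymbol_zero]; ring
  rw [h2, h3, ResolutionOfIdentity.op_const hE,
    ResolutionOfIdentity.op_const_mul hE _ isBddSymbol_jSymbol, one_smul, neg_one_smul]
  abel

end Dictionary

theorem japanese_pos (t : ℝ) : 0 < japanese t := Real.sqrt_pos.2 (by positivity)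

theorem japanese_rpow_mul_le {t : ℝ} (ht : 0 ≤ t) {a x B : ℝ} (ha : 0 ≤ a) (hx : 0 ≤ x)
    (h : x ≤ B * (1 + t) ^ (-a)) : japanese t ^ a * x ≤ B := by
  have h1 : japanese t ≤ 1 + t := Real.sqrt_le_iff.2 ⟨by linarith, by nlinarith⟩
  have h2 : 0 < (1 + t) ^ a := by positivity
  have h3 := (japanese_pos t).le
  rw [Real.rpow_neg (by linarith), ← div_eq_mul_inv, le_div_iff₀ h2] at h
  calc japanese t ^ a * x ≤ (1 + t) ^ a * x := by gcongr
    _ ≤ B := by linarith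

end DampedWave

end

/-! ### Small-data global solutions: existence, uniqueness and decay -/

theorem mainTheorem2 {X : Type*} [MeasurableSpace X] (μ : Measure X) [SigmaFinite μ]
    (A : Lp ℝ 2 μ →ₗ.[ℝ] Lp ℝ 2 μ) (α p q : ℝ) (F : ℝ → ℝ)
    (hA : AssumptionA A α) (hB : AssumptionB A α)
    (hp : 1 < p) (hF : IsNonlinearity F p) (hq : q ∈ Icc (1 : ℝ) 2)
    (hsuper : 1 + 1 / (2 * α) < p) (hsuper' : 2 / p < 2 * α * (p - 1))
    (hqp : q ∈ Icc (max 1 (2 / p)) (min 2 (2 * α * (p - 1))))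
    (hadd : 1 / 2 < α → p ≤ 2 * α / (2 * α - 1)) :
    ∃ ε₀ : ℝ, 0 < ε₀ ∧ ∃ C : ℝ, 0 < C ∧
      ∀ u₀ u₁ : Lp ℝ 2 μ, MemSobolev A 1 u₀ →
        MemLp u₀ (ENNReal.ofReal q) μ → MemLp u₁ (ENNReal.ofReal q) μ →
        dataSize A q u₀ u₁ ≤ ε₀ →
        ∃ u : ℝ → Lp ℝ 2 μ,
          IsMildSolution A F u₀ u₁ (Ici 0) u ∧
          u 0 = u₀ ∧ derivWithin u (Ici 0) 0 = u₁ ∧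
          (∀ v : ℝ → Lp ℝ 2 μ, IsMildSolution A F u₀ u₁ (Ici 0) v → EqOn v u (Ici 0)) ∧
          ∀ t : ℝ, 0 < t →
            japanese t ^ (2 * α * (1 / q - 1 / 2) + 1)
                * Real.log (2 + t) ^ (-(if q < 2 * α * (p - 1) then (0 : ℝ) else 1))
                * ‖derivWithin u (Ici 0) t‖
              + japanese t ^ (2 * α * (1 / q - 1 / 2) + 1 / 2) * ‖sqrtOp A (u t)‖
              + japanese t ^ (2 * α * (1 / q - 1 / 2)) * ‖u t‖
              ≤ C * dataSize A q u₀ u₁ := by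
  have hα := hA.alpha_pos
  obtain ⟨K, hK, hU⟩ := exists_ultracontractive hA
  have hE := hU.proj_Iic_zero hK hα
  have h := admissible_of_bounds hα hp hsuper hsuper' hqp hadd
  have hV := isVolterra hU hE hK h.gn hF
  have hβ := heatExp_nonneg hα.le (by linarith [hq.1] : 0 < q) hq.2
  obtain ⟨ε, hε, c, hc, hmain⟩ := exists_small_solution hU hE hK h hF
  -- The three weighted quantities are each bounded by `c` times the size of the data.
  refine ⟨ε, hε, 3 * c, by positivity, fun u₀ u₁ hu₀ hu₀q hu₁q hsize => ?_⟩
  obtain ⟨w₀, rfl⟩ := exists_j_eq hE hu₀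
  rw [dataSize_j hE] at hsize ⊢
  obtain ⟨w, hwc, hw, hwb⟩ := hmain w₀ u₁ hu₀q hu₁q hsize
  have hg : Continuous fun τ => superpose F ((resolution A).op jSymbol (w τ)) :=
    hV.continuous_nonlinearity.comp hwc
  -- The Duhamel formula defines `u` on the whole line, where it has a two-sided derivative; it
  -- agrees with `(1 + A)^{-1/2} w` for `t ≥ 0` only.
  obtain ⟨u, hu⟩ : ∃ u : ℝ → Lp ℝ 2 μ, u = fun t =>
    linearSol A ((resolution A).op jSymbol w₀) u₁ t +
      ∫ τ in (0 : ℝ)..t, propD A (t - τ) (superpose F ((resolution A).op jSymbol (w τ))) :=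
    ⟨_, rfl⟩
  have hud := hasDerivAt_mild hE w₀ u₁ hg
  rw [← hu] at hud
  have huw : ∀ t, 0 ≤ t → u t = (resolution A).op jSymbol (w t) := by
    intro t ht
    rw [hw t ht, map_add, j_linearFlow hE, j_duhamel hE hg, hu]
  have hdw : ∀ t, 0 ≤ t → derivWithin u (Ici 0) t = _ := fun t ht =>
    (hud t).hasDerivWithinAt.derivWithin (uniqueDiffOn_Ici 0 t ht)
  refine ⟨u, ⟨⟨fun t ht => ?_, fun t ht => ?_⟩, ?_, fun t ht => ?_, fun t ht => ?_, fun t ht => ?_⟩,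
    ?_, ?_, fun v hv => ?_, fun t ht => ?_⟩
  · rw [huw t ht]; exact memSobolev_j hE _
  · have h1 : Tendsto (fun τ => ‖w τ - w t‖) (𝓝[Ici 0] t) (𝓝 0) :=
      (tendsto_iff_norm_sub_tendsto_zero.1 (hwc.tendsto t)).mono_left nhdsWithin_le_nhds
    refine h1.congr' ?_
    filter_upwards [self_mem_nhdsWithin] with τ hτ
    rw [huw τ hτ, huw t ht, ← map_sub, sobolevNorm_j hE]
  · refine ContDiff.contDiffOn (contDiff_one_iff_deriv.2 ⟨fun t => (hud t).differentiableAt, ?_⟩)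
    rw [funext fun t => (hud t).deriv]
    exact continuous_deriv_mild hE w₀ u₁ hg
  · rw [huw t ht]; exact memLp_nonlinearity hU hE hK h.gn hF _
  · have h1 : IntervalIntegrable (fun τ => propD A (t - τ)
        (superpose F ((resolution A).op jSymbol (w τ)))) volume 0 t := by
      simp_rw [propD_eq hE]
      exact (continuous_duhamel_integrand hE isSymbolFamily_d hg t).intervalIntegrable _ _
    refine h1.congr fun τ hτ => ?_
    rw [uIoc_of_le ht] at hτ
    simp only [huw τ hτ.1.le]
  · nth_rewrite 1 [hu]
    beta_reduce
    congr 1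
    refine intervalIntegral.integral_congr fun τ hτ => ?_
    rw [uIcc_of_le ht] at hτ
    simp only [huw τ hτ.1]
  · rw [hu]; simp [linearSol_zero hE]
  · rw [hdw 0 le_rfl, intervalIntegral.integral_same, add_zero, deriv_linearSol_zero hE]
  -- Any competitor lies in `C([0, ∞); H¹(A))`, hence is `(1 + A)^{-1/2} z` with `z` continuous. As
  -- `(1 + A)^{-1/2}` is injective, `z` solves the same Volterra equation, and no decay of the
  -- competitor is required.
  · obtain ⟨z, hzc, hz⟩ := exists_continuous_j_eq hE hv.continuous_sobolev
    have hgz : Continuous fun τ => superpose F ((resolution A).op jSymbol (z τ)) :=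
      hV.continuous_nonlinearity.comp hzc
    have hze : ∀ t, 0 ≤ t → z t = linearFlow (resolution A) w₀ u₁ t + ∫ τ in (0 : ℝ)..t,
        (resolution A).op (sSymbol (t - τ)) (superpose F ((resolution A).op jSymbol (z τ))) := by
      intro t ht
      refine j_injective hE ?_
      rw [hz t ht, map_add, j_linearFlow hE, j_duhamel hE hgz, hv.duhamel t ht]
      congr 1
      refine intervalIntegral.integral_congr fun τ hτ => ?_
      rw [uIcc_of_le ht] at hτ
      simp only [hz τ hτ.1]
    intro t ht
    rw [huw t ht, ← hz t ht, hV.unique hzc hwc hze hw t ht]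
  · obtain ⟨⟨h1, h2⟩, h3⟩ := hwb t ht.le
    rw [hdw t ht.le, huw t ht.le, sqrtOp_j hE]
    change japanese t ^ (heatExp α q + 1) * _ * _ + japanese t ^ (heatExp α q + 1 / 2) * _ +
      japanese t ^ heatExp α q * _ ≤ _
    have hl : 0 < Real.log (2 + t) := by linarith [half_le_log ht.le]
    have k1 := japanese_rpow_mul_le ht.le hβ (norm_nonneg _) h1
    have k2 := japanese_rpow_mul_le ht.le (by positivity) (norm_nonneg _) h2
    have hL := Real.rpow_pos_of_pos hl (if q < 2 * α * (p - 1) then (0 : ℝ) else 1)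
    have k3 := japanese_rpow_mul_le ht.le (a := heatExp α q + 1)
      (B := c * dataNorm (resolution A) q w₀ u₁) (by positivity)
      (mul_nonneg (inv_nonneg.2 hL.le) (norm_nonneg _))
      ((inv_mul_le_iff₀ hL).2 (h3.trans_eq (by rw [mul_comm ((1 + t) ^ _), mul_left_comm])))
    rw [Real.rpow_neg hl.le, mul_assoc (japanese t ^ (heatExp α q + 1))]
    linarith
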